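/- **Conventions.** A *Lorentzian pre-length space* $(X,d,\ll,\leq,\tau)$ is a metric space $(X,d)$ with transitive relations $\ll\,\subseteq\,\leq$, where $\leq$ is reflexive, and a lower semicontinuous $\tau\colon X\times X\to[0,\infty]$ with $\tau(p,r)\ge\tau(p,q)+\tau(q,r)$ for $p\le q\le r$ and $\tau(p,q)>0\iff p\ll q$. A *future directed causal (timelike) curve* is a locally Lipschitz $\gamma\colon I\to X$ on a nondegenerate interval, not constant on any nondegenerate subinterval, with $\gamma(s)\le\gamma(t)$ ($\gamma(s)\ll\gamma(t)$) for $s<t$; its length $L_\tau(\gamma|_{[a,b]})$ is the infimum of $\sum_i\tau(\gamma(t_i),\gamma(t_{i+1}))$ over partitions of $[a,b]$. It is a *distance realizer* on $[a,b]$ if $L_\tau(\gamma|_{[a,b]})=\tau(\gamma(a),\gamma(b))$, and a *geodesic* if every parameter has a neighbourhood $[a,b]$ in $I$ with this property. Past directed curves are defined by reversing the relations. An open $U\subseteq X$ is *strictly timelike geodesically connected* if any $p\ll q$ in $U$ are joined by a future directed distance realizer in $U$ and every such realizer is timelike; $X$ is *locally* so if it is covered by such sets. $X$ is *locally causally closed*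 if every point has a neighbourhood $U$ such that $p_n\le q_n$ in $U$, $p_n\to p$, $q_n\to q$ imply $p\le q$; *strongly causal* if the diamonds $\{z: p\ll z\ll q\}$ form a subbase of the metric topology. $X$ satisfies *geodesic prolongation* if every causal geodesic on an interval $[b,c]$ extends to a causal geodesic on some $(a,e)$ with $a<b<c<e$. Let $\mathbb L^2(K)$ be the simply connected Lorentzian surface of constant curvature $K$ (universal cover of scaled de Sitter for $K>0$, the Minkowski plane for $K=0$, universal cover of scaled anti-de Sitter for $K<0$) with time separation $\bar\tau$; $D_K=\pi/\sqrt{-K}$ for $K<0$ and $D_K=\infty$ otherwise. A *timelike $\ge K$- ($\le K$-) comparison neighbourhood* is an open, strictly timelike geodesically connected $U$ on which $\tau|_{U\times U}$ is finite and continuous, such that for all $p_1\ll p_2\ll p_3$ in $U$ with $\tau(p_1,p_3)<D_K$, joined by future directed distance realizers in $U$, all comparison triangles $\bar p_1\bar p_2\bar p_3$ in $\mathbb L^2(K)$ (same time separations), and all points $q_1,q_2$ on the sides with corresponding points $\bar q_1,\bar q_2$ (same time separations to the endpoints of the side), $\tau(q_1,q_2)\le\bar\tau(\bar q_1,\bar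 q_2)$ (respectively $\ge$). $X$ has *timelike curvature bounded below (above)* by $K$ if it is covered by such neighbourhoods. For timelike curves $\alpha,\beta$ from $x$ (each future or past directed), $\measuredangle_x(\alpha,\beta)\in[0,\infty]$ is the $\limsup$, as $s,t\downarrow0$ through those $(s,t)$ for which $\alpha(s),\beta(t)$ are causally related, of the hyperbolic angle at $\bar x$ in a comparison triangle of $x,\alpha(s),\beta(t)$ in the Minkowski plane. **Proposition (continuity of angles).** Let $X$ be a locally strictly timelike geodesically connected and locally causally closed Lorentzian pre-length space, $x\in X$, and let $\alpha,\alpha_n,\beta,\beta_n\colon[0,B]\to X$ $(n\in\mathbb N)$ be timelike geodesics starting at $x$, where all $\alpha_n$ have the same time orientation as $\alpha$ and all $\beta_n$ the same as $\beta$, with $\alpha_n\to\alpha$ and $\beta_n\to\beta$ pointwise. Suppose that one of the following holds. 1. $X$ has timelike curvature bounded above by some $K\in\mathbb R$, and (a) $\alpha,\beta$ have the same time orientation, and there are a timelike $\le K$-comparison neighbourhood $U$ and $b\in(0,B]$ such that $\alpha_n([0,b])\cup\beta_n([0,b])\subseteq U$ for all large $n$ (this is automatic if $X$ is strongly causal);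 or (b) $\alpha,\beta$ have different time orientations, $X$ is strongly causal, and the angles $\measuredangle_x(\alpha,\beta)$, $\measuredangle_x(\alpha,\beta_n)$ and $\measuredangle_x(\alpha_n,\beta_n)$ are finite for all $n$. 2. $X$ has timelike curvature bounded below by some $K\in\mathbb R$, is strongly causal and satisfies geodesic prolongation, and there is $b\in(0,B]$ such that $\alpha_n|_{[0,b]}$ and $\beta_n|_{[0,b]}$ are distance realizers for all large $n$. Then $$\measuredangle_x(\alpha,\beta)=\lim_{n\to\infty}\measuredangle_x(\alpha_n,\beta_n).$$ -/

import Mathlib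

open Set Filter Topology
open scoped ENNReal

noncomputable section

/-- A Lorentzian pre-length space: a metric space `X` with a chronological relation `chron`,
a causal relation `caus` and a time separation function `tau`. -/
class LorentzianPreLengthSpace (X : Type*) [MetricSpace X] where
  /-- the timelike (chronological) relation -/
  chron : X → X → Prop
  /-- the causal relation -/
  caus : X → X → Prop
  /-- the time separation function -/
  tau : X → X → ℝ≥0∞
  chron_trans : ∀ {p q r : X}, chron p q → chron q r → chron p r
  caus_refl : ∀ p : X, caus p p
  caus_trans : ∀ {p q r : X}, caus p q → caus q r → caus p r
  caus_of_chron : ∀ {p q : X}, chron p q → caus p q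
  tau_lsc : LowerSemicontinuous fun z : X × X => tau z.1 z.2
  tau_reverse_triangle : ∀ {p q r : X}, caus p q → caus q r → tau p q + tau q r ≤ tau p r
  tau_pos_iff : ∀ {p q : X}, 0 < tau p q ↔ chron p q

namespace LorentzianPreLengthSpace

/-- The two time orientations a causal curve can have. -/
inductive TimeOrientation
  | future
  | past

section Curves

variable {X : Type*} [MetricSpace X] [LorentzianPreLengthSpace X]

/-- The chronological relation, reversed for past directed curves. -/
def chronO : TimeOrientation → X → X → Prop
  | .future, p, q => chron p q
  | .past, p, q => chron q p

/-- The causal relation, reversed for past directed curves. -/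
def causO : TimeOrientation → X → X → Prop
  | .future, p, q => caus p q
  | .past, p, q => caus q p

/-- The time separation, with reversed arguments for past directed curves. -/
def tauO : TimeOrientation → X → X → ℝ≥0∞
  | .future, p, q => tau p q
  | .past, p, q => tau q p

/-- `γ` restricted to the (nondegenerate) interval `I` is a causal curve of time orientation `o`:
locally Lipschitz, not constant on any nondegenerate subinterval, and increasing (decreasing, if
past directed) for the causal relation. -/
structure IsCausalCurve (o : TimeOrientation) (γ : ℝ → X) (I : Set ℝ) : Prop where
  ordConnected : I.OrdConnected
  nontrivial : I.Nontrivial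
  locallyLipschitz : LocallyLipschitzOn I γ
  nonconstant : ∀ s ∈ I, ∀ t ∈ I, s < t → ∃ u ∈ Icc s t, γ u ≠ γ s
  causal : ∀ s ∈ I, ∀ t ∈ I, s < t → causO o (γ s) (γ t)

/-- The condition for a causal curve of time orientation `o` on `I` to be timelike. -/
def IsTimelikeOn (o : TimeOrientation) (γ : ℝ → X) (I : Set ℝ) : Prop :=
  ∀ s ∈ I, ∀ t ∈ I, s < t → chronO o (γ s) (γ t)

/-- The `τ`-length of `γ` restricted to `[a, b]`: the infimum of `∑ τ(γ(tᵢ), γ(tᵢ₊₁))` over all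
partitions `a = t₀ < t₁ < ⋯ < tₙ = b`. -/
def tauLength (o : TimeOrientation) (γ : ℝ → X) (a b : ℝ) : ℝ≥0∞ :=
  ⨅ (n : ℕ) (t : ℕ → ℝ) (_ : StrictMonoOn t (Iic n)) (_ : t 0 = a) (_ : t n = b),
    ∑ i ∈ Finset.range n, tauO o (γ (t i)) (γ (t (i + 1)))

/-- `γ` restricted to `[a, b]` is a distance realizer (a maximal geodesic). -/
structure IsDistanceRealizer (o : TimeOrientation) (γ : ℝ → X) (a b : ℝ) : Prop where
  isCausalCurve : IsCausalCurve o γ (Icc a b)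
  tau_eq_length : tauO o (γ a) (γ b) = tauLength o γ a b

/-- A geodesic on the interval `I`: a causal curve each of whose parameters has a neighbourhood
`[a, b]` in `I` on which the curve realizes the time separation of its endpoints. -/
structure IsGeodesic (o : TimeOrientation) (γ : ℝ → X) (I : Set ℝ) : Prop where
  isCausalCurve : IsCausalCurve o γ I
  locally_realizing : ∀ t ∈ I, ∃ a b : ℝ, Icc a b ⊆ I ∧ Icc a b ∈ 𝓝[I] t ∧
    tauO o (γ a) (γ b) = tauLength o γ a b

/-- A timelike geodesic on the interval `I`. -/
structure IsTimelikeGeodesic (o : TimeOrientation) (γ : ℝ → X) (I : Set ℝ) : Prop where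
  isGeodesic : IsGeodesic o γ I
  isTimelike : IsTimelikeOn o γ I

/-- `γ` on `[a, b]` is a future directed distance realizer from `p` to `q` which runs in `U`. -/
structure IsRealizerFromToIn (U : Set X) (p q : X) (γ : ℝ → X) (a b : ℝ) : Prop where
  isDistanceRealizer : IsDistanceRealizer .future γ a b
  source : γ a = p
  target : γ b = q
  mem : ∀ t ∈ Icc a b, γ t ∈ U

/-- Strictly timelike geodesically connected open sets. -/
structure IsStrictlyTimelikeGeodesicallyConnected (U : Set X) : Prop where
  isOpen : IsOpen U
  exists_realizer : ∀ p ∈ U, ∀ q ∈ U, chron p q → ∃ γ a b, IsRealizerFromToIn U p q γ a b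
  timelike_of_realizer : ∀ p ∈ U, ∀ q ∈ U, chron p q → ∀ γ a b,
    IsRealizerFromToIn U p q γ a b → IsTimelikeOn .future γ (Icc a b)

end Curves

section SpaceProperties

variable (X : Type*) [MetricSpace X] [LorentzianPreLengthSpace X]

/-- `X` is covered by strictly timelike geodesically connected open sets. -/
def LocallyStrictlyTimelikeGeodesicallyConnected : Prop :=
  ∀ x : X, ∃ U : Set X, x ∈ U ∧ IsStrictlyTimelikeGeodesicallyConnected U

/-- Every point has a neighbourhood `U` such that causal relations between points of `U` persist
under limits (which then lie in the closure of `U`). -/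
def LocallyCausallyClosed : Prop :=
  ∀ z : X, ∃ U ∈ 𝓝 z, ∀ (p q : ℕ → X) (p' q' : X), (∀ n, p n ∈ U) → (∀ n, q n ∈ U) →
    (∀ n, caus (p n) (q n)) → Tendsto p atTop (𝓝 p') → Tendsto q atTop (𝓝 q') → caus p' q'

/-- Strong causality: the Alexandrov topology, which has the chronological diamonds
`I(p, q) = {z | p ≪ z ≪ q}` as a subbase, is the metric topology. -/
def StronglyCausal : Prop :=
  TopologicalSpace.generateFrom {S : Set X | ∃ p q : X, S = {z | chron p z ∧ chron z q}} =
    (inferInstance : TopologicalSpace X)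

/-- Every causal geodesic defined on a compact interval `[b, c]` can be prolonged, as a causal
geodesic, to an open interval `(a, e)` containing `[b, c]`. -/
def GeodesicProlongation : Prop :=
  ∀ (o : TimeOrientation) (γ : ℝ → X) (b c : ℝ), IsGeodesic o γ (Icc b c) →
    ∃ (a e : ℝ) (γ' : ℝ → X), a < b ∧ c < e ∧ IsGeodesic o γ' (Ioo a e) ∧ EqOn γ' γ (Icc b c)

end SpaceProperties

section Model

/-- The Lorentzian `K`-plane, the simply connected Lorentzian surface of constant curvature `K`,
in global conformal coordinates `(η, σ)`, in which its metric is
* `-dη² + dσ²` on `ℝ²` for `K = 0` (the Minkowski plane),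
* `(-dη² + dσ²) / (|K| cos² σ)` on `|σ| < π/2` for `K < 0` (universal cover of anti-de Sitter),
* `(-dη² + dσ²) / (K cos² η)` on `|η| < π/2` for `K > 0` (universal cover of de Sitter). -/
structure ModelPlane (K : ℝ) where
  /-- the time coordinate -/
  η : ℝ
  /-- the space coordinate -/
  σ : ℝ
  abs_σ_lt : K < 0 → |σ| < Real.pi / 2
  abs_η_lt : 0 < K → |η| < Real.pi / 2

/-- The inner product `-∑_{i < m} vᵢ wᵢ + ∑_{m ≤ i} vᵢ wᵢ` of `ℝ³_m`. -/
def pseudoInner (m : ℕ) (v w : Fin 3 → ℝ) : ℝ :=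
  ∑ i : Fin 3, (if (i : ℕ) < m then -(v i * w i) else v i * w i)

/-- The covering map of the `K`-plane, `K < 0`, onto the pseudo-sphere
`{v ∈ ℝ³₂ | ⟨v, v⟩ = 1 / K}`. -/
def coverNeg (K : ℝ) (p : ModelPlane K) : Fin 3 → ℝ :=
  ![Real.cos p.η / Real.cos p.σ / √(-K), Real.sin p.η / Real.cos p.σ / √(-K),
    Real.tan p.σ / √(-K)]

/-- The covering map of the `K`-plane, `K > 0`, onto the pseudo-sphere
`{v ∈ ℝ³₁ | ⟨v, v⟩ = 1 / K}`. -/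
def coverPos (K : ℝ) (p : ModelPlane K) : Fin 3 → ℝ :=
  ![Real.tan p.η / √K, Real.cos p.σ / Real.cos p.η / √K, Real.sin p.σ / Real.cos p.η / √K]

/-- The causal relation of the `K`-plane (the coordinates are conformal). -/
def ModelPlane.le {K : ℝ} (p q : ModelPlane K) : Prop :=
  |q.σ - p.σ| ≤ q.η - p.η

open Classical in
/-- The time separation function of the `K`-plane. For `p ≤ q` joined by a causal geodesic it is
given by `τ² = (Δη)² - (Δσ)²` for `K = 0`, by `cosh (√K τ) = K ⟨p, q⟩` for `K > 0`, and by
`cos (√(-K) τ) = K ⟨p, q⟩` for `K < 0`. For `K < 0` the points `p ≤ q` with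
`q.η - p.η > π - |p.σ + q.σ|` are joined by arbitrarily long causal curves. -/
def ModelPlane.tau {K : ℝ} (p q : ModelPlane K) : ℝ≥0∞ :=
  if p.le q then
    if K < 0 then
      if q.η - p.η ≤ Real.pi - |p.σ + q.σ| then
        ENNReal.ofReal (Real.arccos (K * pseudoInner 2 (coverNeg K p) (coverNeg K q)) / √(-K))
      else ⊤
    else if 0 < K then
      ENNReal.ofReal (Real.arcosh (K * pseudoInner 1 (coverPos K p) (coverPos K q)) / √K)
    else ENNReal.ofReal √((q.η - p.η) ^ 2 - (q.σ - p.σ) ^ 2)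
  else 0

/-- The timelike size bound for `K` on the longest side `a` of a triangle: `a < D_K`, where
`D_K = π / √(-K)` for `K < 0` and `D_K = ∞` for `K ≥ 0`. -/
def TimelikeSizeBound (K : ℝ) (a : ℝ≥0∞) : Prop :=
  a < ⊤ ∧ (K < 0 → a < ENNReal.ofReal (Real.pi / √(-K)))

/-- The scalar product `⟨y - x, z - x⟩` in the Minkowski plane. -/
def minkowskiInner (x y z : ModelPlane 0) : ℝ :=
  -((y.η - x.η) * (z.η - x.η)) + (y.σ - x.σ) * (z.σ - x.σ)

/-- The hyperbolic angle at `x` in the Minkowski plane between the segments from `x` to the points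
`y` and `z`, both timelike related to `x`: the `arcosh` of the absolute value of the scalar
product of the unit vectors in the directions of `y - x` and `z - x`. -/
def minkowskiAngle (x y z : ModelPlane 0) : ℝ :=
  Real.arcosh (|minkowskiInner x y z| / (√(-minkowskiInner x y y) * √(-minkowskiInner x z z)))

end Model

section Curvature

variable {X : Type*} [MetricSpace X] [LorentzianPreLengthSpace X]

/-- A timelike geodesic triangle in `U`: points `p 0 ≪ p 1 ≪ p 2` with finite time separations
and, for `i < j`, a future directed distance realizer `side i j` (on `[a i j, b i j]`)
from `p i` to `p j` which runs in `U`. -/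
structure TimelikeTriangle (U : Set X) where
  /-- the vertices -/
  p : Fin 3 → X
  /-- the sides -/
  side : Fin 3 → Fin 3 → ℝ → X
  /-- the initial parameters of the sides -/
  a : Fin 3 → Fin 3 → ℝ
  /-- the final parameters of the sides -/
  b : Fin 3 → Fin 3 → ℝ
  chron_vertices : ∀ i j, i < j → chron (p i) (p j)
  tau_lt_top : ∀ i j, i < j → tau (p i) (p j) < ⊤
  isRealizer : ∀ i j, i < j → IsRealizerFromToIn U (p i) (p j) (side i j) (a i j) (b i j)

/-- `q` lies on the side of the triangle from `p i` to `p j`. -/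
def TimelikeTriangle.OnSide {U : Set X} (Δ : TimelikeTriangle U) (i j : Fin 3) (q : X) : Prop :=
  i < j ∧ ∃ t ∈ Icc (Δ.a i j) (Δ.b i j), Δ.side i j t = q

/-- `p'` are the vertices of a comparison triangle in the `K`-plane. -/
def TimelikeTriangle.IsComparison {U : Set X} (Δ : TimelikeTriangle U) {K : ℝ}
    (p' : Fin 3 → ModelPlane K) : Prop :=
  ∀ i j, i < j → (p' i).tau (p' j) = tau (Δ.p i) (Δ.p j)

/-- `q'` is the point on the side from `p' i` to `p' j` of the comparison triangle with the same
time separations to the endpoints of the side as `q`. (As `τ(p' i, p' j)` is positive and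
`< D_K`, these conditions place `q'` on the geodesic segment from `p' i` to `p' j`.) -/
def TimelikeTriangle.Corresponds {U : Set X} (Δ : TimelikeTriangle U) {K : ℝ}
    (p' : Fin 3 → ModelPlane K) (i j : Fin 3) (q : X) (q' : ModelPlane K) : Prop :=
  (p' i).le q' ∧ q'.le (p' j) ∧
    (p' i).tau q' = tau (Δ.p i) q ∧ q'.tau (p' j) = tau q (Δ.p j)

/-- The conditions common to both kinds of comparison neighbourhoods. -/
structure IsComparisonDomain (U : Set X) : Prop where
  isOpen : IsOpen U
  tau_lt_top : ∀ p ∈ U, ∀ q ∈ U, tau p q < ⊤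
  tau_continuousOn : ContinuousOn (fun z : X × X => tau z.1 z.2) (U ×ˢ U)
  connected : IsStrictlyTimelikeGeodesicallyConnected U

/-- Timelike `≥ K`-comparison neighbourhoods. -/
structure IsComparisonNhdBelow (K : ℝ) (U : Set X) : Prop extends IsComparisonDomain U where
  comparison : ∀ Δ : TimelikeTriangle U, TimelikeSizeBound K (tau (Δ.p 0) (Δ.p 2)) →
    ∀ p' : Fin 3 → ModelPlane K, Δ.IsComparison p' →
    ∀ (i j k l : Fin 3) (q₁ q₂ : X) (q₁' q₂' : ModelPlane K),
      Δ.OnSide i j q₁ → Δ.OnSide k l q₂ →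
      Δ.Corresponds p' i j q₁ q₁' → Δ.Corresponds p' k l q₂ q₂' → tau q₁ q₂ ≤ q₁'.tau q₂'

/-- Timelike `≤ K`-comparison neighbourhoods. -/
structure IsComparisonNhdAbove (K : ℝ) (U : Set X) : Prop extends IsComparisonDomain U where
  comparison : ∀ Δ : TimelikeTriangle U, TimelikeSizeBound K (tau (Δ.p 0) (Δ.p 2)) →
    ∀ p' : Fin 3 → ModelPlane K, Δ.IsComparison p' →
    ∀ (i j k l : Fin 3) (q₁ q₂ : X) (q₁' q₂' : ModelPlane K),
      Δ.OnSide i j q₁ → Δ.OnSide k l q₂ →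
      Δ.Corresponds p' i j q₁ q₁' → Δ.Corresponds p' k l q₂ q₂' → q₁'.tau q₂' ≤ tau q₁ q₂

variable (X) in
/-- `X` has timelike curvature bounded below by `K`. -/
def TimelikeCurvatureBoundedBelow (K : ℝ) : Prop :=
  ∀ x : X, ∃ U : Set X, x ∈ U ∧ IsComparisonNhdBelow K U

variable (X) in
/-- `X` has timelike curvature bounded above by `K`. -/
def TimelikeCurvatureBoundedAbove (K : ℝ) : Prop :=
  ∀ x : X, ∃ U : Set X, x ∈ U ∧ IsComparisonNhdAbove K U

end Curvature

section Angles

variable {X : Type*} [MetricSpace X] [LorentzianPreLengthSpace X]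

/-- `p'` is a comparison triangle in the Minkowski plane for the triple `p` (which may be causally
ordered in any way): all time separations agree and causal relations are preserved. -/
def IsMinkowskiComparison (p : Fin 3 → X) (p' : Fin 3 → ModelPlane 0) : Prop :=
  ∀ i j, i ≠ j → (p' i).tau (p' j) = tau (p i) (p j) ∧ (caus (p i) (p j) → (p' i).le (p' j))

/-- The (Minkowski) comparison angle at `x` of causally related `x, y, z`, where `x` is timelike
related to `y` and `z`: the angle at `x'` in a comparison triangle `x', y', z'`. All comparison
triangles are isometric, hence they have the same angle and the supremum is its value. -/
def comparisonAngle (x y z : X) : ℝ≥0∞ :=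
  ⨆ (p' : Fin 3 → ModelPlane 0) (_ : IsMinkowskiComparison ![x, y, z] p'),
    ENNReal.ofReal (minkowskiAngle (p' 0) (p' 1) (p' 2))

/-- The upper angle, in `[0, ∞]`, at the common starting point `α 0 = β 0` of two timelike curves:
the limit superior of the comparison angles of `α 0, α s, β t` as `s, t ↓ 0` through those
parameters for which `α s` and `β t` are causally related. -/
def upperAngle (α β : ℝ → X) : ℝ≥0∞ :=
  limsup (fun z : ℝ × ℝ => comparisonAngle (α 0) (α z.1) (β z.2))
    ((𝓝[>] (0 : ℝ) ×ˢ 𝓝[>] (0 : ℝ)) ⊓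
      𝓟 {z : ℝ × ℝ | caus (α z.1) (β z.2) ∨ caus (β z.2) (α z.1)})

end Angles

end LorentzianPreLengthSpace

end

/-! Everything rests on the estimate `|∠(αₙ, βₙ) - ∠(α, β)| ≤ ∠(αₙ, α) + ∠(βₙ, β)`, which follows
from two uses of the triangle inequality for upper angles. Continuity is thereby reduced to `∠(αₙ,
α) → 0` and `∠(βₙ, β) → 0`.

Triangle inequality. Let `∠(α, β) < A` and `∠(β, γ) < B`, all curves having the same time
orientation. If `α s`, `γ t` had a Minkowski comparison angle above `A + B`, consider in the
Minkowski plane the hinge with the same sides and angle `A + B`. The segment between its endpoints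
crosses the ray at angle `A` at some distance `r` from the vertex (`exists_between_hinge`). The
curve `β` has a point at this distance, which lies causally between `α s` and `γ t`
(`exists_causO_of_mul_exp_lt`), and the law of cosines gives a broken path longer than `τ` allows.
If `γ` has the opposite orientation, the line from `γ t` through `α s` is prolonged until it meets
the ray of `β` (`exists_beyond_hinge`). This requires `s` much smaller than `t`, so `∠(α, γ)` has to
be a limit and not just an upper limit.

Monotonicity. `angleCosh` is the signed hyperbolic cosine of the `K`-comparison angle. As the sides
of a hinge shrink it decreases under an upper curvature bound and increases under a lower one, for
equal and for opposite time orientations (with timelike related endpoints in the lower bound case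
for equal orientations). For small triangles it is relatively close to its Minkowski value
(`exists_abs_angleCosh_sub_le`), so it computes upper angles, and monotonicity turns those between
opposite orientations into limits. The half-angle functions `snHalf`, `csHalf` give the laws of
cosines for all `K` one polynomial form.

Vanishing of `∠(αₙ, α)`. Under an upper bound this angle is at most the `K`-comparison angle of the
single pair `αₙ (e / 2)`, `α e`, which tends to that of a degenerate triangle on `α`, namely zero;
here timelike geodesics in a comparison neighbourhood are realizers
(`IsComparisonNhdAbove.isSepAdditiveOn`). Under a lower bound monotonicity points the other way for
equal orientations, so `α` is prolonged beyond `x` to a point `p`. The signed cosine of `αₙ` with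
the prolongation is bounded below by its value at one pair, which tends to `-1`. A Stewart type
inequality (`IsComparisonNhdBelow.hingeCosh_le_neg`) transfers this to the supplementary angle
between `αₙ` and `α`. -/

noncomputable section

namespace LorentzianPreLengthSpace

/-! ### Laws of cosines in half-angle form, uniformly in `K` -/

section Trigonometry

/-- The generalised half-angle sine. -/
def snHalf (K x : ℝ) : ℝ :=
  if K < 0 then 2 / √(-K) * Real.sin (√(-K) / 2 * x)
  else if 0 < K then 2 / √K * Real.sinh (√K / 2 * x) else x

/-- The generalised half-angle cosine. -/
def csHalf (K x : ℝ) : ℝ :=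
  if K < 0 then Real.cos (√(-K) / 2 * x) else if 0 < K then Real.cosh (√K / 2 * x) else 1

/-- `x` is a possible side length of a timelike triangle in the `K`-plane. -/
def IsSize (K x : ℝ) : Prop := 0 ≤ x ∧ (K < 0 → x < Real.pi / √(-K))

lemma snHalf_add (K x y : ℝ) :
    snHalf K (x + y) = snHalf K x * csHalf K y + csHalf K x * snHalf K y := by
  unfold snHalf csHalf
  split_ifs
  · rw [mul_add, Real.sin_add]; ring
  · rw [mul_add, Real.sinh_add]; ring
  · ring

lemma csHalf_sq (K x : ℝ) : csHalf K x ^ 2 = 1 + K / 4 * snHalf K x ^ 2 := by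
  unfold snHalf csHalf
  split_ifs with h h'
  · have h1 : √(-K) ^ 2 = -K := Real.sq_sqrt (by linarith)
    have h2 : √(-K) ≠ 0 := (Real.sqrt_pos.2 (by linarith)).ne'
    have : (2 / √(-K)) ^ 2 = 4 / (-K) := by rw [div_pow, h1]; norm_num
    rw [mul_pow, this, Real.cos_sq']
    have : K ≠ 0 := h.ne
    field_simp
    ring
  · have h1 : √K ^ 2 = K := Real.sq_sqrt (by linarith)
    have : (2 / √K) ^ 2 = 4 / K := by rw [div_pow, h1]; norm_num
    rw [mul_pow, this, Real.cosh_sq]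
    have : K ≠ 0 := h'.ne'
    field_simp
    ring
  · have : K = 0 := by linarith
    simp [this]

lemma snHalf_neg (K x : ℝ) : snHalf K (-x) = -snHalf K x := by
  unfold snHalf; split_ifs <;> simp

lemma csHalf_neg (K x : ℝ) : csHalf K (-x) = csHalf K x := by
  unfold csHalf; split_ifs <;> simp

lemma snHalf_zero (K : ℝ) : snHalf K 0 = 0 := by
  unfold snHalf; split_ifs <;> simp

lemma csHalf_zero (K : ℝ) : csHalf K 0 = 1 := by
  unfold csHalf; split_ifs <;> simp

lemma csHalf_add (K x y : ℝ) :
    csHalf K (x + y) = csHalf K x * csHalf K y + K / 4 * (snHalf K x * snHalf K y) := by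
  unfold snHalf csHalf
  split_ifs with h h'
  · have h1 : √(-K) * √(-K) = -K := Real.mul_self_sqrt (by linarith)
    have h2 : √(-K) ≠ 0 := (Real.sqrt_pos.2 (by linarith)).ne'
    have : K / 4 = - (√(-K) / 2 * (√(-K) / 2)) := by linarith
    rw [mul_add, Real.cos_add, this]
    field_simp
    ring
  · have h1 : √K * √K = K := Real.mul_self_sqrt (by linarith)
    have h2 : √K ≠ 0 := (Real.sqrt_pos.2 (by linarith)).ne'
    have : K / 4 = √K / 2 * (√K / 2) := by linarith
    rw [mul_add, Real.cosh_add, this]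
    field_simp
  · have : K = 0 := by linarith
    simp [this]

lemma snHalf_sub (K x y : ℝ) :
    snHalf K (x - y) = snHalf K x * csHalf K y - csHalf K x * snHalf K y := by
  rw [sub_eq_add_neg, snHalf_add, snHalf_neg, csHalf_neg]; ring

lemma snHalf_zero_left (x : ℝ) : snHalf 0 x = x := by simp [snHalf]

lemma csHalf_zero_left (x : ℝ) : csHalf 0 x = 1 := by simp [csHalf]

lemma continuous_snHalf (K : ℝ) : Continuous (snHalf K) := by
  unfold snHalf; split_ifs <;> fun_prop

lemma continuous_csHalf (K : ℝ) : Continuous (csHalf K) := by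
  unfold csHalf; split_ifs <;> fun_prop

lemma IsSize.half_lt {K x : ℝ} (h : IsSize K x) (hK : K < 0) :
    √(-K) / 2 * x < Real.pi / 2 := by
  have h1 := h.2 hK
  rw [lt_div_iff₀ (Real.sqrt_pos.2 (by linarith))] at h1
  linarith

lemma csHalf_pos {K x : ℝ} (h : IsSize K x) : 0 < csHalf K x := by
  have h0 := h.1
  unfold csHalf
  split_ifs with hK
  · have := h.half_lt hK
    exact Real.cos_pos_of_mem_Ioo ⟨by have := Real.pi_pos; have : 0 ≤ √(-K) / 2 * x := (by positivity); linarith, this⟩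
  · exact Real.cosh_pos _
  · exact one_pos

lemma snHalf_pos {K x : ℝ} (h : IsSize K x) (hx : 0 < x) : 0 < snHalf K x := by
  unfold snHalf
  split_ifs with hK hK'
  · have := h.half_lt hK
    have h2 : 0 < √(-K) := Real.sqrt_pos.2 (by linarith)
    exact mul_pos (by positivity) (Real.sin_pos_of_mem_Ioo ⟨by positivity, by linarith [Real.pi_pos]⟩)
  · have h2 : 0 < √K := Real.sqrt_pos.2 (by linarith)
    exact mul_pos (by positivity) (Real.sinh_pos_iff.2 (by positivity))
  · exact hx

lemma snHalf_strictMono {K x y : ℝ} (hx : 0 ≤ x) (hy : 0 ≤ y ∧ (K < 0 → y ≤ Real.pi / √(-K)))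
    (h : x < y) : snHalf K x < snHalf K y := by
  unfold snHalf
  split_ifs with hK hK'
  · have h2 : 0 < √(-K) := Real.sqrt_pos.2 (by linarith)
    have h1 := hy.2 hK
    rw [le_div_iff₀ h2] at h1
    refine mul_lt_mul_of_pos_left (Real.strictMonoOn_sin ?_ ?_ ?_) (by positivity)
    · have : 0 ≤ √(-K) / 2 * x := by positivity
      exact ⟨by linarith [Real.pi_pos], by nlinarith⟩
    · have : 0 ≤ √(-K) / 2 * y := mul_nonneg (by positivity) hy.1
      exact ⟨by linarith [Real.pi_pos], by linarith⟩
    · exact mul_lt_mul_of_pos_left h (by positivity)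
  · have h2 : 0 < √K := Real.sqrt_pos.2 (by linarith)
    exact mul_lt_mul_of_pos_left (Real.sinh_lt_sinh.2 (mul_lt_mul_of_pos_left h (by positivity)))
      (by positivity)
  · exact h

lemma snHalf_nonneg {K x : ℝ} (hx : 0 ≤ x ∧ (K < 0 → x ≤ Real.pi / √(-K))) :
    0 ≤ snHalf K x := by
  rcases hx.1.eq_or_lt with h | h
  · rw [← h, snHalf_zero]
  · simpa [snHalf_zero] using (snHalf_strictMono le_rfl hx h).le

lemma le_of_snHalf_sq_le {K x y : ℝ} (hx : 0 ≤ x ∧ (K < 0 → x ≤ Real.pi / √(-K))) (hy : 0 ≤ y)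
    (h : snHalf K x ^ 2 ≤ snHalf K y ^ 2) : x ≤ y := by
  by_contra! hlt
  have h1 := snHalf_strictMono hy hx hlt
  have h2 : 0 ≤ snHalf K y := snHalf_nonneg ⟨hy, fun hK => hlt.le.trans (hx.2 hK)⟩
  nlinarith

lemma snHalf_sq_le {K x y : ℝ} (hx : 0 ≤ x) (hy : 0 ≤ y ∧ (K < 0 → y ≤ Real.pi / √(-K)))
    (h : x ≤ y) : snHalf K x ^ 2 ≤ snHalf K y ^ 2 := by
  rcases h.eq_or_lt with h | h
  · rw [h]
  · exact pow_le_pow_left₀ (snHalf_nonneg ⟨hx, fun hK => h.le.trans (hy.2 hK)⟩)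
      (snHalf_strictMono hx hy h).le 2

lemma IsSize.weak {K x : ℝ} (h : IsSize K x) : 0 ≤ x ∧ (K < 0 → x ≤ Real.pi / √(-K)) :=
  ⟨h.1, fun hK => (h.2 hK).le⟩

lemma IsSize.mono {K x y : ℝ} (h : IsSize K x) (hy : 0 ≤ y) (hyx : y ≤ x) : IsSize K y :=
  ⟨hy, fun hK => hyx.trans_lt (h.2 hK)⟩

lemma exists_isSize (K : ℝ) : ∃ δ > 0, ∀ x, 0 ≤ x → x < δ → IsSize K x := by
  by_cases hK : K < 0
  · exact ⟨Real.pi / √(-K), div_pos Real.pi_pos (Real.sqrt_pos.2 (by linarith)),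
      fun x h0 hx => ⟨h0, fun _ => hx⟩⟩
  · exact ⟨1, one_pos, fun x h0 _ => ⟨h0, fun h => (hK h).elim⟩⟩

/-- The signed hyperbolic cosine of the `K`-comparison angle between sides of lengths `a` and `c`,
opposite to a side of length `b`: it is `≥ 1` if both sides have the same time orientation, and
`≤ -1` otherwise. -/
def angleCosh (K a c b : ℝ) : ℝ :=
  (snHalf K a ^ 2 * csHalf K c ^ 2 + snHalf K c ^ 2 * csHalf K a ^ 2 - snHalf K b ^ 2) /
    (2 * (snHalf K a * csHalf K a) * (snHalf K c * csHalf K c))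

lemma angleCosh_comm (K a c b : ℝ) : angleCosh K a c b = angleCosh K c a b := by
  unfold angleCosh; congr 1 <;> ring

lemma angleCosh_zero_left (a c b : ℝ) :
    angleCosh 0 a c b = (a ^ 2 + c ^ 2 - b ^ 2) / (2 * a * c) := by
  simp [angleCosh, snHalf_zero_left, csHalf_zero_left]

lemma angleCosh_denom_pos {K a c : ℝ} (ha : IsSize K a) (hc : IsSize K c) (ha0 : 0 < a)
    (hc0 : 0 < c) : 0 < 2 * (snHalf K a * csHalf K a) * (snHalf K c * csHalf K c) := by
  have := snHalf_pos ha ha0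
  have := snHalf_pos hc hc0
  have := csHalf_pos ha
  have := csHalf_pos hc
  positivity

lemma angleCosh_le_iff {K a c b F : ℝ} (ha : IsSize K a) (hc : IsSize K c) (ha0 : 0 < a)
    (hc0 : 0 < c) : angleCosh K a c b ≤ F ↔
      snHalf K a ^ 2 * csHalf K c ^ 2 + snHalf K c ^ 2 * csHalf K a ^ 2
        - 2 * (snHalf K a * csHalf K a) * (snHalf K c * csHalf K c) * F ≤ snHalf K b ^ 2 := by
  unfold angleCosh
  rw [div_le_iff₀ (angleCosh_denom_pos ha hc ha0 hc0)]
  constructor <;> intro h <;> linarith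

lemma le_angleCosh_iff {K a c b F : ℝ} (ha : IsSize K a) (hc : IsSize K c) (ha0 : 0 < a)
    (hc0 : 0 < c) : F ≤ angleCosh K a c b ↔ snHalf K b ^ 2 ≤
      snHalf K a ^ 2 * csHalf K c ^ 2 + snHalf K c ^ 2 * csHalf K a ^ 2
        - 2 * (snHalf K a * csHalf K a) * (snHalf K c * csHalf K c) * F := by
  unfold angleCosh
  rw [le_div_iff₀ (angleCosh_denom_pos ha hc ha0 hc0)]
  constructor <;> intro h <;> linarith

lemma snHalf_sq_angleCosh {K a c b : ℝ} (ha : IsSize K a) (hc : IsSize K c) (ha0 : 0 < a)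
    (hc0 : 0 < c) : snHalf K b ^ 2 =
      snHalf K a ^ 2 * csHalf K c ^ 2 + snHalf K c ^ 2 * csHalf K a ^ 2
        - 2 * (snHalf K a * csHalf K a) * (snHalf K c * csHalf K c) * angleCosh K a c b :=
  le_antisymm ((le_angleCosh_iff ha hc ha0 hc0).1 le_rfl)
    ((angleCosh_le_iff ha hc ha0 hc0).1 le_rfl)

/-- The reverse triangle inequality gives `b ≤ c - a`, and `c - a` is the third side of the
degenerate hinge with angle zero. -/
lemma one_le_angleCosh {K a c b : ℝ} (ha0 : 0 < a) (hb : 0 ≤ b) (hc : IsSize K c)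
    (h : a + b ≤ c) : 1 ≤ angleCosh K a c b := by
  have ha : IsSize K a := hc.mono ha0.le (by linarith)
  have hc0 : 0 < c := by linarith
  rw [le_angleCosh_iff ha hc ha0 hc0]
  have h1 := snHalf_sq_le hb (hc.mono (y := c - a) (by linarith) (by linarith)).weak
    (by linarith)
  rw [snHalf_sub] at h1
  linarith [h1]

lemma angleCosh_le_neg_one {K a c b : ℝ} (ha0 : 0 < a) (hc0 : 0 < c) (hb : IsSize K b)
    (h : a + c ≤ b) : angleCosh K a c b ≤ -1 := by
  have ha : IsSize K a := hb.mono ha0.le (by linarith)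
  have hc : IsSize K c := hb.mono hc0.le (by linarith)
  rw [angleCosh_le_iff ha hc ha0 hc0]
  have h1 := snHalf_sq_le (x := a + c) (by linarith) hb.weak h
  rw [snHalf_add] at h1
  linarith [h1]

lemma angleCosh_add {K a c : ℝ} (ha0 : 0 < a) (hc0 : 0 < c) (ha : IsSize K a) (hc : IsSize K c) :
    angleCosh K a c (a + c) = -1 := by
  have h := snHalf_add K a c
  apply le_antisymm
  · rw [angleCosh_le_iff ha hc ha0 hc0, h]; apply le_of_eq; ring
  · rw [le_angleCosh_iff ha hc ha0 hc0, h]; apply le_of_eq; ring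

lemma angleCosh_sub {K a c : ℝ} (ha0 : 0 < a) (hc0 : 0 < c) (ha : IsSize K a) (hc : IsSize K c) :
    angleCosh K a c (c - a) = 1 := by
  have h := snHalf_sub K c a
  apply le_antisymm
  · rw [angleCosh_le_iff ha hc ha0 hc0, h]; apply le_of_eq; ring
  · rw [le_angleCosh_iff ha hc ha0 hc0, h]; apply le_of_eq; ring

/-- Rigidity of the straight angle: the bound on the cosine says that `b` is at most the third side
`a + c` of the degenerate hinge. It is used to glue realizers. -/
lemma eq_add_of_neg_one_le_angleCosh {K a c b : ℝ} (ha0 : 0 < a) (hc0 : 0 < c) (hb : IsSize K b)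
    (h : a + c ≤ b) (hE : -1 ≤ angleCosh K a c b) : b = a + c := by
  have ha : IsSize K a := hb.mono ha0.le (by linarith)
  have hc : IsSize K c := hb.mono hc0.le (by linarith)
  rw [le_angleCosh_iff ha hc ha0 hc0] at hE
  refine le_antisymm (le_of_snHalf_sq_le hb.weak (by linarith) ?_) h
  rw [snHalf_add]
  linarith [hE]

/-- Here `sd`, `kd`, `st`, `kt` stand for squares of half-angle functions, and `s₀ * k + k₀ * s`,
`k₀ * k + q * (s₀ * s)` are the addition formulas for a side `a₀ + a`. The left side is the law of
cosines for the side `a₀ + a`, with its angle eliminated through the piece `a₀`. The right side is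
the law of cosines at the division point with the supplementary angle. -/
lemma stewart_identity {q s₀ k₀ s k sd kd st kt : ℝ} (h₀ : k₀ ^ 2 = 1 + q * s₀ ^ 2)
    (h : k ^ 2 = 1 + q * s ^ 2) (hd : kd = 1 + q * sd) (ht : kt = 1 + q * st) :
    s₀ * k₀ * ((s₀ * k + k₀ * s) ^ 2 * kd + sd * (k₀ * k + q * (s₀ * s)) ^ 2)
      - (s₀ * k + k₀ * s) * (k₀ * k + q * (s₀ * s)) * (s₀ ^ 2 * kd + sd * k₀ ^ 2 - st) =
    s₀ * k₀ * (s ^ 2 * kt + st * k ^ 2) + s * k * (s₀ ^ 2 * kt + st * k₀ ^ 2 - sd) := by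
  subst hd ht
  grind

/-- A form of Stewart's theorem. -/
lemma angleCosh_stewart {K a₀ a d₀ d₁ t : ℝ} (ha₀ : 0 < a₀) (ha : 0 < a) (hd₀ : 0 < d₀)
    (ht : 0 < t) (hA : IsSize K (a₀ + a)) (hd : IsSize K d₀) (ht' : IsSize K t)
    (h : angleCosh K (a₀ + a) d₀ d₁ ≤ angleCosh K a₀ d₀ t) :
    angleCosh K a t d₁ ≤ -angleCosh K a₀ t d₀ := by
  have hsa₀ : IsSize K a₀ := hA.mono ha₀.le (by linarith)
  have hsa : IsSize K a := hA.mono ha.le (by linarith)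
  rw [angleCosh_le_iff hsa ht' ha ht]
  rw [angleCosh_le_iff hA hd (by linarith) hd₀] at h
  have e1 := snHalf_sq_angleCosh (b := t) hsa₀ hd ha₀ hd₀
  have e2 := snHalf_sq_angleCosh (b := d₀) hsa₀ ht' ha₀ ht
  have p1 := mul_pos (snHalf_pos hsa₀ ha₀) (csHalf_pos hsa₀)
  have p2 := mul_pos (snHalf_pos hd hd₀) (csHalf_pos hd)
  have p3 := mul_pos (snHalf_pos ht' ht) (csHalf_pos ht')
  generalize angleCosh K a₀ d₀ t = F at *
  generalize angleCosh K a₀ t d₀ = F' at *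
  rw [snHalf_add, csHalf_add] at h
  have c0 := csHalf_sq K a₀
  have c1 := csHalf_sq K a
  have c2 := csHalf_sq K d₀
  have c3 := csHalf_sq K t
  generalize snHalf K a₀ = s0 at *
  generalize csHalf K a₀ = k0 at *
  generalize snHalf K a = s at *
  generalize csHalf K a = k at *
  generalize snHalf K d₀ = sd at *
  generalize csHalf K d₀ = kd at *
  generalize snHalf K t = st at *
  generalize csHalf K t = kt at *
  generalize snHalf K d₁ ^ 2 = h1 at *
  have key := stewart_identity c0 c1 c2 c3
  have h2 := mul_le_mul_of_nonneg_left h p1.le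
  refine le_of_mul_le_mul_left ?_ p1
  have e1' : 2 * (s0 * k0) * (sd * kd) * F = s0 ^ 2 * kd ^ 2 + sd ^ 2 * k0 ^ 2 - st ^ 2 := by
    linarith
  have e2' : 2 * (s0 * k0) * (st * kt) * F' = s0 ^ 2 * kt ^ 2 + st ^ 2 * k0 ^ 2 - sd ^ 2 := by
    linarith
  rw [← e1', ← e2'] at key
  linarith

lemma exists_abs_sub_le_of_hasDerivAt {f : ℝ → ℝ} (hf : HasDerivAt f 1 0) (h0 : f 0 = 0) {ε : ℝ}
    (hε : 0 < ε) : ∃ δ > 0, ∀ x, |x| < δ → |f x - x| ≤ ε * |x| := by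
  have h := (hasDerivAt_iff_isLittleO.1 hf).def hε
  obtain ⟨δ, hδ, h⟩ := Metric.eventually_nhds_iff.1 h
  refine ⟨δ, hδ, fun x hx => ?_⟩
  simpa [h0] using h (show dist x 0 < δ by simpa using hx)

lemma hasDerivAt_snHalf (K : ℝ) : HasDerivAt (snHalf K) 1 0 := by
  unfold snHalf
  split_ifs with hK hK'
  · have h2 : √(-K) ≠ 0 := (Real.sqrt_pos.2 (by linarith)).ne'
    have h := (((hasDerivAt_id (0 : ℝ)).const_mul (√(-K) / 2)).sin).const_mul (2 / √(-K))
    have e : 2 / √(-K) * (Real.cos (√(-K) / 2 * id 0) * (√(-K) / 2 * 1)) = 1 := by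
      simp only [id, mul_zero, Real.cos_zero]
      field_simp
    rwa [e] at h
  · have h2 : √K ≠ 0 := (Real.sqrt_pos.2 (by linarith)).ne'
    have h := (((hasDerivAt_id (0 : ℝ)).const_mul (√K / 2)).sinh).const_mul (2 / √K)
    have e : 2 / √K * (Real.cosh (√K / 2 * id 0) * (√K / 2 * 1)) = 1 := by
      simp only [id, mul_zero, Real.cosh_zero]
      field_simp
    rwa [e] at h
  · exact hasDerivAt_id _

lemma snHalf_sq_sub (K x y : ℝ) :
    snHalf K x ^ 2 - snHalf K y ^ 2 = snHalf K (x + y) * snHalf K (x - y) := by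
  rw [snHalf_add, snHalf_sub]
  linear_combination snHalf K y ^ 2 * csHalf_sq K x - snHalf K x ^ 2 * csHalf_sq K y

lemma abs_one_add_mul_sub_one_le {u v η : ℝ} (hu : |u| ≤ η) (hv : |v| ≤ η) (hη : η ≤ 1) :
    |(1 + u) * (1 + v) - 1| ≤ 3 * η := by
  have h : (1 + u) * (1 + v) - 1 = u + v + u * v := by ring
  have h3 : |u * v| ≤ η := by
    rw [abs_mul]; nlinarith [abs_nonneg u, abs_nonneg v]
  rw [h]
  calc |u + v + u * v| ≤ |u| + |v| + |u * v| := abs_add_three _ _ _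
    _ ≤ 3 * η := by linarith

lemma exists_eq_mul_one_add {x y η : ℝ} (hη : 0 ≤ η) (h : |y - x| ≤ η * |x|) :
    ∃ u, |u| ≤ η ∧ y = x * (1 + u) := by
  rcases eq_or_ne x 0 with rfl | hx
  · exact ⟨0, by simpa using hη, by simpa using h⟩
  · refine ⟨(y - x) / x, ?_, by field_simp; ring⟩
    rwa [abs_div, div_le_iff₀ (abs_pos.2 hx)]

set_option maxHeartbeats 1000000 in
/-- For small sides the comparison angles for different `K` agree up to a small relative error. -/
lemma exists_abs_angleCosh_sub_le (K : ℝ) {ε : ℝ} (hε : 0 < ε) : ∃ δ > 0, ∀ a c b : ℝ,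
    0 < a → a < δ → 0 < c → c < δ → 0 ≤ b → b < δ → 1 ≤ |angleCosh 0 a c b| →
      |angleCosh K a c b - angleCosh 0 a c b| ≤ ε * |angleCosh 0 a c b| := by
  -- The error of the numerator is at most `43 / 2 * η` times the Minkowski numerator, and dividing
  -- by `1 + w > 1 / 2` at most doubles it; `η ≤ 1 / 30` guarantees that `|w| < 1 / 2`.
  obtain ⟨η, hη, hη1, hη2⟩ : ∃ η > 0, η ≤ 1 / 30 ∧ 43 * η ≤ ε :=
    ⟨min (1 / 30) (ε / 43), by positivity, min_le_left _ _, by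
      linarith [min_le_right (1 / 30) (ε / 43)]⟩
  obtain ⟨δ₁, hδ₁, h₁⟩ := exists_abs_sub_le_of_hasDerivAt (hasDerivAt_snHalf K) (snHalf_zero K) hη
  obtain ⟨δ₂, hδ₂, h₂⟩ := Metric.continuous_iff.1 (continuous_csHalf K) 0 η hη
  have hcs : ∀ x, |x| < δ₂ → ∃ u, |u| ≤ η ∧ csHalf K x = 1 + u := fun x hx =>
    ⟨csHalf K x - 1, by simpa [csHalf_zero, Real.dist_eq] using (h₂ x (by simpa using hx)).le, by ring⟩
  have hsn : ∀ x, |x| < δ₁ → ∃ u, |u| ≤ η ∧ snHalf K x = x * (1 + u) := fun x hx =>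
    exists_eq_mul_one_add hη.le (h₁ x hx)
  -- This `δ₃` makes the curvature term, which is of order `K * (a * c) ^ 2`, small relative to `a *
  -- c`.
  obtain ⟨δ₃, hδ₃, h₃⟩ : ∃ δ₃ > 0, 32 * |K / 4| * δ₃ ^ 2 ≤ η := by
    have : Tendsto (fun x : ℝ => 32 * |K / 4| * x ^ 2) (𝓝[>] 0) (𝓝 (32 * |K / 4| * 0 ^ 2)) :=
      Tendsto.mono_left (Continuous.tendsto (by fun_prop) 0) nhdsWithin_le_nhds
    have h := this.eventually (ge_mem_nhds (show 32 * |K / 4| * (0 : ℝ) ^ 2 < η by simpa using hη))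
    obtain ⟨x, hx, hx0⟩ := (h.and self_mem_nhdsWithin).exists
    exact ⟨x, hx0, hx⟩
  refine ⟨min (δ₁ / 2) (min δ₂ δ₃), by positivity, fun a c b ha haδ hc hcδ hb hbδ hE => ?_⟩
  -- With `a ≤ c`, the bound `2 * a * c ≤ |N|` for the Minkowski numerator `N` also controls `a ^
  -- 2`.
  wlog hac : a ≤ c generalizing a c
  · have := this c a hc hcδ ha haδ (by rwa [angleCosh_comm]) (by linarith)
    rwa [angleCosh_comm K, angleCosh_comm 0]
  simp only [lt_min_iff] at haδ hcδ hbδ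
  have aa : |a| = a := abs_of_pos ha
  have ac : |c| = c := abs_of_pos hc
  obtain ⟨u₁, hu₁, e₁⟩ := hsn a (by rw [aa]; linarith)
  obtain ⟨u₂, hu₂, e₂⟩ := hsn c (by rw [ac]; linarith)
  obtain ⟨u₃, hu₃, e₃⟩ := hcs a (by rw [aa]; linarith)
  obtain ⟨u₄, hu₄, e₄⟩ := hcs c (by rw [ac]; linarith)
  obtain ⟨u₅, hu₅, e₅⟩ := hsn (c + b) (by rw [abs_of_pos (by linarith)]; linarith)
  obtain ⟨u₆, hu₆, e₆⟩ := hsn (c - b) (by rw [abs_lt]; constructor <;> linarith)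
  -- When `a` is much smaller than `c`, the numerator can be much smaller than `c ^ 2` and `b ^ 2`,
  -- so these must not be estimated separately. The factorization of `snHalf K c ^ 2 - snHalf K b ^
  -- 2` makes the error relative to `c ^ 2 - b ^ 2`.
  have hnum : snHalf K a ^ 2 * csHalf K c ^ 2 + snHalf K c ^ 2 * csHalf K a ^ 2 - snHalf K b ^ 2
      = a ^ 2 * ((1 + u₁) * (1 + u₁)) + (c ^ 2 - b ^ 2) * ((1 + u₅) * (1 + u₆))
        + 2 * (K / 4) * (a * c) ^ 2 * (((1 + u₁) * (1 + u₂)) ^ 2) := by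
    have h := snHalf_sq_sub K c b
    rw [e₅, e₆] at h
    rw [csHalf_sq, csHalf_sq]
    rw [e₂] at *
    rw [e₁]
    linear_combination h
  rw [angleCosh_zero_left] at hE ⊢
  have hD : 0 < 2 * a * c := by positivity
  set N := a ^ 2 + c ^ 2 - b ^ 2 with hN
  have hac' : a ^ 2 ≤ a * c := by rw [sq]; exact mul_le_mul_of_nonneg_left hac ha.le
  have hNge : 2 * a * c ≤ |N| := by
    rwa [abs_div, abs_of_pos hD, one_le_div hD] at hE
  obtain ⟨v₁, hv₁, f₁⟩ : ∃ v, |v| ≤ 3 * η ∧ (1 + u₁) * (1 + u₁) = 1 + v :=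
    ⟨_, abs_one_add_mul_sub_one_le hu₁ hu₁ (by linarith), by ring⟩
  obtain ⟨v₂, hv₂, f₂⟩ : ∃ v, |v| ≤ 3 * η ∧ (1 + u₅) * (1 + u₆) = 1 + v :=
    ⟨_, abs_one_add_mul_sub_one_le hu₅ hu₆ (by linarith), by ring⟩
  obtain ⟨v₃, hv₃, f₃⟩ : ∃ v, |v| ≤ 3 * η ∧ (1 + u₁) * (1 + u₂) = 1 + v :=
    ⟨_, abs_one_add_mul_sub_one_le hu₁ hu₂ (by linarith), by ring⟩
  obtain ⟨v₄, hv₄, f₄⟩ : ∃ v, |v| ≤ 3 * η ∧ (1 + u₃) * (1 + u₄) = 1 + v :=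
    ⟨_, abs_one_add_mul_sub_one_le hu₃ hu₄ (by linarith), by ring⟩
  obtain ⟨w, hw, g⟩ : ∃ w, |w| ≤ 3 * (3 * η) ∧ (1 + v₃) * (1 + v₄) = 1 + w :=
    ⟨_, abs_one_add_mul_sub_one_le hv₃ hv₄ (by linarith), by ring⟩
  have hden : 2 * (snHalf K a * csHalf K a) * (snHalf K c * csHalf K c) = 2 * a * c * (1 + w) := by
    rw [e₁, e₂, e₃, e₄, ← g, ← f₃, ← f₄]; ring
  have hw' := abs_le.1 hw
  have hw2 : 1 / 2 < 1 + w := by linarith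
  unfold angleCosh
  rw [hnum, hden, f₁, f₂, f₃]
  have hNu : |a ^ 2 * (1 + v₁) + (c ^ 2 - b ^ 2) * (1 + v₂) + 2 * (K / 4) * (a * c) ^ 2 * (1 + v₃) ^ 2
      - N * (1 + w)| ≤ 43 / 2 * η * |N| := by
    have : a ^ 2 * (1 + v₁) + (c ^ 2 - b ^ 2) * (1 + v₂) + 2 * (K / 4) * (a * c) ^ 2 * (1 + v₃) ^ 2
      - N * (1 + w) = (a ^ 2 * v₁ + (c ^ 2 - b ^ 2) * v₂)
        + (2 * (K / 4) * (a * c) ^ 2 * (1 + v₃) ^ 2 - N * w) := by rw [hN]; ring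
    rw [this]
    have t1 : |a ^ 2 * v₁| ≤ 3 / 2 * η * |N| := by
      rw [abs_mul, abs_of_nonneg (sq_nonneg a)]
      calc a ^ 2 * |v₁| ≤ (|N| / 2) * (3 * η) := by gcongr; linarith
        _ = _ := by ring
    have t2 : |(c ^ 2 - b ^ 2) * v₂| ≤ 9 / 2 * η * |N| := by
      have : |c ^ 2 - b ^ 2| ≤ 3 / 2 * |N| := by
        have e : c ^ 2 - b ^ 2 = N - a ^ 2 := by rw [hN]; ring
        rw [e]
        calc |N - a ^ 2| ≤ |N| + |a ^ 2| := abs_sub _ _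
          _ ≤ _ := by rw [abs_of_nonneg (sq_nonneg a)]; linarith
      rw [abs_mul]
      calc |c ^ 2 - b ^ 2| * |v₂| ≤ (3 / 2 * |N|) * (3 * η) := by gcongr
        _ = _ := by ring
    have t3 : |2 * (K / 4) * (a * c) ^ 2 * (1 + v₃) ^ 2| ≤ η * |N| := by
      have hb3 := abs_le.1 hv₃
      have : (1 + v₃) ^ 2 ≤ 4 := by
        have := sq_le_sq' (show -2 ≤ 1 + v₃ by linarith) (show 1 + v₃ ≤ 2 by linarith)
        linarith
      have h4 : a * c ≤ δ₃ ^ 2 := by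
        rw [sq]; exact mul_le_mul haδ.2.2.le hcδ.2.2.le hc.le hδ₃.le
      rw [abs_mul, abs_mul, abs_mul, abs_two, abs_of_nonneg (sq_nonneg (a * c)),
        abs_of_nonneg (sq_nonneg (1 + v₃))]
      calc 2 * |K / 4| * (a * c) ^ 2 * (1 + v₃) ^ 2 ≤ 2 * |K / 4| * (a * c * δ₃ ^ 2) * 4 := by
            have : (a * c) ^ 2 ≤ a * c * δ₃ ^ 2 := by rw [sq]; gcongr
            gcongr
        _ = 32 * |K / 4| * δ₃ ^ 2 * (a * c) / 4 := by ring
        _ ≤ η * (a * c) / 4 := by gcongr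
        _ ≤ η * |N| := by
          have := mul_le_mul_of_nonneg_left hNge hη.le
          have : 0 < η * (a * c) := by positivity
          linarith
    have t4 : |N * w| ≤ 9 * η * |N| := by
      rw [abs_mul]
      calc |N| * |w| ≤ |N| * (3 * (3 * η)) := by gcongr
        _ = _ := by ring
    calc _ ≤ |a ^ 2 * v₁ + (c ^ 2 - b ^ 2) * v₂| + |2 * (K / 4) * (a * c) ^ 2 * (1 + v₃) ^ 2 - N * w| :=
          abs_add_le _ _
      _ ≤ (|a ^ 2 * v₁| + |(c ^ 2 - b ^ 2) * v₂|)
          + (|2 * (K / 4) * (a * c) ^ 2 * (1 + v₃) ^ 2| + |N * w|) :=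
          add_le_add (abs_add_le _ _) (abs_sub _ _)
      _ ≤ _ := by
        have : 0 ≤ η * |N| := by positivity
        linarith
  have e : ∀ M : ℝ, M / (2 * a * c * (1 + w)) - N / (2 * a * c)
      = (M - N * (1 + w)) / (2 * a * c * (1 + w)) := by
    intro M
    have : 1 + w ≠ 0 := by linarith
    field_simp
  rw [e, abs_div, abs_div, abs_of_pos hD, abs_of_pos (show 0 < 2 * a * c * (1 + w) by
    apply mul_pos hD; linarith), div_le_iff₀ (by apply mul_pos hD; linarith)]
  calc _ ≤ 43 / 2 * η * |N| := hNu
    _ ≤ ε * |N| * (1 + w) := by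
      have h0 := abs_nonneg N
      have : 43 * η * |N| ≤ ε * |N| := by gcongr
      have := mul_le_mul_of_nonneg_left hw2.le (mul_nonneg hε.le h0)
      linarith
    _ = _ := by field_simp

end Trigonometry

/-! ### Hinges in the Minkowski plane -/

section Hyperbolic

/-- The pairs `s, k` and `t, l` are the hyperbolic sines and cosines of two angles. The ray dividing
a hinge into these angles cuts the segment between its endpoints in the ratio `a * s : c * t`; the
identity is the law of cosines for one part, cleared of denominators. -/
lemma hinge_identity {a c s t k l : ℝ} (hk : k ^ 2 = s ^ 2 + 1) (hl : l ^ 2 = t ^ 2 + 1) :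
    a ^ 2 * (a * s + c * t) ^ 2 + (a * c * (s * l + k * t)) ^ 2
      - 2 * a * (a * c * (s * l + k * t)) * k * (a * s + c * t)
      = (a * s) ^ 2 * (a ^ 2 + c ^ 2 - 2 * a * c * (k * l + s * t)) := by
  grind

/-- The third vertex on the segment between the endpoints of a hinge with angle `A + B`. -/
lemma exists_between_hinge {a c A B b : ℝ} (ha : 0 < a) (hac : a ≤ c) (hA : 0 < A) (hB : 0 < B)
    (hb : b ^ 2 < a ^ 2 + c ^ 2 - 2 * a * c * Real.cosh (A + B)) :
    ∃ r, a * Real.exp A < r ∧ r * Real.exp B < c ∧ ∀ b₁ b₂, 0 ≤ b₁ → 0 ≤ b₂ →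
      a ^ 2 + r ^ 2 - 2 * a * r * Real.cosh A ≤ b₁ ^ 2 →
      r ^ 2 + c ^ 2 - 2 * r * c * Real.cosh B ≤ b₂ ^ 2 → b < b₁ + b₂ := by
  have hc : 0 < c := ha.trans_le hac
  have sA := Real.sinh_pos_iff.2 hA
  have sB := Real.sinh_pos_iff.2 hB
  have kA := Real.cosh_sq A
  have kB := Real.cosh_sq B
  have eA := Real.cosh_add_sinh A
  have eB := Real.cosh_add_sinh B
  -- The squared third side factors into its null components. Its positivity, with `a ≤ c`, means `a
  -- * exp (A + B) < c`.
  have hk : a * Real.exp A < c * (Real.cosh B - Real.sinh B) := by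
    have hfac : a ^ 2 + c ^ 2 - 2 * a * c * Real.cosh (A + B)
        = (c - a * Real.exp (A + B)) * (c - a * Real.exp (-(A + B))) := by
      have : Real.exp (A + B) * Real.exp (-(A + B)) = 1 := by rw [← Real.exp_add]; simp
      rw [Real.cosh_eq]; linear_combination -a ^ 2 * this
    have h1 : 0 < c - a * Real.exp (-(A + B)) := by
      have : Real.exp (-(A + B)) < 1 := Real.exp_lt_one_iff.2 (by linarith)
      nlinarith
    have h2 : 0 < c - a * Real.exp (A + B) := by
      by_contra! h
      nlinarith [sq_nonneg b]
    have h3 : Real.exp B * Real.exp (-B) = 1 := by rw [← Real.exp_add]; simp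
    rw [Real.cosh_sub_sinh]
    rw [Real.exp_add] at h2
    have h4 := mul_pos h2 (Real.exp_pos (-B))
    have : (c - a * (Real.exp A * Real.exp B)) * Real.exp (-B)
      = c * Real.exp (-B) - a * Real.exp A := by linear_combination -(a * Real.exp A) * h3
    linarith
  have hD : 0 < a * Real.sinh A + c * Real.sinh B := by positivity
  rw [Real.cosh_add] at hb
  rw [← eA] at hk
  -- Additivity of area determines `r`: `a * c * sinh (A + B) = a * r * sinh A + r * c * sinh B`.
  refine ⟨a * c * Real.sinh (A + B) / (a * Real.sinh A + c * Real.sinh B), ?_, ?_, ?_⟩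
  · rw [lt_div_iff₀ hD, ← eA, Real.sinh_add]
    generalize Real.sinh A = s at *
    generalize Real.sinh B = t at *
    generalize Real.cosh A = k at *
    generalize Real.cosh B = l at *
    have := mul_lt_mul_of_pos_left hk (mul_pos ha sA)
    linarith
  · rw [div_mul_eq_mul_div, div_lt_iff₀ hD, ← eB, Real.sinh_add]
    have h2 := Real.exp_pos B
    rw [← eB] at h2
    generalize Real.sinh A = s at *
    generalize Real.sinh B = t at *
    generalize Real.cosh A = k at *
    generalize Real.cosh B = l at *
    have h1 := mul_lt_mul_of_pos_left hk (mul_pos hc sB)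
    have h3 := mul_lt_mul_of_pos_left h1 h2
    have e : (l + t) * (c * t * (c * (l - t))) = c * t * c := by
      linear_combination c ^ 2 * t * kB
    have e2 : c * (a * s + c * t) - a * c * (s * l + k * t) * (l + t)
        = c * t * c - (l + t) * (c * t * (a * (k + s))) := by
      linear_combination (-(a * c * s)) * kB
    linarith
  · intro b₁ b₂ hb₁ hb₂ h1 h2
    have hX := (sq_nonneg b).trans_lt hb
    rw [Real.sinh_add] at h1 h2
    generalize Real.sinh A = s at *
    generalize Real.sinh B = t at *
    generalize Real.cosh A = k at *
    generalize Real.cosh B = l at *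
    have e1 : a ^ 2 + (a * c * (s * l + k * t) / (a * s + c * t)) ^ 2
        - 2 * a * (a * c * (s * l + k * t) / (a * s + c * t)) * k
        = (a * s / (a * s + c * t)
          * √(a ^ 2 + c ^ 2 - 2 * a * c * (k * l + s * t))) ^ 2 := by
      rw [mul_pow, Real.sq_sqrt hX.le]
      have := hinge_identity (a := a) (c := c) kA kB
      generalize a * s + c * t = D at *
      field_simp
      refine mul_left_cancel₀ (pow_ne_zero 2 ha.ne') ?_
      linear_combination this
    have e2 : (a * c * (s * l + k * t) / (a * s + c * t)) ^ 2 + c ^ 2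
        - 2 * (a * c * (s * l + k * t) / (a * s + c * t)) * c * l
        = (c * t / (a * s + c * t)
          * √(a ^ 2 + c ^ 2 - 2 * a * c * (k * l + s * t))) ^ 2 := by
      rw [mul_pow, Real.sq_sqrt hX.le]
      have := hinge_identity (a := c) (c := a) kB kA
      rw [add_comm (c * t)] at this
      generalize a * s + c * t = D at *
      field_simp
      refine mul_left_cancel₀ (pow_ne_zero 2 hc.ne') ?_
      linear_combination this
    rw [e1] at h1
    rw [e2] at h2
    have f1 := (pow_le_pow_iff_left₀ (by positivity) hb₁ two_ne_zero).1 h1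
    have f2 := (pow_le_pow_iff_left₀ (by positivity) hb₂ two_ne_zero).1 h2
    have f4 : b < √(a ^ 2 + c ^ 2 - 2 * a * c * (k * l + s * t)) := Real.lt_sqrt_of_sq_lt hb
    generalize √(a ^ 2 + c ^ 2 - 2 * a * c * (k * l + s * t)) = X at *
    have f3 : a * s / (a * s + c * t) * X + c * t / (a * s + c * t) * X = X := by
      field_simp
    linarith

/-- The third vertex on the prolongation of a side of a triangle with angle `A + B`. -/
lemma exists_beyond_hinge {a c A B : ℝ} (ha : 0 < a) (hc : 0 < c) (hA : 0 < A) (hB : 0 < B)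
    (hac : 2 * (a * Real.sinh A) ≤ c * Real.sinh B) :
    ∃ r, a * Real.exp A < r ∧ r ≤ 2 * a * Real.sinh (A + B) / Real.sinh B ∧
      ∀ b b₁ b₂, 0 ≤ b → 0 ≤ b₁ → 0 ≤ b₂ →
      a ^ 2 + c ^ 2 + 2 * a * c * Real.cosh (A + B) < b ^ 2 →
      a ^ 2 + r ^ 2 - 2 * a * r * Real.cosh A ≤ b₁ ^ 2 →
      b₂ ^ 2 ≤ r ^ 2 + c ^ 2 + 2 * r * c * Real.cosh B → b₂ < b + b₁ := by
  have sA := Real.sinh_pos_iff.2 hA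
  have sB := Real.sinh_pos_iff.2 hB
  have kA := Real.cosh_sq A
  have kB := Real.cosh_sq B
  have eA := Real.cosh_add_sinh A
  have pA := Real.cosh_pos A
  have pB := Real.cosh_pos B
  have hlt : Real.sinh B < Real.cosh B := Real.sinh_lt_cosh B
  have hD : 0 < c * Real.sinh B - a * Real.sinh A := by
    have : 0 < a * Real.sinh A := by positivity
    linarith
  rw [Real.cosh_add, Real.sinh_add]
  generalize Real.sinh A = s at *
  generalize Real.sinh B = t at *
  generalize Real.cosh A = k at *
  generalize Real.cosh B = l at *
  -- The area relation again, with a minus sign: now the line through the two endpoints meets the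
  -- ray at angle `A` beyond the endpoint of `a`. The hypothesis `hac` keeps the denominator above
  -- half of `c * t`, whence the bound on `r`.
  refine ⟨a * c * (s * l + k * t) / (c * t - a * s), ?_, ?_, ?_⟩
  · rw [lt_div_iff₀ hD, ← eA]
    have h1 : 0 < a * (c * s * (l - t)) := by have := sub_pos.2 hlt; positivity
    have h2 : 0 < a * (a * s * (k + s)) := by positivity
    linarith
  · rw [div_le_div_iff₀ hD sB]
    have : 0 < a * (s * l + k * t) := by positivity
    nlinarith
  · intro b b₁ b₂ hb hb₁ hb₂ h h1 h2
    have hX : 0 < a ^ 2 + c ^ 2 + 2 * a * c * (k * l + s * t) := by positivity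
    have hX' := hX
    -- Changing the sign of `a` reflects one side in the vertex and thus treats opposite time
    -- orientations.
    have i1 := hinge_identity (a := -a) (c := c) kA kB
    have i2 := hinge_identity (a := c) (c := -a) kB kA
    have r1 : -a * s + c * t = c * t - a * s := by ring
    have r2 : c * t + -a * s = c * t - a * s := by ring
    rw [r1] at i1
    rw [r2] at i2
    have e1 : a ^ 2 + (a * c * (s * l + k * t) / (c * t - a * s)) ^ 2
        - 2 * a * (a * c * (s * l + k * t) / (c * t - a * s)) * k
        = (a * s / (c * t - a * s)
          * √(a ^ 2 + c ^ 2 + 2 * a * c * (k * l + s * t))) ^ 2 := by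
      rw [mul_pow, Real.sq_sqrt hX.le]
      generalize c * t - a * s = D at *
      field_simp
      refine mul_left_cancel₀ (pow_ne_zero 2 ha.ne') ?_
      linear_combination i1
    have e2 : (a * c * (s * l + k * t) / (c * t - a * s)) ^ 2 + c ^ 2
        + 2 * (a * c * (s * l + k * t) / (c * t - a * s)) * c * l
        = (c * t / (c * t - a * s)
          * √(a ^ 2 + c ^ 2 + 2 * a * c * (k * l + s * t))) ^ 2 := by
      rw [mul_pow, Real.sq_sqrt hX.le]
      generalize c * t - a * s = D at *
      field_simp
      refine mul_left_cancel₀ (pow_ne_zero 2 hc.ne') ?_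
      linear_combination i2
    rw [e1] at h1
    rw [e2] at h2
    have f1 := (pow_le_pow_iff_left₀ (by positivity) hb₁ two_ne_zero).1 h1
    have f2 := (pow_le_pow_iff_left₀ hb₂ (by positivity) two_ne_zero).1 h2
    have f4 : √(a ^ 2 + c ^ 2 + 2 * a * c * (k * l + s * t)) < b := by
      rw [Real.sqrt_lt hX.le hb]; exact h
    generalize √(a ^ 2 + c ^ 2 + 2 * a * c * (k * l + s * t)) = X at *
    have f3 : a * s / (c * t - a * s) * X + X = c * t / (c * t - a * s) * X := by
      field_simp
      ring
    linarith

end Hyperbolic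


/-! ### Null coordinates on the `K`-plane -/

section Chart

lemma sin_arctan_eq_cos_mul (x : ℝ) :
    Real.sin (Real.arctan x) = Real.cos (Real.arctan x) * x := by
  rw [Real.sin_arctan, Real.cos_arctan]; ring

lemma cos_arctan_sub_arctan (u v : ℝ) : Real.cos (Real.arctan u - Real.arctan v)
    = Real.cos (Real.arctan u) * Real.cos (Real.arctan v) * (1 + u * v) := by
  rw [Real.cos_sub, sin_arctan_eq_cos_mul u, sin_arctan_eq_cos_mul v]
  ring

/-- The cosine of the difference has the sign of `1 + u * v`, and the difference is too small in
absolute value for its cosine to become positive again beyond `π / 2`. This turns the domain of the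
null coordinates into the coordinate bounds of `ModelPlane`. -/
lemma abs_arctan_sub_lt {u v : ℝ} (h : 0 < 1 + u * v) :
    |Real.arctan u - Real.arctan v| < Real.pi / 2 := by
  by_contra! h'
  have h1 := cos_arctan_sub_arctan u v
  rw [← Real.cos_abs] at h1
  have h2 : 0 < Real.cos (Real.arctan u) * Real.cos (Real.arctan v) * (1 + u * v) :=
    mul_pos (mul_pos (Real.cos_arctan_pos u) (Real.cos_arctan_pos v)) h
  have h3 : |Real.arctan u - Real.arctan v| ≤ Real.pi + Real.pi / 2 := by
    have := Real.arctan_lt_pi_div_two u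
    have := Real.arctan_lt_pi_div_two v
    have := Real.neg_pi_div_two_lt_arctan u
    have := Real.neg_pi_div_two_lt_arctan v
    have := Real.pi_pos
    rw [abs_le]; constructor <;> linarith
  linarith [Real.cos_nonpos_of_pi_div_two_le_of_le h' h3]

lemma arctan_sub_le {u v : ℝ} (h : 0 ≤ 1 + u * v) :
    Real.arctan u - Real.arctan v ≤ Real.pi / 2 := by
  by_contra! h'
  have h1 := cos_arctan_sub_arctan u v
  have h2 : 0 ≤ Real.cos (Real.arctan u) * Real.cos (Real.arctan v) * (1 + u * v) :=
    mul_nonneg (mul_pos (Real.cos_arctan_pos u) (Real.cos_arctan_pos v)).le h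
  have h3 : Real.arctan u - Real.arctan v < Real.pi + Real.pi / 2 := by
    have := Real.arctan_lt_pi_div_two u
    have := Real.neg_pi_div_two_lt_arctan v
    have := Real.pi_pos
    linarith
  linarith [Real.cos_neg_of_pi_div_two_lt_of_lt h' h3]

/-- The coordinate change from conformally flat null coordinates to those of `ModelPlane`. -/
def nullCoord (K U : ℝ) : ℝ := if K = 0 then U / 2 else Real.arctan (√|K| / 2 * U)

lemma strictMono_nullCoord (K : ℝ) : StrictMono (nullCoord K) := by
  intro x y h
  unfold nullCoord
  split_ifs with hK
  · linarith
  · have : 0 < √|K| := Real.sqrt_pos.2 (abs_pos.2 hK)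
    exact Real.arctan_strictMono (mul_lt_mul_of_pos_left h (by positivity))

lemma half_sqrt_mul (K U V : ℝ) : √|K| / 2 * U * (√|K| / 2 * V) = |K| / 4 * (U * V) := by
  have : √|K| * √|K| = |K| := Real.mul_self_sqrt (abs_nonneg K)
  linear_combination U * V / 4 * this

/-- The point of the `K`-plane with null coordinates `U`, `V`, in which the metric is
`-dU dV / (1 - K U V / 4)²`. -/
def chart {K : ℝ} (U V : ℝ) (h : 0 < 1 - K / 4 * (U * V)) : ModelPlane K where
  η := nullCoord K U + nullCoord K V
  σ := nullCoord K U - nullCoord K V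
  abs_σ_lt hK := by
    simp only [nullCoord, hK.ne, if_false]
    apply abs_arctan_sub_lt
    rw [half_sqrt_mul, abs_of_neg hK]
    linarith
  abs_η_lt hK := by
    simp only [nullCoord, hK.ne', if_false]
    have := abs_arctan_sub_lt (u := √|K| / 2 * U) (v := -(√|K| / 2 * V)) (by
      rw [mul_neg, half_sqrt_mul, abs_of_pos hK]; linarith)
    rwa [Real.arctan_neg, sub_neg_eq_add] at this

variable {K U V U' V' : ℝ}

lemma chart_le_chart {h : 0 < 1 - K / 4 * (U * V)} {h' : 0 < 1 - K / 4 * (U' * V')} :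
    (chart U V h).le (chart U' V' h') ↔ U ≤ U' ∧ V ≤ V' := by
  rw [← (strictMono_nullCoord K).le_iff_le, ← (strictMono_nullCoord K).le_iff_le (a := V)]
  simp only [ModelPlane.le, chart, abs_le]
  constructor
  · rintro ⟨h1, h2⟩; constructor <;> linarith
  · rintro ⟨h1, h2⟩; constructor <;> linarith

lemma coverNeg_chart (hK : K < 0) (h : 0 < 1 - K / 4 * (U * V)) : coverNeg K (chart U V h) =
    ![(1 - √(-K) / 2 * U * (√(-K) / 2 * V)) / (1 + √(-K) / 2 * U * (√(-K) / 2 * V)) / √(-K),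
      (√(-K) / 2 * U + √(-K) / 2 * V) / (1 + √(-K) / 2 * U * (√(-K) / 2 * V)) / √(-K),
      (√(-K) / 2 * U - √(-K) / 2 * V) / (1 + √(-K) / 2 * U * (√(-K) / 2 * V)) / √(-K)] := by
  simp only [coverNeg, chart, nullCoord, hK.ne, if_false, abs_of_neg hK, Real.tan_eq_sin_div_cos]
  generalize √(-K) / 2 * U = u
  generalize √(-K) / 2 * V = v
  have hc := mul_ne_zero (Real.cos_arctan_pos u).ne' (Real.cos_arctan_pos v).ne'
  rw [← mul_div_mul_left (1 - u * v) _ hc, ← mul_div_mul_left (u + v) _ hc,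
    ← mul_div_mul_left (u - v) _ hc]
  simp only [Real.cos_add, Real.cos_sub, Real.sin_add, Real.sin_sub, sin_arctan_eq_cos_mul]
  congr 1
  · ring
  · congr 1
    · ring
    · congr 1
      ring

lemma coverPos_chart (hK : 0 < K) (h : 0 < 1 - K / 4 * (U * V)) : coverPos K (chart U V h) =
    ![(√K / 2 * U + √K / 2 * V) / (1 - √K / 2 * U * (√K / 2 * V)) / √K,
      (1 + √K / 2 * U * (√K / 2 * V)) / (1 - √K / 2 * U * (√K / 2 * V)) / √K,
      (√K / 2 * U - √K / 2 * V) / (1 - √K / 2 * U * (√K / 2 * V)) / √K] := by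
  simp only [coverPos, chart, nullCoord, hK.ne', if_false, abs_of_pos hK, Real.tan_eq_sin_div_cos]
  generalize √K / 2 * U = u
  generalize √K / 2 * V = v
  have hc := mul_ne_zero (Real.cos_arctan_pos u).ne' (Real.cos_arctan_pos v).ne'
  rw [← mul_div_mul_left (1 + u * v) _ hc, ← mul_div_mul_left (u + v) _ hc,
    ← mul_div_mul_left (u - v) _ hc]
  simp only [Real.cos_add, Real.cos_sub, Real.sin_add, Real.sin_sub, sin_arctan_eq_cos_mul]
  congr 1
  · ring
  · congr 1
    · ring
    · congr 1
      ring

lemma mul_pseudoInner_coverNeg (hK : K < 0) (h : 0 < 1 - K / 4 * (U * V))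
    (h' : 0 < 1 - K / 4 * (U' * V')) :
    K * pseudoInner 2 (coverNeg K (chart U V h)) (coverNeg K (chart U' V' h'))
      = 1 + K / 2 * ((U' - U) * (V' - V) / ((1 - K / 4 * (U * V)) * (1 - K / 4 * (U' * V')))) := by
  have hk2 : √(-K) ^ 2 = -K := Real.sq_sqrt (by linarith)
  have hk : √(-K) ≠ 0 := (Real.sqrt_pos.2 (by linarith)).ne'
  rw [coverNeg_chart hK, coverNeg_chart hK]
  simp only [pseudoInner, Fin.sum_univ_three]
  simp
  have hK' : K = -√(-K) ^ 2 := by rw [hk2, neg_neg]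
  generalize √(-K) = k at *
  subst hK'
  have e1 : 1 + k / 2 * U * (k / 2 * V) ≠ 0 := by intro h0; apply h.ne'; linarith
  have e2 : 1 + k / 2 * U' * (k / 2 * V') ≠ 0 := by intro h0; apply h'.ne'; linarith
  have e3 : 1 - -k ^ 2 / 4 * (U * V) = 1 + k / 2 * U * (k / 2 * V) := by ring
  have e4 : 1 - -k ^ 2 / 4 * (U' * V') = 1 + k / 2 * U' * (k / 2 * V') := by ring
  rw [e3, e4]
  generalize hD : 1 + k / 2 * U * (k / 2 * V) = D at *
  generalize hD' : 1 + k / 2 * U' * (k / 2 * V') = D' at *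
  field_simp
  subst hD hD'
  ring

lemma mul_pseudoInner_coverPos (hK : 0 < K) (h : 0 < 1 - K / 4 * (U * V))
    (h' : 0 < 1 - K / 4 * (U' * V')) :
    K * pseudoInner 1 (coverPos K (chart U V h)) (coverPos K (chart U' V' h'))
      = 1 + K / 2 * ((U' - U) * (V' - V) / ((1 - K / 4 * (U * V)) * (1 - K / 4 * (U' * V')))) := by
  have hk2 : √K ^ 2 = K := Real.sq_sqrt (by linarith)
  have hk : √K ≠ 0 := (Real.sqrt_pos.2 (by linarith)).ne'
  rw [coverPos_chart hK, coverPos_chart hK]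
  simp only [pseudoInner, Fin.sum_univ_three]
  simp
  have hK' : K = √K ^ 2 := hk2.symm
  generalize √K = k at *
  subst hK'
  have e1 : 1 - k / 2 * U * (k / 2 * V) ≠ 0 := by intro h0; apply h.ne'; linarith
  have e2 : 1 - k / 2 * U' * (k / 2 * V') ≠ 0 := by intro h0; apply h'.ne'; linarith
  have e3 : 1 - k ^ 2 / 4 * (U * V) = 1 - k / 2 * U * (k / 2 * V) := by ring
  have e4 : 1 - k ^ 2 / 4 * (U' * V') = 1 - k / 2 * U' * (k / 2 * V') := by ring
  rw [e3, e4]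
  generalize hD : 1 - k / 2 * U * (k / 2 * V) = D at *
  generalize hD' : 1 - k / 2 * U' * (k / 2 * V') = D' at *
  field_simp
  subst hD hD'
  ring

/-- Write `G` for the quotient on the right. For `K ≠ 0` the invariant `K⟨p, q⟩` equals `1 + K / 2 *
G`, and the half-angle formulas turn this into `snHalf K T ^ 2 = G`; for `K = 0`, `G` is the squared
distance itself. The hypothesis `hbr` excludes, for `K < 0`, the pairs with infinite separation. -/
lemma exists_tau_chart (h : 0 < 1 - K / 4 * (U * V)) (h' : 0 < 1 - K / 4 * (U' * V'))
    (hU : U ≤ U') (hV : V ≤ V')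
    (hbr : K < 0 → 0 ≤ 1 - K / 4 * (U' * V) ∧ 0 ≤ 1 - K / 4 * (V' * U)) :
    ∃ T, 0 ≤ T ∧ (K < 0 → T ≤ Real.pi / √(-K)) ∧
      snHalf K T ^ 2 = (U' - U) * (V' - V) / ((1 - K / 4 * (U * V)) * (1 - K / 4 * (U' * V'))) ∧
      (chart U V h).tau (chart U' V' h') = ENNReal.ofReal T := by
  have hle : (chart U V h).le (chart U' V' h') := chart_le_chart.2 ⟨hU, hV⟩
  have hG : 0 ≤ (U' - U) * (V' - V) / ((1 - K / 4 * (U * V)) * (1 - K / 4 * (U' * V'))) :=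
    div_nonneg (mul_nonneg (by linarith) (by linarith)) (mul_pos h h').le
  unfold ModelPlane.tau
  rw [if_pos hle]
  rcases lt_trichotomy K 0 with hK | hK | hK
  · have hk : 0 < √(-K) := Real.sqrt_pos.2 (by linarith)
    have hk2 : √(-K) ^ 2 = -K := Real.sq_sqrt (by linarith)
    obtain ⟨b1, b2⟩ := hbr hK
    have hbranch : (chart U' V' h').η - (chart U V h).η
        ≤ Real.pi - |(chart U V h).σ + (chart U' V' h').σ| := by
      have f1 := arctan_sub_le (u := √|K| / 2 * U') (v := √|K| / 2 * V)
        (by rw [half_sqrt_mul, abs_of_neg hK]; linarith)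
      have f2 := arctan_sub_le (u := √|K| / 2 * V') (v := √|K| / 2 * U)
        (by rw [half_sqrt_mul, abs_of_neg hK]; linarith)
      simp only [chart, nullCoord, hK.ne, if_false]
      rw [le_sub_comm, abs_le]
      constructor <;> linarith
    rw [if_pos hK, if_pos hbranch, mul_pseudoInner_coverNeg hK]
    have hG1 : -K / 4 * ((U' - U) * (V' - V) / ((1 - K / 4 * (U * V)) * (1 - K / 4 * (U' * V'))))
        ≤ 1 := by
      rw [mul_div_assoc', div_le_one (mul_pos h h')]
      have := mul_nonneg b1 b2
      linarith
    generalize (U' - U) * (V' - V) / ((1 - K / 4 * (U * V)) * (1 - K / 4 * (U' * V'))) = G at *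
    refine ⟨_, div_nonneg (Real.arccos_nonneg _) hk.le, fun _ => ?_, ?_, rfl⟩
    · gcongr; exact Real.arccos_le_pi _
    · have hc : Real.cos (Real.arccos (1 + K / 2 * G)) = 1 + K / 2 * G :=
        Real.cos_arccos (by linarith) (by nlinarith)
      rw [snHalf, if_pos hK, mul_pow, Real.sin_sq_eq_half_sub, div_pow, hk2]
      have : 2 * (√(-K) / 2 * (Real.arccos (1 + K / 2 * G) / √(-K))) = Real.arccos (1 + K / 2 * G) := by
        field_simp
      rw [this, hc]
      have := hK.ne
      field_simp
      ring
  · subst hK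
    simp only [lt_irrefl, if_false]
    refine ⟨_, Real.sqrt_nonneg _, fun h0 => h0.elim, ?_, rfl⟩
    rw [snHalf_zero_left]
    simp only [chart, nullCoord, if_true]
    rw [Real.sq_sqrt]
    · ring
    · have : 0 ≤ (U' - U) * (V' - V) := mul_nonneg (by linarith) (by linarith)
      linarith
  · have hk : 0 < √K := Real.sqrt_pos.2 (by linarith)
    have hk2 : √K ^ 2 = K := Real.sq_sqrt (by linarith)
    rw [if_neg hK.not_gt, if_pos hK, mul_pseudoInner_coverPos hK]
    generalize (U' - U) * (V' - V) / ((1 - K / 4 * (U * V)) * (1 - K / 4 * (U' * V'))) = G at *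
    have h1 : 1 ≤ 1 + K / 2 * G := by have : 0 ≤ K / 2 * G := by positivity
                                      linarith
    refine ⟨_, div_nonneg (Real.arcosh_nonneg h1) hk.le, fun h0 => (h0.not_gt hK).elim, ?_, rfl⟩
    have hc := Real.cosh_arcosh h1
    have h2 := Real.cosh_two_mul (√K / 2 * (Real.arcosh (1 + K / 2 * G) / √K))
    have : 2 * (√K / 2 * (Real.arcosh (1 + K / 2 * G) / √K)) = Real.arcosh (1 + K / 2 * G) := by
      field_simp
    rw [this, hc, Real.cosh_sq] at h2
    rw [snHalf, if_neg hK.not_gt, if_pos hK, mul_pow, div_pow, hk2]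
    have := hK.ne'
    generalize Real.sinh _ = S at *
    field_simp
    linarith

end Chart


/-! ### Polar coordinates and the law of cosines in the `K`-plane -/

section Polar

/-- The causal relation of the `K`-plane, reversed for the past orientation. -/
def ModelPlane.leO {K : ℝ} : TimeOrientation → ModelPlane K → ModelPlane K → Prop
  | .future, p, q => p.le q
  | .past, p, q => q.le p

/-- The time separation of the `K`-plane, with reversed arguments for the past orientation. -/
def ModelPlane.tauO {K : ℝ} : TimeOrientation → ModelPlane K → ModelPlane K → ℝ≥0∞
  | .future, p, q => p.tau q
  | .past, p, q => q.tau p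

/-- The sign of a time orientation. -/
def TimeOrientation.sign : TimeOrientation → ℝ
  | .future => 1
  | .past => -1

/-- The reversed time orientation. -/
def TimeOrientation.rev : TimeOrientation → TimeOrientation
  | .future => .past
  | .past => .future

lemma TimeOrientation.sign_mul_self (o : TimeOrientation) : o.sign * o.sign = 1 := by
  cases o <;> norm_num [sign]

variable {K : ℝ}

/-- The generalised half-angle tangent. -/
def tnHalf (K x : ℝ) : ℝ := snHalf K x / csHalf K x

lemma tnHalf_zero (K : ℝ) : tnHalf K 0 = 0 := by simp [tnHalf, snHalf_zero]

lemma tnHalf_nonneg {a : ℝ} (ha : IsSize K a) : 0 ≤ tnHalf K a :=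
  div_nonneg (snHalf_nonneg ha.weak) (csHalf_pos ha).le

lemma tnHalf_mono {a b : ℝ} (ha : 0 ≤ a) (hb : IsSize K b) (hab : a ≤ b) :
    tnHalf K a ≤ tnHalf K b := by
  have ha' := hb.mono ha hab
  have h := snHalf_nonneg (hb.mono (y := b - a) (by linarith) (by linarith)).weak
  rw [snHalf_sub] at h
  unfold tnHalf
  rw [div_le_div_iff₀ (csHalf_pos ha') (csHalf_pos hb)]
  linarith

lemma one_sub_tnHalf {a : ℝ} (ha : IsSize K a) :
    1 - K / 4 * (tnHalf K a * tnHalf K a) = 1 / csHalf K a ^ 2 := by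
  have h := csHalf_sq K a
  have h' := (csHalf_pos ha).ne'
  unfold tnHalf
  field_simp
  linarith

lemma one_sub_polar {a : ℝ} (o : TimeOrientation) (ha : IsSize K a) (φ : ℝ) :
    1 - K / 4 * (o.sign * (tnHalf K a * Real.exp φ) * (o.sign * (tnHalf K a * Real.exp (-φ))))
      = 1 / csHalf K a ^ 2 := by
  rw [← one_sub_tnHalf ha]
  have h1 : Real.exp φ * Real.exp (-φ) = 1 := by rw [← Real.exp_add]; simp
  linear_combination (-(K / 4 * tnHalf K a ^ 2) * (o.sign * o.sign)) * h1
    - (K / 4 * tnHalf K a ^ 2) * o.sign_mul_self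

/-- The point at time separation `a` from the origin of the chart in the direction of rapidity
`φ`. -/
def polar {a : ℝ} (o : TimeOrientation) (ha : IsSize K a) (φ : ℝ) : ModelPlane K :=
  chart (o.sign * (tnHalf K a * Real.exp φ)) (o.sign * (tnHalf K a * Real.exp (-φ))) (by
    rw [one_sub_polar o ha]
    have := csHalf_pos ha
    positivity)

lemma polar_zero {o o' : TimeOrientation} {h : IsSize K 0} (φ φ' : ℝ) :
    polar o h φ = polar o' h φ' := by
  unfold polar; simp [tnHalf_zero]

variable {a a' φ φ' : ℝ} {ha : IsSize K a} {ha' : IsSize K a'}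

lemma leO_polar {o : TimeOrientation} : (polar o ha φ).leO o (polar o ha' φ') ↔
    tnHalf K a * Real.exp φ ≤ tnHalf K a' * Real.exp φ' ∧
      tnHalf K a * Real.exp (-φ) ≤ tnHalf K a' * Real.exp (-φ') := by
  cases o
  · simp only [ModelPlane.leO, polar, chart_le_chart, TimeOrientation.sign, one_mul]
  · simp only [ModelPlane.leO, polar, chart_le_chart, TimeOrientation.sign, neg_mul, one_mul,
      neg_le_neg_iff]

lemma leO_polar_of_le {o : TimeOrientation} (h : a ≤ a') :
    (polar o ha φ).leO o (polar o ha' φ) := by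
  rw [leO_polar]
  have := tnHalf_mono ha.1 ha' h
  constructor <;> gcongr

/-- The sign `s` is `1` for two points on the same side of the origin and `-1` for points on
opposite sides, so that a single computation yields both laws of cosines. -/
lemma polar_separation (K : ℝ) {a a' : ℝ} (ha : IsSize K a) (ha' : IsSize K a') (s φ φ' : ℝ)
    (hs : s ^ 2 = 1) :
    (tnHalf K a' * Real.exp φ' - s * (tnHalf K a * Real.exp φ))
      * (tnHalf K a' * Real.exp (-φ') - s * (tnHalf K a * Real.exp (-φ)))
        / (1 / csHalf K a ^ 2 * (1 / csHalf K a' ^ 2)) =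
    snHalf K a ^ 2 * csHalf K a' ^ 2 + snHalf K a' ^ 2 * csHalf K a ^ 2
        - s * (2 * (snHalf K a * csHalf K a) * (snHalf K a' * csHalf K a')) * Real.cosh (φ - φ') := by
  have h := (csHalf_pos ha).ne'
  have h' := (csHalf_pos ha').ne'
  have h1 : Real.exp φ * Real.exp (-φ) = 1 := by rw [← Real.exp_add]; simp
  have h2 : Real.exp φ' * Real.exp (-φ') = 1 := by rw [← Real.exp_add]; simp
  rw [Real.cosh_eq, neg_sub, sub_eq_add_neg φ, sub_eq_add_neg φ', Real.exp_add, Real.exp_add]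
  unfold tnHalf
  generalize Real.exp φ = x at *
  generalize Real.exp (-φ) = y at *
  generalize Real.exp φ' = x' at *
  generalize Real.exp (-φ') = y' at *
  field_simp
  linear_combination (csHalf K a ^ 2 * snHalf K a' ^ 2) * h2
    + (csHalf K a' ^ 2 * snHalf K a ^ 2) * (s ^ 2 * h1 + hs)

lemma exists_tauO_polar {o : TimeOrientation} (hle : (polar o ha φ).leO o (polar o ha' φ')) :
    ∃ T, 0 ≤ T ∧ (K < 0 → T ≤ Real.pi / √(-K)) ∧
      snHalf K T ^ 2 = snHalf K a ^ 2 * csHalf K a' ^ 2 + snHalf K a' ^ 2 * csHalf K a ^ 2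
        - 2 * (snHalf K a * csHalf K a) * (snHalf K a' * csHalf K a') * Real.cosh (φ - φ') ∧
      (polar o ha φ).tauO o (polar o ha' φ') = ENNReal.ofReal T := by
  have t0 := tnHalf_nonneg ha
  have t1 := tnHalf_nonneg ha'
  -- On one side of the origin all null coordinates have the same sign, hence the mixed products are
  -- nonnegative and the finiteness condition for `K < 0` is automatic.
  have hpos : ∀ x y, K < 0 → 0 ≤ 1 - K / 4 * (o.sign * (tnHalf K a * Real.exp x)
      * (o.sign * (tnHalf K a' * Real.exp y))) := by
    intro x y hK
    have : 0 ≤ -K / 4 * (tnHalf K a * Real.exp x * (tnHalf K a' * Real.exp y)) := by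
      have : 0 ≤ -K / 4 := by linarith
      positivity
    linear_combination this + (-K / 4 * (tnHalf K a * Real.exp x * (tnHalf K a' * Real.exp y)))
      * (o.sign_mul_self.ge)
  have key := polar_separation K ha ha' 1 φ φ' (by norm_num)
  simp only [one_mul] at key
  have hl := leO_polar.1 hle
  cases o
  · obtain ⟨T, h0, h1, h2, h3⟩ := exists_tau_chart (K := K)
      (by rw [one_sub_polar .future ha φ]; have := csHalf_pos ha; positivity)
      (by rw [one_sub_polar .future ha' φ']; have := csHalf_pos ha'; positivity)
      (by simpa [TimeOrientation.sign] using hl.1) (by simpa [TimeOrientation.sign] using hl.2)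
      (fun hK => ⟨by have := hpos (-φ) φ' hK; rwa [mul_comm (_ * _)] at this, by
        have := hpos φ (-φ') hK; rwa [mul_comm (_ * _)] at this⟩)
    refine ⟨T, h0, h1, ?_, h3⟩
    rw [h2, one_sub_polar _ ha, one_sub_polar _ ha', ← key]
    simp [TimeOrientation.sign]
  · obtain ⟨T, h0, h1, h2, h3⟩ := exists_tau_chart (K := K)
      (by rw [one_sub_polar .past ha' φ']; have := csHalf_pos ha'; positivity)
      (by rw [one_sub_polar .past ha φ]; have := csHalf_pos ha; positivity)
      (by simpa [TimeOrientation.sign] using hl.1) (by simpa [TimeOrientation.sign] using hl.2)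
      (fun hK => ⟨hpos φ (-φ') hK, hpos (-φ) φ' hK⟩)
    refine ⟨T, h0, h1, ?_, h3⟩
    rw [h2, one_sub_polar _ ha, one_sub_polar _ ha', ← key]
    simp only [TimeOrientation.sign]
    rw [mul_comm (1 / csHalf K a' ^ 2)]
    congr 1
    ring

lemma tauO_polar_eq {o : TimeOrientation} {b : ℝ} (hb : 0 ≤ b ∧ (K < 0 → b ≤ Real.pi / √(-K)))
    (hle : (polar o ha φ).leO o (polar o ha' φ'))
    (h : snHalf K b ^ 2 = snHalf K a ^ 2 * csHalf K a' ^ 2 + snHalf K a' ^ 2 * csHalf K a ^ 2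
        - 2 * (snHalf K a * csHalf K a) * (snHalf K a' * csHalf K a') * Real.cosh (φ - φ')) :
    (polar o ha φ).tauO o (polar o ha' φ') = ENNReal.ofReal b := by
  obtain ⟨T, h0, h1, h2, h3⟩ := exists_tauO_polar hle
  rw [h3, le_antisymm (le_of_snHalf_sq_le ⟨h0, h1⟩ hb.1 (by rw [h2, h]))
    (le_of_snHalf_sq_le hb h0 (by rw [h2, h]))]

lemma tauO_polar_radial {o : TimeOrientation} (h : a ≤ a') :
    (polar o ha φ).tauO o (polar o ha' φ) = ENNReal.ofReal (a' - a) := by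
  apply tauO_polar_eq (ha'.mono (by linarith) (by linarith [ha.1])).weak (leO_polar_of_le h)
  rw [snHalf_sub, sub_self, Real.cosh_zero]
  ring

lemma le_polar_past_future : (polar .past ha φ).le (polar .future ha' φ') := by
  have t0 := tnHalf_nonneg ha
  have t1 := tnHalf_nonneg ha'
  simp only [polar, chart_le_chart, TimeOrientation.sign]
  constructor
  · have : 0 ≤ tnHalf K a * Real.exp φ := by positivity
    have : 0 ≤ tnHalf K a' * Real.exp φ' := by positivity
    linarith
  · have : 0 ≤ tnHalf K a * Real.exp (-φ) := by positivity
    have : 0 ≤ tnHalf K a' * Real.exp (-φ') := by positivity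
    linarith

/-- The factor with the nonpositive exponent is nonnegative because `x ≤ 1`, and positivity of the
product passes the sign on to the other factor. -/
lemma nonneg_of_mul_exp {x y : ℝ} (hx : x ≤ 1)
    (h : 0 < (1 - x * Real.exp y) * (1 - x * Real.exp (-y))) :
    0 ≤ 1 - x * Real.exp y ∧ 0 ≤ 1 - x * Real.exp (-y) := by
  wlog hy : 0 ≤ y generalizing y
  · have := this (y := -y) (by rwa [neg_neg, mul_comm]) (by linarith)
    rw [neg_neg] at this
    exact this.symm
  have h1 : Real.exp (-y) ≤ 1 := Real.exp_le_one_iff.2 (by linarith)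
  have h2 : 0 ≤ 1 - x * Real.exp (-y) := by linarith [mul_le_of_le_one_left (Real.exp_pos (-y)).le hx]
  exact ⟨(pos_of_mul_pos_left h h2).le, h2⟩

/-- The points at parameters `a` and `a'` of opposite time orientation, with rapidities differing by
`ψ`, are joined by a causal geodesic (a restriction only for `K < 0`). -/
def IsJoinable (K a a' ψ : ℝ) : Prop :=
  K < 0 → 0 ≤ 1 - -K / 4 * (tnHalf K a * tnHalf K a') * Real.exp ψ ∧
    0 ≤ 1 - -K / 4 * (tnHalf K a * tnHalf K a') * Real.exp (-ψ)

lemma IsJoinable.mono {b b' ψ : ℝ} (h : IsJoinable K b b' ψ) (ha : IsSize K a)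
    (ha' : IsSize K a') (hb : IsSize K b) (hb' : IsSize K b') (hab : a ≤ b) (hab' : a' ≤ b') :
    IsJoinable K a a' ψ := by
  intro hK
  have t0 := tnHalf_nonneg ha
  have t1 := tnHalf_nonneg ha'
  have h1 : -K / 4 * (tnHalf K a * tnHalf K a') ≤ -K / 4 * (tnHalf K b * tnHalf K b') := by
    have := tnHalf_mono ha.1 hb hab
    have := tnHalf_mono ha'.1 hb' hab'
    have : 0 ≤ -K / 4 := by linarith
    have := tnHalf_nonneg hb
    gcongr
  have h2 := mul_le_mul_of_nonneg_right h1 (Real.exp_pos ψ).le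
  have h3 := mul_le_mul_of_nonneg_right h1 (Real.exp_pos (-ψ)).le
  constructor
  · linarith [(h hK).1]
  · linarith [(h hK).2]

/-- The product of the two quantities in `IsJoinable` is `1 + K / 4 * Q` up to a positive factor,
`Q` being the left side of `hQ`. As `Q ≤ snHalf K b ^ 2`, it is at least `csHalf K b ^ 2 > 0`. The
bound `a + a' ≤ b` makes `csHalf K (a + a')` positive, which is the remaining hypothesis of
`nonneg_of_mul_exp`. -/
lemma isJoinable_of_le (ha : IsSize K a) (ha' : IsSize K a') {b ψ : ℝ} (hb : IsSize K b)
    (hab : a + a' ≤ b)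
    (hQ : snHalf K a ^ 2 * csHalf K a' ^ 2 + snHalf K a' ^ 2 * csHalf K a ^ 2
        + 2 * (snHalf K a * csHalf K a) * (snHalf K a' * csHalf K a') * Real.cosh ψ
        ≤ snHalf K b ^ 2) : IsJoinable K a a' ψ := by
  intro hK
  have t0 := tnHalf_nonneg ha
  have t1 := tnHalf_nonneg ha'
  have c0 := csHalf_pos ha
  have c1 := csHalf_pos ha'
  have hx : -K / 4 * (tnHalf K a * tnHalf K a') ≤ 1 := by
    have h := csHalf_pos (hb.mono (y := a + a') (by linarith [ha.1, ha'.1]) hab)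
    rw [csHalf_add] at h
    unfold tnHalf
    rw [div_mul_div_comm, mul_div_assoc', div_le_one (by positivity)]
    linarith
  refine nonneg_of_mul_exp hx ?_
  have e : (1 - -K / 4 * (tnHalf K a * tnHalf K a') * Real.exp ψ)
      * (1 - -K / 4 * (tnHalf K a * tnHalf K a') * Real.exp (-ψ))
      = (1 + K / 4 * (snHalf K a ^ 2 * csHalf K a' ^ 2 + snHalf K a' ^ 2 * csHalf K a ^ 2
        + 2 * (snHalf K a * csHalf K a) * (snHalf K a' * csHalf K a')
          * Real.cosh ψ)) / (csHalf K a ^ 2 * csHalf K a' ^ 2) := by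
    have h1 : Real.exp ψ * Real.exp (-ψ) = 1 := by rw [← Real.exp_add]; simp
    have k0 := csHalf_sq K a
    have k1 := csHalf_sq K a'
    rw [Real.cosh_eq]
    unfold tnHalf
    generalize Real.exp ψ = x at *
    generalize Real.exp (-ψ) = y at *
    generalize csHalf K a = c at *
    generalize csHalf K a' = c' at *
    field_simp
    linear_combination (K ^ 2 * snHalf K a ^ 2 * snHalf K a' ^ 2) * h1
      + 16 * c' ^ 2 * k0 - 4 * K * snHalf K a' ^ 2 * k0 + 16 * k1
  rw [e]
  have := csHalf_sq K b
  have := mul_le_mul_of_nonneg_left hQ (show 0 ≤ -K / 4 by linarith)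
  have : 0 < csHalf K b ^ 2 := by have := csHalf_pos hb; positivity
  apply div_pos _ (by positivity)
  linarith

lemma exists_tau_polar_past_future (hbr : IsJoinable K a a' (φ - φ')) :
    ∃ T, 0 ≤ T ∧ (K < 0 → T ≤ Real.pi / √(-K)) ∧
      snHalf K T ^ 2 = snHalf K a ^ 2 * csHalf K a' ^ 2 + snHalf K a' ^ 2 * csHalf K a ^ 2
        + 2 * (snHalf K a * csHalf K a) * (snHalf K a' * csHalf K a') * Real.cosh (φ - φ') ∧
      (polar .past ha φ).tau (polar .future ha' φ') = ENNReal.ofReal T := by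
  have key := polar_separation K ha ha' (-1) φ φ' (by norm_num)
  have hl := chart_le_chart.1 (le_polar_past_future (ha := ha) (ha' := ha') (φ := φ) (φ' := φ'))
  have c0 := csHalf_pos ha
  have c1 := csHalf_pos ha'
  obtain ⟨T, h0, h1, h2, h3⟩ := exists_tau_chart (K := K)
    (by rw [one_sub_polar .past ha φ]; positivity)
    (by rw [one_sub_polar .future ha' φ']; positivity) hl.1 hl.2
    (fun hK => by
      have := hbr hK
      rw [neg_sub, sub_eq_add_neg φ, sub_eq_add_neg φ', Real.exp_add, Real.exp_add] at this
      simp only [TimeOrientation.sign]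
      constructor
      · linarith [this.2]
      · linarith [this.1])
  refine ⟨T, h0, h1, ?_, h3⟩
  rw [h2, one_sub_polar _ ha, one_sub_polar _ ha']
  simp only [TimeOrientation.sign]
  linear_combination key

end Polar


/-! ### Causality and the symmetrised time separation -/

section Separation

variable {X : Type*} [MetricSpace X] [LorentzianPreLengthSpace X] {o : TimeOrientation}
  {p q r : X} {U : Set X}

lemma causO_refl (o : TimeOrientation) (p : X) : causO o p p := by
  cases o <;> exact caus_refl p

lemma causO_trans (h : causO o p q) (h' : causO o q r) : causO o p r := by
  cases o
  · exact caus_trans h h'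
  · exact caus_trans h' h

lemma causO_of_chronO (h : chronO o p q) : causO o p q := by
  cases o <;> exact caus_of_chron h

lemma tauO_reverse_triangle (h : causO o p q) (h' : causO o q r) :
    tauO o p q + tauO o q r ≤ tauO o p r := by
  cases o
  · exact tau_reverse_triangle h h'
  · rw [add_comm]; exact tau_reverse_triangle h' h

lemma tauO_pos_iff : 0 < tauO o p q ↔ chronO o p q := by
  cases o <;> exact tau_pos_iff

lemma chronO_of_causO_of_chronO (h : causO o p q) (h' : chronO o q r) : chronO o p r :=
  tauO_pos_iff.1 (((tauO_pos_iff.2 h').trans_le le_add_self).trans_le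
    (tauO_reverse_triangle h (causO_of_chronO h')))

lemma chronO_of_chronO_of_causO (h : chronO o p q) (h' : causO o q r) : chronO o p r :=
  tauO_pos_iff.1 (((tauO_pos_iff.2 h).trans_le le_self_add).trans_le
    (tauO_reverse_triangle (causO_of_chronO h) h'))

lemma chronO_rev : chronO o.rev p q ↔ chronO o q p := by cases o <;> rfl

lemma causO_rev : causO o.rev p q ↔ causO o q p := by cases o <;> rfl

/-- The symmetrised, real valued time separation. -/
def sep (p q : X) : ℝ := (max (tau p q) (tau q p)).toReal

lemma sep_comm (p q : X) : sep p q = sep q p := by unfold sep; rw [max_comm]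

lemma sep_nonneg (p q : X) : 0 ≤ sep p q := ENNReal.toReal_nonneg

namespace IsComparisonDomain

variable (hU : IsComparisonDomain U)
include hU

lemma tau_self (hp : p ∈ U) : tau p p = 0 := by
  have h := tau_reverse_triangle (caus_refl p) (caus_refl p)
  have hfin := (hU.tau_lt_top p hp p hp).ne
  by_contra h0
  exact (ENNReal.lt_add_right hfin h0).not_ge h

lemma not_chronO_self (hp : p ∈ U) : ¬ chronO o p p := by
  rw [← tauO_pos_iff]
  cases o <;> simp [tauO, hU.tau_self hp]

lemma not_chronO_of_causO (hp : p ∈ U) (h : causO o p q) : ¬ chronO o q p :=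
  fun h' => hU.not_chronO_self hp (chronO_of_causO_of_chronO h h')

lemma tauO_symm_eq_zero (hp : p ∈ U) (h : causO o p q) : tauO o q p = 0 := by
  have := mt tauO_pos_iff.1 (hU.not_chronO_of_causO hp h)
  simpa using this

lemma tauO_lt_top (hp : p ∈ U) (hq : q ∈ U) : tauO o p q < ⊤ := by
  cases o
  · exact hU.tau_lt_top p hp q hq
  · exact hU.tau_lt_top q hq p hp

/-- Finiteness of `τ` excludes chronological loops in `U`, so the separation in the reverse
direction vanishes and the symmetrisation loses nothing on causally related pairs. -/
lemma ofReal_sep (hp : p ∈ U) (hq : q ∈ U) (h : causO o p q) :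
    ENNReal.ofReal (sep p q) = tauO o p q := by
  have h0 := hU.tauO_symm_eq_zero hp h
  have h1 := (hU.tauO_lt_top (o := o) hp hq).ne
  unfold sep
  cases o
  · simp only [tauO] at *
    rw [h0, max_eq_left (zero_le), ENNReal.ofReal_toReal h1]
  · simp only [tauO] at *
    rw [h0, max_eq_right (zero_le), ENNReal.ofReal_toReal h1]

lemma sep_eq (hp : p ∈ U) (hq : q ∈ U) (h : causO o p q) : sep p q = (tauO o p q).toReal := by
  rw [← hU.ofReal_sep hp hq h, ENNReal.toReal_ofReal (sep_nonneg _ _)]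

lemma sep_pos (hp : p ∈ U) (hq : q ∈ U) (h : chronO o p q) : 0 < sep p q := by
  rw [hU.sep_eq hp hq (causO_of_chronO h)]
  exact ENNReal.toReal_pos (tauO_pos_iff.2 h).ne' (hU.tauO_lt_top hp hq).ne

lemma sep_self (hp : p ∈ U) : sep p p = 0 := by
  simp [sep, hU.tau_self hp]

lemma sep_triangle (hp : p ∈ U) (hq : q ∈ U) (hr : r ∈ U) (h : causO o p q) (h' : causO o q r) :
    sep p q + sep q r ≤ sep p r := by
  have := tauO_reverse_triangle h h'
  rw [← hU.ofReal_sep hp hq h, ← hU.ofReal_sep hq hr h', ← hU.ofReal_sep hp hr (causO_trans h h'),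
    ← ENNReal.ofReal_add (sep_nonneg _ _) (sep_nonneg _ _)] at this
  exact (ENNReal.ofReal_le_ofReal_iff (sep_nonneg _ _)).1 this

lemma continuousOn_sep : ContinuousOn (fun z : X × X => sep z.1 z.2) (U ×ˢ U) := by
  have h1 := hU.tau_continuousOn
  have h2 : ContinuousOn (fun z : X × X => tau z.2 z.1) (U ×ˢ U) :=
    h1.comp (f := Prod.swap) continuous_swap.continuousOn (fun z hz => ⟨hz.2, hz.1⟩)
  intro z hz
  have h := (h1 z hz).max (h2 z hz)
  refine (ENNReal.tendsto_toReal ?_).comp h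
  exact (max_lt (hU.tau_lt_top _ hz.1 _ hz.2) (hU.tau_lt_top _ hz.2 _ hz.1)).ne

lemma tendsto_sep {ι : Type*} {l : Filter ι} {f g : ι → X} (hp : p ∈ U) (hq : q ∈ U)
    (hf : Tendsto f l (𝓝 p)) (hg : Tendsto g l (𝓝 q)) :
    Tendsto (fun i => sep (f i) (g i)) l (𝓝 (sep p q)) :=
  ((hU.continuousOn_sep.continuousAt ((hU.isOpen.prod hU.isOpen).mem_nhds ⟨hp, hq⟩)).tendsto.comp
    (hf.prodMk_nhds hg) :)

end IsComparisonDomain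

lemma isOpen_chron : IsOpen {z : X × X | chron z.1 z.2} := by
  have h := (tau_lsc (X := X)).isOpen_preimage 0
  convert h using 1
  ext z
  exact tau_pos_iff.symm

lemma eventually_chronO {ι : Type*} {l : Filter ι} {f g : ι → X} (h : chronO o p q)
    (hf : Tendsto f l (𝓝 p)) (hg : Tendsto g l (𝓝 q)) : ∀ᶠ i in l, chronO o (f i) (g i) := by
  cases o
  · exact (hf.prodMk_nhds hg).eventually (isOpen_chron.mem_nhds h)
  · exact (hg.prodMk_nhds hf).eventually (isOpen_chron.mem_nhds h)

end Separation

/-! ### Length, additivity and points on realizers -/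

section Length

variable {X : Type*} [MetricSpace X] [LorentzianPreLengthSpace X] {o : TimeOrientation}
  {γ : ℝ → X} {a b c : ℝ} {I : Set ℝ}

lemma tauLength_self (o : TimeOrientation) (γ : ℝ → X) (a : ℝ) : tauLength o γ a a = 0 := by
  refine le_antisymm ?_ (zero_le)
  refine (iInf_le_of_le 0 <| iInf_le_of_le (fun _ => a) <| iInf_le_of_le ?_ <|
    iInf_le_of_le rfl <| iInf_le_of_le rfl ?_)
  · intro i hi j hj hij
    simp only [mem_Iic, Nat.le_zero] at hi hj
    omega
  · simp

lemma tauLength_le_tauO (h : a ≤ b) : tauLength o γ a b ≤ tauO o (γ a) (γ b) := by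
  rcases h.eq_or_lt with rfl | h
  · rw [tauLength_self]; exact zero_le
  · refine (iInf_le_of_le 1 <| iInf_le_of_le (fun i => if i = 0 then a else b) <|
      iInf_le_of_le ?_ <| iInf_le_of_le rfl <| iInf_le_of_le rfl ?_)
    · intro i hi j hj hij
      simp only [mem_Iic] at hi hj
      have h0 : i = 0 := by omega
      have h1 : j = 1 := by omega
      simp [h0, h1, h]
    · simp

lemma tauLength_le_add (o : TimeOrientation) (γ : ℝ → X) (a b c : ℝ) :
    tauLength o γ a c ≤ tauLength o γ a b + tauLength o γ b c := by
  conv_rhs => unfold tauLength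
  simp only [ENNReal.iInf_add, ENNReal.add_iInf]
  refine le_iInf fun m => le_iInf fun s => le_iInf fun hs => le_iInf fun k0 => le_iInf fun km =>
    le_iInf fun n => le_iInf fun t => le_iInf fun ht => le_iInf fun h0 => le_iInf fun hn => ?_
  -- At the junction `i = n` both partitions take the value `b`, so the formula of the second one is
  -- already valid there.
  have hu : ∀ i, n ≤ i → (if i ≤ n then t i else s (i - n)) = s (i - n) := by
    intro i hi
    split_ifs with h
    · have : i = n := le_antisymm h hi
      subst this
      simp [hn, k0]
    · rfl
  refine iInf_le_of_le (n + m) <| iInf_le_of_le (fun i => if i ≤ n then t i else s (i - n)) <|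
    iInf_le_of_le ?_ <| iInf_le_of_le (by simp [h0]) <| iInf_le_of_le ?_ ?_
  · intro i hi j hj hij
    simp only [mem_Iic] at hi hj
    rcases le_or_gt n i with h | h
    · simp only [hu i h, hu j (h.trans hij.le)]
      exact hs (by simp only [mem_Iic]; omega) (by simp only [mem_Iic]; omega) (by omega)
    · simp only [if_pos h.le]
      split_ifs with h'
      · exact ht h.le h' hij
      · refine (ht h.le (mem_Iic.2 le_rfl) h).trans ?_
        rw [hn, ← k0]
        exact hs (by simp) (by simp only [mem_Iic]; omega) (by omega)
  · exact (hu (n + m) (by omega)).trans (by rw [Nat.add_sub_cancel_left, km])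
  · rw [Finset.sum_range_add]
    refine add_le_add (le_of_eq <| Finset.sum_congr rfl fun i hi => ?_)
      (le_of_eq <| Finset.sum_congr rfl fun i hi => ?_)
    · have := Finset.mem_range.1 hi
      simp only [if_pos this.le, if_pos (show i + 1 ≤ n by omega)]
    · simp only [hu (n + i) (by omega), hu (n + i + 1) (by omega)]
      congr 3 <;> omega

/-- The time separation is additive along `γ`. -/
def IsTauAdditiveOn (o : TimeOrientation) (γ : ℝ → X) (I : Set ℝ) : Prop :=
  ∀ r ∈ I, ∀ t ∈ I, ∀ u ∈ I, r ≤ t → t ≤ u →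
    tauO o (γ r) (γ u) = tauO o (γ r) (γ t) + tauO o (γ t) (γ u)

lemma IsCausalCurve.causO_of_le (h : IsCausalCurve o γ I) {s t : ℝ} (hs : s ∈ I) (ht : t ∈ I)
    (hst : s ≤ t) : causO o (γ s) (γ t) := by
  rcases hst.eq_or_lt with rfl | hst
  · exact causO_refl o _
  · exact h.causal s hs t ht hst

lemma IsCausalCurve.mono {J : Set ℝ} (h : IsCausalCurve o γ I) (hJI : J ⊆ I) (hJ : J.OrdConnected)
    (hJ' : J.Nontrivial) : IsCausalCurve o γ J where
  ordConnected := hJ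
  nontrivial := hJ'
  locallyLipschitz := h.locallyLipschitz.mono hJI
  nonconstant s hs t ht := h.nonconstant s (hJI hs) t (hJI ht)
  causal s hs t ht := h.causal s (hJI hs) t (hJI ht)

/-- The length is subadditive and bounded by `τ`, while `τ` is superadditive along the curve.
Equality for the endpoints therefore forces equality in between, after cancelling finite terms; with
infinite values nothing could be cancelled. -/
lemma isTauAdditiveOn_of_eq_tauLength (hγ : IsCausalCurve o γ I) (hI : Icc a b ⊆ I)
    (h : tauO o (γ a) (γ b) = tauLength o γ a b) (hfin : tauLength o γ a b < ⊤) :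
    IsTauAdditiveOn o γ (Icc a b) ∧
      ∀ s ∈ Icc a b, ∀ t ∈ Icc a b, s ≤ t → tauO o (γ s) (γ t) < ⊤ := by
  have hab : ∀ s ∈ Icc a b, ∀ t ∈ Icc a b, s ≤ t →
      tauO o (γ a) (γ s) + tauO o (γ s) (γ t) + tauO o (γ t) (γ b) ≤ tauO o (γ a) (γ b) := by
    intro s hs t ht hst
    have hab := hs.1.trans hs.2
    have c1 := hγ.causO_of_le (hI (left_mem_Icc.2 hab)) (hI hs) hs.1
    have c2 := hγ.causO_of_le (hI hs) (hI ht) hst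
    have c3 := hγ.causO_of_le (hI ht) (hI (right_mem_Icc.2 hab)) ht.2
    exact (add_le_add_left (tauO_reverse_triangle c1 c2) _).trans
      (tauO_reverse_triangle (causO_trans c1 c2) c3)
  rw [← h] at hfin
  have hlt : ∀ s ∈ Icc a b, ∀ t ∈ Icc a b, s ≤ t → tauO o (γ a) (γ s) < ⊤ ∧
      tauO o (γ s) (γ t) < ⊤ ∧ tauO o (γ t) (γ b) < ⊤ := by
    intro s hs t ht hst
    have := (hab s hs t ht hst).trans_lt hfin
    simp only [ENNReal.add_lt_top] at this
    tauto
  refine ⟨fun r hr t ht u hu hrt htu => ?_, fun s hs t ht hst => (hlt s hs t ht hst).2.1⟩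
  refine le_antisymm ?_ (tauO_reverse_triangle (hγ.causO_of_le (hI hr) (hI ht) hrt)
    (hγ.causO_of_le (hI ht) (hI hu) htu))
  have h1 : tauO o (γ a) (γ b) ≤ tauO o (γ a) (γ r) + (tauO o (γ r) (γ t) + tauO o (γ t) (γ u))
      + tauO o (γ u) (γ b) := by
    rw [h]
    calc tauLength o γ a b ≤ tauLength o γ a u + tauLength o γ u b := tauLength_le_add ..
      _ ≤ tauLength o γ a r + tauLength o γ r u + tauLength o γ u b :=
        add_le_add_left (tauLength_le_add ..) _
      _ ≤ tauLength o γ a r + (tauLength o γ r t + tauLength o γ t u) + tauLength o γ u b :=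
        add_le_add_left (add_le_add_right (tauLength_le_add ..) _) _
      _ ≤ _ := add_le_add (add_le_add (tauLength_le_tauO hr.1) (add_le_add
        (tauLength_le_tauO hrt) (tauLength_le_tauO htu))) (tauLength_le_tauO hu.2)
  have h2 := (hab r hr u hu (hrt.trans htu)).trans h1
  have h3 := hlt r hr u hu (hrt.trans htu)
  exact (ENNReal.add_le_add_iff_left h3.1.ne).1 ((ENNReal.add_le_add_iff_right h3.2.2.ne).1 h2)

lemma isDistanceRealizer_of_isTauAdditiveOn (hγ : IsCausalCurve o γ (Icc a b))
    (h : IsTauAdditiveOn o γ (Icc a b)) (h0 : tauO o (γ a) (γ a) = 0) :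
    IsDistanceRealizer o γ a b := by
  refine ⟨hγ, le_antisymm ?_ (tauLength_le_tauO ?_)⟩
  · refine le_iInf fun n => le_iInf fun t => le_iInf fun ht => le_iInf fun ht0 => le_iInf fun hn => ?_
    have hmem : ∀ k ≤ n, t k ∈ Icc a b := fun k hk => by
      rw [← ht0, ← hn]
      exact ⟨ht.monotoneOn (by simp) hk (Nat.zero_le k), ht.monotoneOn hk (by simp) hk⟩
    -- The empty sum at `k = 0` requires `τ(γ a, γ a) = 0`.
    have key : ∀ k ≤ n, tauO o (γ a) (γ (t k))
        = ∑ i ∈ Finset.range k, tauO o (γ (t i)) (γ (t (i + 1))) := by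
      intro k
      induction k with
      | zero => intro _; simp [ht0, h0]
      | succ k ih =>
        intro hk
        rw [Finset.sum_range_succ, ← ih (by omega)]
        exact h a (ht0 ▸ hmem 0 (by omega)) _ (hmem k (by omega)) _ (hmem (k + 1) hk)
          (hmem k (by omega)).1 (ht.monotoneOn (mem_Iic.2 (by omega)) hk (by omega))
    rw [← key n le_rfl, hn]
  · obtain ⟨x, hx⟩ := hγ.nontrivial.nonempty
    exact hx.1.trans hx.2

/-- The symmetrised time separation is additive along `γ`. -/
def IsSepAdditiveOn (γ : ℝ → X) (I : Set ℝ) : Prop :=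
  ∀ r ∈ I, ∀ t ∈ I, ∀ u ∈ I, r ≤ t → t ≤ u →
    sep (γ r) (γ u) = sep (γ r) (γ t) + sep (γ t) (γ u)

lemma IsSepAdditiveOn.mono {J : Set ℝ} (h : IsSepAdditiveOn γ I) (hJ : J ⊆ I) :
    IsSepAdditiveOn γ J :=
  fun r hr t ht u hu => h r (hJ hr) t (hJ ht) u (hJ hu)

lemma isTauAdditiveOn_iff {U : Set X} (hU : IsComparisonDomain U) (hγ : IsCausalCurve o γ I)
    (hmem : ∀ t ∈ I, γ t ∈ U) : IsTauAdditiveOn o γ I ↔ IsSepAdditiveOn γ I := by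
  refine forall₂_congr fun r hr => forall₂_congr fun t ht => forall₂_congr fun u hu =>
    forall₂_congr fun hrt htu => ?_
  rw [← hU.ofReal_sep (hmem r hr) (hmem t ht) (hγ.causO_of_le hr ht hrt),
    ← hU.ofReal_sep (hmem t ht) (hmem u hu) (hγ.causO_of_le ht hu htu),
    ← hU.ofReal_sep (hmem r hr) (hmem u hu) (hγ.causO_of_le hr hu (hrt.trans htu)),
    ← ENNReal.ofReal_add (sep_nonneg _ _) (sep_nonneg _ _),
    ENNReal.ofReal_eq_ofReal_iff (sep_nonneg _ _) (add_nonneg (sep_nonneg _ _) (sep_nonneg _ _))]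

/-- The realizers in `TimelikeTriangle` and in timelike geodesic connectedness are future directed;
past directed ones enter through this reversal of the parameter. -/
lemma IsCausalCurve.rev (hγ : IsCausalCurve o γ I) :
    IsCausalCurve o.rev (fun t => γ (-t)) (-I) where
  ordConnected := by
    have := hγ.ordConnected
    refine ⟨fun x hx y hy z hz => ?_⟩
    exact this.out hy hx ⟨neg_le_neg hz.2, neg_le_neg hz.1⟩
  nontrivial := by
    obtain ⟨x, hx, y, hy, hxy⟩ := hγ.nontrivial
    exact ⟨-x, by simpa using hx, -y, by simpa using hy, by simpa using hxy⟩
  locallyLipschitz := by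
    intro x hx
    obtain ⟨K, t, ht, hK⟩ := hγ.locallyLipschitz (show -x ∈ I from hx)
    refine ⟨K, -t, ?_, ?_⟩
    · have : Tendsto (fun y : ℝ => -y) (𝓝[-I] x) (𝓝[I] (-x)) :=
        tendsto_nhdsWithin_of_tendsto_nhds_of_eventually_within _
          ((continuous_neg.tendsto x).mono_left nhdsWithin_le_nhds)
          (eventually_mem_nhdsWithin.mono fun y hy => hy)
      exact this ht
    · intro y hy z hz
      simpa [edist_neg_neg] using hK (show -y ∈ t from hy) (show -z ∈ t from hz)
  nonconstant s hs t ht hst := by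
    by_contra! hcon
    obtain ⟨u, hu, hne⟩ := hγ.nonconstant (-t) ht (-s) hs (by linarith)
    apply hne
    have h1 := hcon (-u) ⟨by linarith [hu.2], by linarith [hu.1]⟩
    have h2 := hcon t ⟨hst.le, le_rfl⟩
    rw [neg_neg] at h1
    rw [h1, ← h2]
  causal s hs t ht hst := causO_rev.2 (hγ.causal (-t) ht (-s) hs (by linarith))

/-- `q` lies on some future directed distance realizer from `p` to `r` in `U`. -/
def OnRealizer (U : Set X) (p r q : X) : Prop :=
  ∃ γ a b, IsRealizerFromToIn U p r γ a b ∧ ∃ t ∈ Icc a b, γ t = q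

/-- `OnRealizer`, with the endpoints interchanged for the past orientation. -/
def OnRealizerO (o : TimeOrientation) (U : Set X) (p r q : X) : Prop :=
  match o with
  | .future => OnRealizer U p r q
  | .past => OnRealizer U r p q

lemma onRealizerO_rev {U : Set X} {p q r : X} :
    OnRealizerO o.rev U p r q ↔ OnRealizerO o U r p q := by cases o <;> rfl

lemma onRealizer_of_isSepAdditiveOn {U : Set X} (hU : IsComparisonDomain U)
    (hγ : IsCausalCurve .future γ (Icc a b)) (hadd : IsSepAdditiveOn γ (Icc a b))
    (hmem : ∀ t ∈ Icc a b, γ t ∈ U) {t : ℝ} (ht : t ∈ Icc a b) :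
    OnRealizer U (γ a) (γ b) (γ t) :=
  ⟨γ, a, b, ⟨isDistanceRealizer_of_isTauAdditiveOn hγ ((isTauAdditiveOn_iff hU hγ hmem).2 hadd)
    (hU.tau_self (hmem a (left_mem_Icc.2 (ht.1.trans ht.2)))), rfl, rfl, hmem⟩, t, ht, rfl⟩

lemma onRealizerO_of_isSepAdditiveOn {U : Set X} (hU : IsComparisonDomain U)
    (hγ : IsCausalCurve o γ I) (hI : Icc a b ⊆ I) (hadd : IsSepAdditiveOn γ (Icc a b))
    (hmem : ∀ t ∈ Icc a b, γ t ∈ U) (hab : a < b) {t : ℝ} (ht : t ∈ Icc a b) :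
    OnRealizerO o U (γ a) (γ b) (γ t) := by
  have hγ' := hγ.mono hI ordConnected_Icc ⟨a, left_mem_Icc.2 hab.le, b, right_mem_Icc.2 hab.le, hab.ne⟩
  cases o
  · exact onRealizer_of_isSepAdditiveOn hU hγ' hadd hmem ht
  · have hneg : -Icc a b = Icc (-b) (-a) := by ext x; simp [and_comm]
    have h1 := hγ'.rev
    rw [hneg] at h1
    have hm : ∀ {x}, x ∈ Icc (-b) (-a) → -x ∈ Icc a b := fun hx =>
      ⟨by linarith [hx.2], by linarith [hx.1]⟩
    have := onRealizer_of_isSepAdditiveOn (γ := fun t => γ (-t)) hU h1 (a := -b) (b := -a)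
      (fun r hr t ht u hu hrt htu => by
        have := hadd _ (hm hu) _ (hm ht) _ (hm hr) (by linarith) (by linarith)
        rw [sep_comm, this, sep_comm (γ (-t)) (γ (-r)), sep_comm (γ (-u)) (γ (-t)), add_comm])
      (fun t ht => hmem _ (hm ht)) (t := -t) ⟨by linarith [ht.2], by linarith [ht.1]⟩
    simp only [neg_neg] at this
    exact this

lemma OnRealizer.additive {U : Set X} (hU : IsComparisonDomain U) {p q r : X}
    (h : OnRealizer U p r q) : q ∈ U ∧ caus p q ∧ caus q r ∧
      sep p r = sep p q + sep q r := by
  obtain ⟨γ, a, b, ⟨⟨hγ, hL⟩, rfl, rfl, hmem⟩, t, ht, rfl⟩ := h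
  have ha := left_mem_Icc.2 (ht.1.trans ht.2)
  have hb := right_mem_Icc.2 (ht.1.trans ht.2)
  have h1 := isTauAdditiveOn_of_eq_tauLength hγ subset_rfl hL
    (hL ▸ hU.tau_lt_top _ (hmem a ha) _ (hmem b hb))
  have h2 := (isTauAdditiveOn_iff hU hγ hmem).1 h1.1
  exact ⟨hmem t ht, hγ.causO_of_le ha ht ht.1, hγ.causO_of_le ht hb ht.2,
    h2 a ha t ht b hb ht.1 ht.2⟩

lemma OnRealizerO.additive {U : Set X} (hU : IsComparisonDomain U) {p q r : X}
    (h : OnRealizerO o U p r q) : q ∈ U ∧ causO o p q ∧ causO o q r ∧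
      sep p r = sep p q + sep q r := by
  cases o
  · exact OnRealizer.additive hU h
  · obtain ⟨h1, h2, h3, h4⟩ := OnRealizer.additive hU h
    exact ⟨h1, h3, h2, by rw [sep_comm, h4, sep_comm r q, sep_comm q p, add_comm]⟩

lemma exists_onRealizerO {U : Set X} (hU : IsComparisonDomain U) {p r : X} (hp : p ∈ U)
    (hr : r ∈ U) (h : chronO o p r) : OnRealizerO o U p r p ∧ OnRealizerO o U p r r := by
  have key : ∀ {p r}, p ∈ U → r ∈ U → chron p r → OnRealizer U p r p ∧ OnRealizer U p r r := by
    intro p r hp hr h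
    obtain ⟨γ, a, b, hγ⟩ := hU.connected.exists_realizer p hp r hr h
    obtain ⟨x, hx⟩ := hγ.isDistanceRealizer.isCausalCurve.nontrivial.nonempty
    exact ⟨⟨γ, a, b, hγ, a, left_mem_Icc.2 (hx.1.trans hx.2), hγ.source⟩,
      ⟨γ, a, b, hγ, b, right_mem_Icc.2 (hx.1.trans hx.2), hγ.target⟩⟩
  cases o
  · exact key hp hr h
  · exact (key hr hp h).symm

end Length


/-! ### Triangles with marked points -/

section Comparison

variable {X : Type*} [MetricSpace X] [LorentzianPreLengthSpace X] {o : TimeOrientation}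
  {U : Set X} {K : ℝ}

/-- A triangle with prescribed points on two different sides. -/
lemma exists_timelikeTriangle (hU : IsComparisonDomain U) {p : Fin 3 → X} (hp : ∀ i, p i ∈ U)
    (hchron : ∀ i j, i < j → chron (p i) (p j)) {i j k l : Fin 3} (hij : i < j) (hkl : k < l)
    (hne : (i, j) ≠ (k, l)) {q₁ q₂ : X} (h₁ : OnRealizer U (p i) (p j) q₁)
    (h₂ : OnRealizer U (p k) (p l) q₂) :
    ∃ Δ : TimelikeTriangle U, Δ.p = p ∧ Δ.OnSide i j q₁ ∧ Δ.OnSide k l q₂ := by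
  classical
  -- As the marked points lie on different sides, the sides can be chosen independently: the given
  -- realizers for the two marked ones, any realizer for the third, and a dummy when `m < n` fails.
  have hex : ∀ m n : Fin 3, ∃ s : (ℝ → X) × ℝ × ℝ, m < n →
      IsRealizerFromToIn U (p m) (p n) s.1 s.2.1 s.2.2 ∧
      ((m, n) = (i, j) → ∃ t ∈ Icc s.2.1 s.2.2, s.1 t = q₁) ∧
      ((m, n) = (k, l) → ∃ t ∈ Icc s.2.1 s.2.2, s.1 t = q₂) := by
    intro m n
    by_cases hmn : m < n
    · by_cases e1 : (m, n) = (i, j)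
      · obtain ⟨γ, a, b, hγ, ht⟩ := h₁
        obtain ⟨rfl, rfl⟩ := Prod.mk.inj e1
        exact ⟨(γ, a, b), fun _ => ⟨hγ, fun _ => ht, fun h => (hne h).elim⟩⟩
      · by_cases e2 : (m, n) = (k, l)
        · obtain ⟨γ, a, b, hγ, ht⟩ := h₂
          obtain ⟨rfl, rfl⟩ := Prod.mk.inj e2
          exact ⟨(γ, a, b), fun _ => ⟨hγ, fun h => (e1 h).elim, fun _ => ht⟩⟩
        · obtain ⟨γ, a, b, hγ⟩ := hU.connected.exists_realizer _ (hp m) _ (hp n) (hchron m n hmn)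
          exact ⟨(γ, a, b), fun _ => ⟨hγ, fun h => (e1 h).elim, fun h => (e2 h).elim⟩⟩
    · exact ⟨(fun _ => p 0, 0, 0), fun h => (hmn h).elim⟩
  choose s hs using hex
  exact ⟨⟨p, fun m n => (s m n).1, fun m n => (s m n).2.1, fun m n => (s m n).2.2, hchron,
    fun m n _ => hU.tau_lt_top _ (hp m) _ (hp n), fun m n hmn => (hs m n hmn).1⟩, rfl,
    ⟨hij, (hs i j hij).2.1 rfl⟩, ⟨hkl, (hs k l hkl).2.2 rfl⟩⟩

end Comparison

/-! ### Monotonicity of comparison angles for equal time orientations -/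

section Hinge

variable {X : Type*} [MetricSpace X] [LorentzianPreLengthSpace X] {o : TimeOrientation}
  {U : Set X} {K : ℝ}

lemma forall_lt_fin_three {P : Fin 3 → Fin 3 → Prop} (h₀₁ : P 0 1) (h₀₂ : P 0 2) (h₁₂ : P 1 2) :
    ∀ i j, i < j → P i j := by
  intro i j h
  fin_cases i <;> fin_cases j <;> first | assumption | exact absurd h (by decide)

lemma IsSize.timelikeSizeBound {a : ℝ} (h : IsSize K a) : TimelikeSizeBound K (ENNReal.ofReal a) :=
  ⟨ENNReal.ofReal_lt_top, fun hK =>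
    (ENNReal.ofReal_lt_ofReal_iff (h.1.trans_lt (h.2 hK))).2 (h.2 hK)⟩

lemma isSize_zero (K : ℝ) : IsSize K 0 :=
  ⟨le_rfl, fun hK => div_pos Real.pi_pos (Real.sqrt_pos.2 (by linarith))⟩

lemma leO_of_tauO_pos {p q : ModelPlane K} (h : 0 < p.tauO o q) : p.leO o q := by
  cases o
  all_goals
    by_contra hle
    simp only [ModelPlane.tauO, ModelPlane.tau, ModelPlane.leO] at h hle
    rw [if_neg hle] at h
    exact h.false

/-- The hypothesis says that the product of the differences of null coordinates is nonnegative. The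
difference containing `exp φ` is nonnegative because `a ≤ c`, so the other one is too; when it
vanishes, `φ = 0` and the points lie on one ray. -/
lemma leO_polar_of_sq_nonneg {a c φ : ℝ} (ha : IsSize K a) (hc : IsSize K c) (ha0 : 0 < a)
    (hac : a ≤ c) (hφ : 0 ≤ φ) (h : 0 ≤ snHalf K a ^ 2 * csHalf K c ^ 2
      + snHalf K c ^ 2 * csHalf K a ^ 2
      - 2 * (snHalf K a * csHalf K a) * (snHalf K c * csHalf K c) * Real.cosh φ) :
    (polar o ha 0).leO o (polar o hc φ) := by
  have h1 := polar_separation K ha hc 1 0 φ (by norm_num)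
  have ca := csHalf_pos ha
  have cc := csHalf_pos hc
  rw [zero_sub, Real.cosh_neg, div_eq_iff (by positivity)] at h1
  simp only [neg_zero, Real.exp_zero, mul_one, one_mul] at h1
  have h2 : 0 ≤ (tnHalf K c * Real.exp φ - tnHalf K a) * (tnHalf K c * Real.exp (-φ) - tnHalf K a) := by
    rw [h1]; exact mul_nonneg h (by positivity)
  rw [leO_polar]
  have hm := tnHalf_mono ha0.le hc hac
  have hapos : 0 < tnHalf K a := div_pos (snHalf_pos ha ha0) ca
  have he : 1 ≤ Real.exp φ := Real.one_le_exp hφ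
  have hle : tnHalf K a ≤ tnHalf K c * Real.exp φ := by nlinarith
  simp only [neg_zero, Real.exp_zero, mul_one]
  refine ⟨hle, ?_⟩
  rcases hle.eq_or_lt with heq | hlt
  · have : Real.exp φ ≤ 1 := by
      by_contra! hgt
      nlinarith
    have hφ0 : φ = 0 := le_antisymm (by rwa [Real.exp_le_one_iff] at this) hφ
    simpa [hφ0] using hm
  · linarith [nonneg_of_mul_nonneg_right h2 (sub_pos.2 hlt)]

/-- The comparison configuration for a hinge at `x` with sides to `y` and `z`. -/
lemma exists_hinge_comparison (hU : IsComparisonDomain U) {x y z y' z' : X}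
    (hx : x ∈ U) (hy : y ∈ U) (hz : z ∈ U) (hxy : chronO o x y) (hyz : chronO o y z)
    (hsize : IsSize K (sep x z)) (hy' : OnRealizerO o U x y y') (hz' : OnRealizerO o U x z z') :
    ∃ φ, ∃ ha : IsSize K (sep x y'), ∃ hc : IsSize K (sep x z'),
    Real.cosh φ = angleCosh K (sep x y) (sep x z) (sep y z) ∧
    (∃ i j k l, ∃ Δ : TimelikeTriangle U, TimelikeSizeBound K (tau (Δ.p 0) (Δ.p 2)) ∧
      ∃ p' : Fin 3 → ModelPlane K, Δ.IsComparison p' ∧ Δ.OnSide i j y' ∧ Δ.OnSide k l z' ∧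
        Δ.Corresponds p' i j y' (polar o ha 0) ∧ Δ.Corresponds p' k l z' (polar o hc φ)) := by
  have hxz : chronO o x z := chronO_of_chronO_of_causO hxy (causO_of_chronO hyz)
  have cxy := causO_of_chronO hxy
  have cyz := causO_of_chronO hyz
  have cxz := causO_of_chronO hxz
  obtain ⟨hyU, c1, c2, s1⟩ := hy'.additive hU
  obtain ⟨hzU, c3, c4, s2⟩ := hz'.additive hU
  have htri := hU.sep_triangle hx hy hz cxy cyz
  have pxy := hU.sep_pos hx hy hxy
  have hb : IsSize K (sep x y) := hsize.mono pxy.le (by linarith [sep_nonneg y z])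
  have ha : IsSize K (sep x y') := hb.mono (sep_nonneg _ _) (by linarith [sep_nonneg y' y])
  have hc : IsSize K (sep x z') := hsize.mono (sep_nonneg _ _) (by linarith [sep_nonneg z' z])
  have hF := one_le_angleCosh pxy (sep_nonneg y z) hsize htri
  have hφ := Real.cosh_arcosh hF
  have hφ0 := Real.arcosh_nonneg hF
  have hsq := snHalf_sq_angleCosh (b := sep y z) hb hsize pxy (hU.sep_pos hx hz hxz)
  rw [← hφ] at hsq
  -- The model triangle has `x` at the origin, `y` at rapidity `0` and `z` at rapidity `φ`, which
  -- the law of cosines identifies as the comparison angle.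
  set φ := Real.arcosh (angleCosh K (sep x y) (sep x z) (sep y z)) with hφdef
  refine ⟨φ, ha, hc, hφ, ?_⟩
  have h0 := isSize_zero K
  have f1 : (polar o h0 0).tauO o (polar o hb 0) = tauO o x y := by
    rw [tauO_polar_radial pxy.le, sub_zero, hU.ofReal_sep hx hy cxy]
  have f2 : (polar o h0 0).tauO o (polar o hsize φ) = tauO o x z := by
    rw [polar_zero (o' := o) 0 φ, tauO_polar_radial (sep_nonneg _ _), sub_zero,
      hU.ofReal_sep hx hz cxz]
  have hle : (polar o hb 0).leO o (polar o hsize φ) :=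
    leO_polar_of_sq_nonneg hb hsize pxy (by linarith [sep_nonneg y z]) hφ0 (hsq ▸ sq_nonneg _)
  have f3 : (polar o hb 0).tauO o (polar o hsize φ) = tauO o y z := by
    rw [tauO_polar_eq (hsize.mono (sep_nonneg y z) (by linarith)).weak hle
      (by rw [zero_sub, Real.cosh_neg, ← hsq]), hU.ofReal_sep hy hz cyz]
  have g1 : (polar o h0 0).leO o (polar o ha 0) := leO_polar_of_le (sep_nonneg _ _)
  have g2 : (polar o ha 0).leO o (polar o hb 0) := leO_polar_of_le (by linarith [sep_nonneg y' y])
  have g3 : (polar o h0 0).tauO o (polar o ha 0) = tauO o x y' := by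
    rw [tauO_polar_radial (sep_nonneg _ _), sub_zero, hU.ofReal_sep hx hyU c1]
  have g4 : (polar o ha 0).tauO o (polar o hb 0) = tauO o y' y := by
    rw [tauO_polar_radial (by linarith [sep_nonneg y' y]), s1, add_sub_cancel_left,
      hU.ofReal_sep hyU hy c2]
  have k1 : (polar o h0 0).leO o (polar o hc φ) := by
    rw [polar_zero (o' := o) 0 φ]; exact leO_polar_of_le (sep_nonneg _ _)
  have k2 : (polar o hc φ).leO o (polar o hsize φ) :=
    leO_polar_of_le (by linarith [sep_nonneg z' z])
  have k3 : (polar o h0 0).tauO o (polar o hc φ) = tauO o x z' := by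
    rw [polar_zero (o' := o) 0 φ, tauO_polar_radial (sep_nonneg _ _), sub_zero,
      hU.ofReal_sep hx hzU c3]
  have k4 : (polar o hc φ).tauO o (polar o hsize φ) = tauO o z' z := by
    rw [tauO_polar_radial (by linarith [sep_nonneg z' z]), s2, add_sub_cancel_left,
      hU.ofReal_sep hzU hz c4]
  have hbound := hsize.timelikeSizeBound
  rw [hU.ofReal_sep hx hz cxz] at hbound
  cases o
  · obtain ⟨Δ, hp, hs1, hs2⟩ := exists_timelikeTriangle hU (p := ![x, y, z])
      (by intro i; fin_cases i <;> assumption) (forall_lt_fin_three hxy hxz hyz)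
      (i := 0) (j := 1) (k := 0) (l := 2) (by decide) (by decide) (by decide) hy' hz'
    refine ⟨0, 1, 0, 2, Δ, by rw [hp]; exact hbound,
      ![polar .future h0 0, polar .future hb 0, polar .future hsize φ],
      forall_lt_fin_three ?_ ?_ ?_, hs1, hs2, ⟨g1, g2, ?_, ?_⟩, ⟨k1, k2, ?_, ?_⟩⟩ <;>
    rw [hp] <;> assumption
  -- For the past orientation the vertex `x` of the hinge comes last in the chronological order.
  · obtain ⟨Δ, hp, hs1, hs2⟩ := exists_timelikeTriangle hU (p := ![z, y, x])
      (by intro i; fin_cases i <;> assumption) (forall_lt_fin_three hyz hxz hxy)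
      (i := 1) (j := 2) (k := 0) (l := 2) (by decide) (by decide) (by decide) hy' hz'
    refine ⟨1, 2, 0, 2, Δ, by rw [hp]; exact hbound,
      ![polar .past hsize φ, polar .past hb 0, polar .past h0 0],
      forall_lt_fin_three ?_ ?_ ?_, hs1, hs2, ⟨g2, g1, ?_, ?_⟩, ⟨k2, k1, ?_, ?_⟩⟩ <;>
    rw [hp] <;> assumption

lemma tauO_le_ofReal_sep (hU : IsComparisonDomain U) {p q : X} (hp : p ∈ U) (hq : q ∈ U) :
    tauO o p q ≤ ENNReal.ofReal (sep p q) := by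
  unfold sep
  rw [ENNReal.ofReal_toReal (max_lt (hU.tau_lt_top _ hp _ hq) (hU.tau_lt_top _ hq _ hp)).ne]
  cases o
  · exact le_max_left _ _
  · exact le_max_right _ _

lemma chronO_or_of_sep_pos {p q : X} (h : 0 < sep p q) : chronO o p q ∨ chronO o q p := by
  by_contra! hcon
  have h1 : ¬ chron p q := by cases o <;> tauto
  have h2 : ¬ chron q p := by cases o <;> tauto
  rw [← tau_pos_iff, not_lt, nonpos_iff_eq_zero] at h1 h2
  simp [sep, h1, h2] at h

/-- If `y` and `z` are timelike related, the reverse triangle inequality bounds their separation by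
that of `x` and the farther of the two; otherwise it is zero. -/
lemma isSize_sep_of_chronO (hU : IsComparisonDomain U) {x y z : X} (hx : x ∈ U) (hy : y ∈ U)
    (hz : z ∈ U) (hxy : chronO o x y) (hxz : chronO o x z) (h1 : IsSize K (sep x y))
    (h2 : IsSize K (sep x z)) : IsSize K (sep y z) := by
  rcases (sep_nonneg y z).eq_or_lt with h | h
  · rw [← h]; exact isSize_zero K
  · rcases chronO_or_of_sep_pos (o := o) h with h | h
    · have := hU.sep_triangle hx hy hz (causO_of_chronO hxy) (causO_of_chronO h)
      exact h2.mono (sep_nonneg _ _) (by linarith [sep_nonneg x y])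
    · have := hU.sep_triangle hx hz hy (causO_of_chronO hxz) (causO_of_chronO h)
      rw [sep_comm z y] at this
      exact h1.mono (sep_nonneg _ _) (by linarith [sep_nonneg x z])

/-- Under an upper curvature bound, the comparison angle of a hinge decreases with the sides. -/
lemma IsComparisonNhdAbove.angleCosh_le (hU : IsComparisonNhdAbove K U) {x y z y' z' : X}
    (hx : x ∈ U) (hy : y ∈ U) (hz : z ∈ U) (hxy : chronO o x y) (hyz : chronO o y z)
    (hsize : IsSize K (sep x z)) (hy' : OnRealizerO o U x y y') (hz' : OnRealizerO o U x z z')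
    (hxy' : chronO o x y') (hxz' : chronO o x z') :
    angleCosh K (sep x y') (sep x z') (sep y' z')
      ≤ angleCosh K (sep x y) (sep x z) (sep y z) := by
  have hD := hU.toIsComparisonDomain
  obtain ⟨φ, ha, hc, hφ, i, j, k, l, Δ, hb, p', hp', hs1, hs2, hc1, hc2⟩ :=
    exists_hinge_comparison hD hx hy hz hxy hyz hsize hy' hz'
  have hyU := (hy'.additive hD).1
  have hzU := (hz'.additive hD).1
  have e1 := hU.comparison Δ hb p' hp' i j k l _ _ _ _ hs1 hs2 hc1 hc2
  have e2 := hU.comparison Δ hb p' hp' k l i j _ _ _ _ hs2 hs1 hc2 hc1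
  have hS := isSize_sep_of_chronO (K := K) hD hx hyU hzU hxy' hxz' ha hc
  have E1 : (polar o ha 0).tauO o (polar o hc φ) ≤ ENNReal.ofReal (sep y' z') := by
    cases o
    · exact e1.trans (tauO_le_ofReal_sep (o := .future) hD hyU hzU)
    · exact e2.trans (tauO_le_ofReal_sep (o := .past) hD hyU hzU)
  have E2 : (polar o hc φ).tauO o (polar o ha 0) ≤ ENNReal.ofReal (sep y' z') := by
    rw [sep_comm y' z']
    cases o
    · exact e2.trans (tauO_le_ofReal_sep (o := .future) hD hzU hyU)
    · exact e1.trans (tauO_le_ofReal_sep (o := .past) hD hzU hyU)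
  rw [← hφ, angleCosh_le_iff ha hc (hD.sep_pos hx hyU hxy') (hD.sep_pos hx hzU hxz')]
  by_cases l1 : (polar o ha 0).leO o (polar o hc φ)
  · obtain ⟨T, h0, h1, h2, h3⟩ := exists_tauO_polar l1
    rw [h3, ENNReal.ofReal_le_ofReal_iff (sep_nonneg _ _)] at E1
    rw [zero_sub, Real.cosh_neg] at h2
    rw [← h2]
    exact snHalf_sq_le h0 hS.weak E1
  by_cases l2 : (polar o hc φ).leO o (polar o ha 0)
  · obtain ⟨T, h0, h1, h2, h3⟩ := exists_tauO_polar l2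
    rw [h3, ENNReal.ofReal_le_ofReal_iff (sep_nonneg _ _)] at E2
    rw [sub_zero] at h2
    have := snHalf_sq_le h0 hS.weak E2
    rw [h2] at this
    linarith
  -- If the model points are not causally related, the differences of their null coordinates have
  -- opposite signs. The law of cosines expression is then nonpositive, hence at most any square.
  · have h1 := polar_separation K ha hc 1 0 φ (by norm_num)
    have ca := csHalf_pos ha
    have cc := csHalf_pos hc
    rw [zero_sub, Real.cosh_neg] at h1
    simp only [neg_zero, Real.exp_zero, mul_one, one_mul] at h1
    rw [← h1]
    refine le_trans ?_ (sq_nonneg _)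
    apply div_nonpos_of_nonpos_of_nonneg _ (by positivity)
    rw [leO_polar] at l1 l2
    simp only [neg_zero, Real.exp_zero, mul_one] at l1 l2
    rw [not_and_or, not_le, not_le] at l1 l2
    rcases l1 with h | h <;> rcases l2 with h' | h'
    · exact absurd h h'.not_gt
    · exact mul_nonpos_of_nonpos_of_nonneg (by linarith) (by linarith)
    · exact mul_nonpos_of_nonneg_of_nonpos (by linarith) (by linarith)
    · exact absurd h h'.not_gt

/-- Under a lower curvature bound, the comparison angle of a hinge increases as the sides
shrink. -/
lemma IsComparisonNhdBelow.le_angleCosh (hU : IsComparisonNhdBelow K U) {x y z y' z' : X}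
    (hx : x ∈ U) (hy : y ∈ U) (hz : z ∈ U) (hxy : chronO o x y) (hyz : chronO o y z)
    (hsize : IsSize K (sep x z)) (hy' : OnRealizerO o U x y y') (hz' : OnRealizerO o U x z z')
    (hxy' : chronO o x y') (hxz' : chronO o x z') (hr : chronO o y' z' ∨ chronO o z' y') :
    angleCosh K (sep x y) (sep x z) (sep y z)
      ≤ angleCosh K (sep x y') (sep x z') (sep y' z') := by
  have hD := hU.toIsComparisonDomain
  obtain ⟨φ, ha, hc, hφ, i, j, k, l, Δ, hb, p', hp', hs1, hs2, hc1, hc2⟩ :=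
    exists_hinge_comparison hD hx hy hz hxy hyz hsize hy' hz'
  have hyU := (hy'.additive hD).1
  have hzU := (hz'.additive hD).1
  have e1 := hU.comparison Δ hb p' hp' i j k l _ _ _ _ hs1 hs2 hc1 hc2
  have e2 := hU.comparison Δ hb p' hp' k l i j _ _ _ _ hs2 hs1 hc2 hc1
  rw [← hφ, le_angleCosh_iff ha hc (hD.sep_pos hx hyU hxy') (hD.sep_pos hx hzU hxz')]
  rcases hr with hr | hr
  · have E1 : tauO o y' z' ≤ (polar o ha 0).tauO o (polar o hc φ) := by
      cases o
      · exact e1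
      · exact e2
    -- Since `τ` is positive on this pair, so is the model separation; the model points are then
    -- causally related and the law of cosines applies to them.
    obtain ⟨T, h0, h1, h2, h3⟩ :=
      exists_tauO_polar (leO_of_tauO_pos ((tauO_pos_iff.2 hr).trans_le E1))
    rw [h3, ← hD.ofReal_sep hyU hzU (causO_of_chronO hr), ENNReal.ofReal_le_ofReal_iff h0] at E1
    rw [zero_sub, Real.cosh_neg] at h2
    rw [← h2]
    exact snHalf_sq_le (sep_nonneg _ _) ⟨h0, h1⟩ E1
  · have E2 : tauO o z' y' ≤ (polar o hc φ).tauO o (polar o ha 0) := by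
      cases o
      · exact e2
      · exact e1
    obtain ⟨T, h0, h1, h2, h3⟩ :=
      exists_tauO_polar (leO_of_tauO_pos ((tauO_pos_iff.2 hr).trans_le E2))
    rw [h3, ← hD.ofReal_sep hzU hyU (causO_of_chronO hr), ENNReal.ofReal_le_ofReal_iff h0] at E2
    rw [sub_zero] at h2
    have := snHalf_sq_le (sep_nonneg _ _) ⟨h0, h1⟩ E2
    rw [h2, sep_comm] at this
    linarith

end Hinge


/-! ### Monotonicity of comparison angles for opposite time orientations -/

section Straight

variable {X : Type*} [MetricSpace X] [LorentzianPreLengthSpace X] {o : TimeOrientation}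
  {U : Set X} {K : ℝ}

/-- The comparison configuration for points `p`, `q` in the past and in the future of `x`. -/
lemma exists_past_future_comparison (hU : IsComparisonDomain U) {x p q p₁ q₁ : X}
    (hx : x ∈ U) (hp : p ∈ U) (hq : q ∈ U) (hpx : chron p x) (hxq : chron x q)
    (hsize : IsSize K (sep p q)) (hp₁ : OnRealizer U p x p₁) (hq₁ : OnRealizer U x q q₁) :
    ∃ φ, ∃ ha : IsSize K (sep x p₁), ∃ hc : IsSize K (sep x q₁),
    Real.cosh φ = -angleCosh K (sep x p) (sep x q) (sep p q) ∧
    IsJoinable K (sep x p₁) (sep x q₁) (φ - 0) ∧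
    (∃ Δ : TimelikeTriangle U, TimelikeSizeBound K (tau (Δ.p 0) (Δ.p 2)) ∧
      ∃ p' : Fin 3 → ModelPlane K, Δ.IsComparison p' ∧ Δ.OnSide 0 1 p₁ ∧ Δ.OnSide 1 2 q₁ ∧
        Δ.Corresponds p' 0 1 p₁ (polar .past ha φ) ∧
        Δ.Corresponds p' 1 2 q₁ (polar .future hc 0)) := by
  have cpx := caus_of_chron hpx
  have cxq := caus_of_chron hxq
  have hpq := chron_trans hpx hxq
  have cpq := caus_of_chron hpq
  obtain ⟨hpU, c1, c2, s1⟩ := hp₁.additive hU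
  obtain ⟨hqU, c3, c4, s2⟩ := hq₁.additive hU
  rw [sep_comm p x, sep_comm p p₁, sep_comm p₁ x] at s1
  have htri := hU.sep_triangle (o := .future) hp hx hq cpx cxq
  rw [sep_comm p x] at htri
  have ppx : 0 < sep x p := hU.sep_pos (o := .past) hx hp hpx
  have pxq : 0 < sep x q := hU.sep_pos (o := .future) hx hq hxq
  have hb : IsSize K (sep x p) := hsize.mono ppx.le (by linarith)
  have hd : IsSize K (sep x q) := hsize.mono pxq.le (by linarith)
  have n1 := sep_nonneg p₁ p
  have n2 := sep_nonneg q₁ q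
  have ha : IsSize K (sep x p₁) := hb.mono (sep_nonneg _ _) (by linarith)
  have hc : IsSize K (sep x q₁) := hd.mono (sep_nonneg _ _) (by linarith)
  have hF : 1 ≤ -angleCosh K (sep x p) (sep x q) (sep p q) := by
    linarith [angleCosh_le_neg_one ppx pxq hsize htri]
  have hφ := Real.cosh_arcosh hF
  have hsq := snHalf_sq_angleCosh (b := sep p q) hb hd ppx pxq
  set φ := Real.arcosh (-angleCosh K (sep x p) (sep x q) (sep p q)) with hφdef
  have hsq' : snHalf K (sep p q) ^ 2 = snHalf K (sep x p) ^ 2 * csHalf K (sep x q) ^ 2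
      + snHalf K (sep x q) ^ 2 * csHalf K (sep x p) ^ 2
      + 2 * (snHalf K (sep x p) * csHalf K (sep x p)) * (snHalf K (sep x q) * csHalf K (sep x q))
        * Real.cosh (φ - 0) := by rw [sub_zero, hφ]; linarith
  -- The length bound on the side from `p` to `q` guarantees that the model points are joined by a
  -- geodesic; the property passes to points nearer to the vertex.
  have hJ : IsJoinable K (sep x p) (sep x q) (φ - 0) := isJoinable_of_le hb hd hsize htri hsq'.ge
  refine ⟨φ, ha, hc, hφ, hJ.mono ha hc hb hd (by linarith) (by linarith), ?_⟩
  have h0 := isSize_zero K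
  have f1 : (polar .past hb φ).tau (polar .past h0 0) = tau p x := by
    have := tauO_polar_radial (o := .past) (ha := h0) (ha' := hb) (φ := φ) ppx.le
    rw [polar_zero (o' := .past) φ 0, sub_zero, hU.ofReal_sep (o := .past) hx hp cpx] at this
    exact this
  have f2 : (polar .past h0 0).tau (polar .future hd 0) = tau x q := by
    have := tauO_polar_radial (o := .future) (ha := h0) (ha' := hd) (φ := 0) pxq.le
    rw [polar_zero (o' := .past) 0 0, sub_zero, hU.ofReal_sep (o := .future) hx hq cxq] at this
    exact this
  have f3 : (polar .past hb φ).tau (polar .future hd 0) = tau p q := by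
    obtain ⟨T, t0, t1, t2, t3⟩ := exists_tau_polar_past_future (ha := hb) (ha' := hd) hJ
    rw [← hsq'] at t2
    rw [t3, le_antisymm (le_of_snHalf_sq_le ⟨t0, t1⟩ hsize.1 t2.le)
      (le_of_snHalf_sq_le hsize.weak t0 t2.ge), hU.ofReal_sep (o := .future) hp hq cpq]
    rfl
  have g1 : (polar .past hb φ).le (polar .past ha φ) := leO_polar_of_le (o := .past) (by linarith)
  have g2 : (polar .past ha φ).le (polar .past h0 0) := by
    rw [polar_zero (o' := .past) 0 φ]
    exact leO_polar_of_le (o := .past) (sep_nonneg _ _)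
  have g3 : (polar .past hb φ).tau (polar .past ha φ) = tau p p₁ := by
    have := tauO_polar_radial (o := .past) (ha := ha) (ha' := hb) (φ := φ) (by linarith)
    rw [show sep x p - sep x p₁ = sep p₁ p by linarith,
      hU.ofReal_sep (o := .past) hpU hp c1] at this
    exact this
  have g4 : (polar .past ha φ).tau (polar .past h0 0) = tau p₁ x := by
    have := tauO_polar_radial (o := .past) (ha := h0) (ha' := ha) (φ := φ) (sep_nonneg _ _)
    rw [polar_zero (o' := .past) φ 0, sub_zero, hU.ofReal_sep (o := .past) hx hpU c2] at this
    exact this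
  have k1 : (polar .past h0 0).le (polar .future hc 0) := by
    rw [polar_zero (o' := .future) 0 0]
    exact leO_polar_of_le (o := .future) (sep_nonneg _ _)
  have k2 : (polar .future hc 0).le (polar .future hd 0) :=
    leO_polar_of_le (o := .future) (by linarith)
  have k3 : (polar .past h0 0).tau (polar .future hc 0) = tau x q₁ := by
    have := tauO_polar_radial (o := .future) (ha := h0) (ha' := hc) (φ := 0) (sep_nonneg _ _)
    rw [polar_zero (o' := .past) 0 0, sub_zero, hU.ofReal_sep (o := .future) hx hqU c3] at this
    exact this
  have k4 : (polar .future hc 0).tau (polar .future hd 0) = tau q₁ q := by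
    have := tauO_polar_radial (o := .future) (ha := hc) (ha' := hd) (φ := 0) (by linarith)
    rw [show sep x q - sep x q₁ = sep q₁ q by linarith, hU.ofReal_sep (o := .future) hqU hq c4] at this
    exact this
  have hbound := hsize.timelikeSizeBound
  rw [hU.ofReal_sep (o := .future) hp hq cpq] at hbound
  obtain ⟨Δ, hΔ, hs1, hs2⟩ := exists_timelikeTriangle hU (p := ![p, x, q])
    (by intro i; fin_cases i <;> assumption) (forall_lt_fin_three hpx hpq hxq)
    (i := 0) (j := 1) (k := 1) (l := 2) (by decide) (by decide) (by decide) hp₁ hq₁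
  refine ⟨Δ, by rw [hΔ]; exact hbound,
    ![polar .past hb φ, polar .past h0 0, polar .future hd 0],
    forall_lt_fin_three ?_ ?_ ?_, hs1, hs2, ⟨g1, g2, ?_, ?_⟩, ⟨k1, k2, ?_, ?_⟩⟩ <;>
  rw [hΔ] <;> assumption

/-- Comparison bounds the separation of the inner pair from below by its model value, and the signed
cosine decreases in the third side. Causality of the inner pair is automatic, since `p₁ ≪ x ≪ q₁`.
-/
lemma IsComparisonNhdAbove.angleCosh_le_of_past_future (hU : IsComparisonNhdAbove K U)
    {x p q p₁ q₁ : X}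
    (hx : x ∈ U) (hp : p ∈ U) (hq : q ∈ U) (hpx : chron p x) (hxq : chron x q)
    (hsize : IsSize K (sep p q)) (hp₁ : OnRealizer U p x p₁) (hq₁ : OnRealizer U x q q₁)
    (hpx₁ : chron p₁ x) (hxq₁ : chron x q₁) :
    angleCosh K (sep x p₁) (sep x q₁) (sep p₁ q₁)
      ≤ angleCosh K (sep x p) (sep x q) (sep p q) := by
  have hD := hU.toIsComparisonDomain
  obtain ⟨φ, ha, hc, hφ, hJ, Δ, hb, p', hp', hs1, hs2, hc1, hc2⟩ :=
    exists_past_future_comparison hD hx hp hq hpx hxq hsize hp₁ hq₁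
  have hpU := (hp₁.additive hD).1
  have hqU := (hq₁.additive hD).1
  have e1 := hU.comparison Δ hb p' hp' 0 1 1 2 _ _ _ _ hs1 hs2 hc1 hc2
  obtain ⟨T, h0, h1, h2, h3⟩ := exists_tau_polar_past_future (ha := ha) (ha' := hc) hJ
  have hpq₁ := chron_trans hpx₁ hxq₁
  rw [h3, show tau p₁ q₁ = ENNReal.ofReal (sep p₁ q₁) from
    (hD.ofReal_sep (o := .future) hpU hqU (caus_of_chron hpq₁)).symm,
    ENNReal.ofReal_le_ofReal_iff (sep_nonneg _ _)] at e1
  rw [angleCosh_le_iff ha hc (hD.sep_pos (o := .past) hx hpU hpx₁)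
    (hD.sep_pos (o := .future) hx hqU hxq₁)]
  rw [sub_zero, hφ] at h2
  have hs : sep p₁ q₁ ≤ sep p q := by
    have a1 := hp₁.additive hD
    have a2 := hq₁.additive hD
    have t1 := hD.sep_triangle (o := .future) hp hpU hqU a1.2.1 (caus_of_chron hpq₁)
    have t2 := hD.sep_triangle (o := .future) hp hqU hq
      (caus_trans a1.2.1 (caus_of_chron hpq₁)) a2.2.2.1
    linarith [sep_nonneg p p₁, sep_nonneg q₁ q]
  have := snHalf_sq_le h0 (hsize.mono (sep_nonneg p₁ q₁) hs).weak e1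
  linarith

lemma IsComparisonNhdBelow.le_angleCosh_of_past_future (hU : IsComparisonNhdBelow K U)
    {x p q p₁ q₁ : X}
    (hx : x ∈ U) (hp : p ∈ U) (hq : q ∈ U) (hpx : chron p x) (hxq : chron x q)
    (hsize : IsSize K (sep p q)) (hp₁ : OnRealizer U p x p₁) (hq₁ : OnRealizer U x q q₁)
    (hpx₁ : chron p₁ x) (hxq₁ : chron x q₁) :
    angleCosh K (sep x p) (sep x q) (sep p q)
      ≤ angleCosh K (sep x p₁) (sep x q₁) (sep p₁ q₁) := by
  have hD := hU.toIsComparisonDomain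
  obtain ⟨φ, ha, hc, hφ, hJ, Δ, hb, p', hp', hs1, hs2, hc1, hc2⟩ :=
    exists_past_future_comparison hD hx hp hq hpx hxq hsize hp₁ hq₁
  have hpU := (hp₁.additive hD).1
  have hqU := (hq₁.additive hD).1
  have e1 := hU.comparison Δ hb p' hp' 0 1 1 2 _ _ _ _ hs1 hs2 hc1 hc2
  obtain ⟨T, h0, h1, h2, h3⟩ := exists_tau_polar_past_future (ha := ha) (ha' := hc) hJ
  have hpq₁ := chron_trans hpx₁ hxq₁
  rw [h3, show tau p₁ q₁ = ENNReal.ofReal (sep p₁ q₁) from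
    (hD.ofReal_sep (o := .future) hpU hqU (caus_of_chron hpq₁)).symm,
    ENNReal.ofReal_le_ofReal_iff h0] at e1
  rw [le_angleCosh_iff ha hc (hD.sep_pos (o := .past) hx hpU hpx₁)
    (hD.sep_pos (o := .future) hx hqU hxq₁)]
  rw [sub_zero, hφ] at h2
  have := snHalf_sq_le (sep_nonneg _ _) ⟨h0, h1⟩ e1
  linarith

end Straight


/-! ### Minkowski comparison angles through the signed cosine -/

section ComparisonAngle

variable {X : Type*} [MetricSpace X] [LorentzianPreLengthSpace X] {o : TimeOrientation}
  {U : Set X} {K : ℝ} {x y z p q : X}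

/-- The signed hyperbolic cosine of the `K`-comparison angle at `x`. -/
abbrev hingeCosh (K : ℝ) (x y z : X) : ℝ := angleCosh K (sep x y) (sep x z) (sep y z)

lemma hingeCosh_comm (K : ℝ) (x y z : X) : hingeCosh K x y z = hingeCosh K x z y := by
  unfold hingeCosh; rw [angleCosh_comm, sep_comm y z]

lemma IsComparisonDomain.one_le_hingeCosh (hU : IsComparisonDomain U) (hx : x ∈ U) (hy : y ∈ U)
    (hz : z ∈ U) (hxy : chronO o x y) (hxz : chronO o x z) (hyz : causO o y z ∨ causO o z y)
    (h1 : IsSize K (sep x y)) (h2 : IsSize K (sep x z)) : 1 ≤ hingeCosh K x y z := by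
  rcases hyz with h | h
  · exact one_le_angleCosh (hU.sep_pos hx hy hxy) (sep_nonneg _ _) h2
      (hU.sep_triangle hx hy hz (causO_of_chronO hxy) h)
  · rw [hingeCosh_comm]
    exact one_le_angleCosh (hU.sep_pos hx hz hxz) (sep_nonneg _ _) h1
      (hU.sep_triangle hx hz hy (causO_of_chronO hxz) h)

lemma IsComparisonDomain.hingeCosh_le_neg_one (hU : IsComparisonDomain U) (hx : x ∈ U)
    (hy : y ∈ U) (hz : z ∈ U) (hxy : chronO o x y) (hxz : chronO o.rev x z)
    (h : IsSize K (sep y z)) : hingeCosh K x y z ≤ -1 := by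
  refine angleCosh_le_neg_one (hU.sep_pos hx hy hxy) (hU.sep_pos hx hz hxz) h ?_
  rw [add_comm, sep_comm x z, sep_comm y z]
  exact hU.sep_triangle hz hx hy (causO_of_chronO (chronO_rev.1 hxz)) (causO_of_chronO hxy)

lemma isSize_zero_left {a : ℝ} (h : 0 ≤ a) : IsSize 0 a := ⟨h, fun h => (lt_irrefl _ h).elim⟩

/-- The squared Lorentzian distance in the Minkowski plane. -/
def minkowskiSq (p q : ModelPlane 0) : ℝ := (q.η - p.η) ^ 2 - (q.σ - p.σ) ^ 2

lemma minkowskiSq_comm (p q : ModelPlane 0) : minkowskiSq p q = minkowskiSq q p := by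
  unfold minkowskiSq; ring

lemma ModelPlane.tau_of_le {p q : ModelPlane 0} (h : p.le q) :
    p.tau q = ENNReal.ofReal √(minkowskiSq p q) := by
  simp [ModelPlane.tau, h, minkowskiSq]

lemma ModelPlane.tau_of_not_le {p q : ModelPlane 0} (h : ¬ p.le q) : p.tau q = 0 := by
  simp [ModelPlane.tau, h]

lemma ModelPlane.minkowskiSq_nonneg_of_le {p q : ModelPlane 0} (h : p.le q) :
    0 ≤ minkowskiSq p q := by
  have := sq_le_sq.2 (h.trans (le_abs_self _))
  unfold minkowskiSq
  linarith

/-- `p'`, `q'` have the same time separations and causal relations as `p`, `q`. -/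
def IsMinkowskiPair (p q : X) (p' q' : ModelPlane 0) : Prop :=
  (p'.tau q' = tau p q ∧ (caus p q → p'.le q')) ∧ (q'.tau p' = tau q p ∧ (caus q p → q'.le p'))

lemma IsMinkowskiPair.symm {p' q' : ModelPlane 0} (h : IsMinkowskiPair p q p' q') :
    IsMinkowskiPair q p q' p' := ⟨h.2, h.1⟩

lemma isMinkowskiComparison_iff {p' : Fin 3 → ModelPlane 0} :
    IsMinkowskiComparison ![x, y, z] p' ↔ IsMinkowskiPair x y (p' 0) (p' 1) ∧
      IsMinkowskiPair x z (p' 0) (p' 2) ∧ IsMinkowskiPair y z (p' 1) (p' 2) := by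
  constructor
  · intro h
    exact ⟨⟨h 0 1 (by decide), h 1 0 (by decide)⟩, ⟨h 0 2 (by decide), h 2 0 (by decide)⟩,
      ⟨h 1 2 (by decide), h 2 1 (by decide)⟩⟩
  · rintro ⟨h1, h2, h3⟩ i j hij
    fin_cases i <;> fin_cases j <;> first | exact absurd rfl hij | skip
    · exact h1.1
    · exact h2.1
    · exact h1.2
    · exact h3.1
    · exact h2.2
    · exact h3.2

lemma IsMinkowskiPair.minkowskiSq_eq (hU : IsComparisonDomain U) (hp : p ∈ U) (hq : q ∈ U)
    {p' q' : ModelPlane 0} (h : IsMinkowskiPair p q p' q') (hpq : causO o p q) :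
    minkowskiSq p' q' = sep p q ^ 2 := by
  have key : ∀ {p q : X} {p' q' : ModelPlane 0}, p ∈ U → q ∈ U → IsMinkowskiPair p q p' q' →
      caus p q → minkowskiSq p' q' = sep p q ^ 2 := by
    intro p q p' q' hp hq h hpq
    have hle := h.1.2 hpq
    have h1 := h.1.1
    have h2 := hU.ofReal_sep (o := .future) hp hq hpq
    rw [ModelPlane.tau_of_le hle, ← show ENNReal.ofReal (sep p q) = tau p q from h2,
      ENNReal.ofReal_eq_ofReal_iff (Real.sqrt_nonneg _) (sep_nonneg _ _)] at h1
    rw [← h1, Real.sq_sqrt (ModelPlane.minkowskiSq_nonneg_of_le hle)]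
  cases o
  · exact key hp hq h hpq
  · rw [minkowskiSq_comm, sep_comm]
    exact key hq hp h.symm hpq

/-- Points causally related in both directions must be represented by one point, because the causal
relation of the plane is antisymmetric. The hypothesis `h3` takes care of this. -/
lemma IsComparisonDomain.isMinkowskiPair (hU : IsComparisonDomain U) (hp : p ∈ U) (hq : q ∈ U)
    {p' q' : ModelPlane 0} (hpq : causO o p q) (h1 : |q'.σ - p'.σ| ≤ o.sign * (q'.η - p'.η))
    (h2 : minkowskiSq p' q' = sep p q ^ 2)
    (h3 : causO o q p → q'.σ = p'.σ ∧ q'.η = p'.η) : IsMinkowskiPair p q p' q' := by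
  have key : ∀ {p q : X} {p' q' : ModelPlane 0}, p ∈ U → q ∈ U → caus p q → p'.le q' →
      minkowskiSq p' q' = sep p q ^ 2 → (caus q p → q'.σ = p'.σ ∧ q'.η = p'.η) →
      IsMinkowskiPair p q p' q' := by
    intro p q p' q' hp hq hpq h1 h2 h3
    have e1 : ENNReal.ofReal (sep p q) = tau p q := hU.ofReal_sep (o := .future) hp hq hpq
    have e2 : tau q p = 0 := hU.tauO_symm_eq_zero (o := .future) hp hpq
    refine ⟨⟨?_, fun _ => h1⟩, ?_, ?_⟩
    · rw [ModelPlane.tau_of_le h1, h2, Real.sqrt_sq (sep_nonneg _ _), e1]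
    · rw [e2]
      by_cases h : q'.le p'
      · have hη : q'.η = p'.η := by
          have := (abs_nonneg _).trans h
          have := (abs_nonneg _).trans h1
          linarith
        have hσ : q'.σ = p'.σ := by
          have h : |p'.σ - q'.σ| ≤ p'.η - q'.η := h
          rw [hη, sub_self] at h
          linarith [abs_nonpos_iff.1 h]
        rw [ModelPlane.tau_of_le h]
        simp [minkowskiSq, hη, hσ]
      · exact ModelPlane.tau_of_not_le h
    · intro h
      obtain ⟨hσ, hη⟩ := h3 h
      simp [ModelPlane.le, hσ, hη]
  cases o
  · exact key hp hq hpq (by simpa [ModelPlane.le, TimeOrientation.sign] using h1) h2 h3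
  · refine (key hq hp hpq ?_ (by rw [minkowskiSq_comm, h2, sep_comm])
      fun h => ⟨(h3 h).1.symm, (h3 h).2.symm⟩).symm
    rw [abs_sub_comm] at h1
    simpa [ModelPlane.le, TimeOrientation.sign] using h1

/-- Put `x'` at the origin, `z'` on the time axis at height `c` and `y'` at height `e` and distance
`s` from the axis (heights taken with the sign of `o`); `e` and `s` are determined by the squared
separations. The inequality `a + b ≤ c` amounts to `a ≤ e ≤ c - b`, which makes the sides causal. -/
lemma IsComparisonDomain.exists_minkowski_chain (hU : IsComparisonDomain U) (hx : x ∈ U)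
    (hy : y ∈ U) (hz : z ∈ U) (hxy : causO o x y) (hyz : causO o y z) (hxz : chronO o x z) :
    ∃ x' y' z' : ModelPlane 0, IsMinkowskiPair x y x' y' ∧ IsMinkowskiPair y z y' z' ∧
      IsMinkowskiPair x z x' z' := by
  have hc := hU.sep_pos hx hz hxz
  have ha := sep_nonneg x y
  have hb := sep_nonneg y z
  have htri := hU.sep_triangle hx hy hz hxy hyz
  set a := sep x y with hadef
  set b := sep y z with hbdef
  set c := sep x z with hcdef
  set e := (c ^ 2 + a ^ 2 - b ^ 2) / (2 * c) with he
  have hec : 2 * c * e = c ^ 2 + a ^ 2 - b ^ 2 := by rw [he]; field_simp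
  have hae : a ≤ e := by
    rw [he, le_div_iff₀ (by positivity)]
    nlinarith [mul_nonneg (show 0 ≤ c - a - b by linarith) (show 0 ≤ c - a + b by linarith)]
  have hce : b ≤ c - e := by
    rw [le_sub_iff_add_le, ← le_sub_iff_add_le', he, div_le_iff₀ (by positivity)]
    nlinarith [mul_nonneg (show 0 ≤ c - a - b by linarith) (show 0 ≤ c + a - b by linarith)]
  have hs : 0 ≤ e ^ 2 - a ^ 2 := by nlinarith
  have hsq := Real.sq_sqrt hs
  set s := √(e ^ 2 - a ^ 2) with hsdef
  have hs0 : 0 ≤ s := Real.sqrt_nonneg _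
  have hse : s ≤ e := by nlinarith
  have hsc : s ≤ c - e := by nlinarith
  have mk : ∀ η σ : ℝ, ∃ p' : ModelPlane 0, p'.η = η ∧ p'.σ = σ := fun η σ =>
    ⟨⟨η, σ, fun h => (lt_irrefl _ h).elim, fun h => (lt_irrefl _ h).elim⟩, rfl, rfl⟩
  obtain ⟨x', x1, x2⟩ := mk 0 0
  obtain ⟨y', y1, y2⟩ := mk (o.sign * e) s
  obtain ⟨z', z1, z2⟩ := mk (o.sign * c) 0
  have ho : o.sign * o.sign = 1 := by cases o <;> simp [TimeOrientation.sign]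
  have ho' : ∀ r, o.sign * (o.sign * r) = r := fun r => by rw [← mul_assoc, ho, one_mul]
  refine ⟨x', y', z', hU.isMinkowskiPair hx hy hxy ?_ ?_ ?_, hU.isMinkowskiPair hy hz hyz ?_ ?_ ?_,
    hU.isMinkowskiPair hx hz (causO_of_chronO hxz) ?_ ?_ ?_⟩
  · rw [x1, x2, y1, y2, sub_zero, sub_zero, abs_of_nonneg hs0, ho']
    exact hse
  · rw [minkowskiSq, x1, x2, y1, y2, sub_zero, sub_zero]
    linear_combination e ^ 2 * ho - hsq
  -- If also `y ≤ x`, then `a + c ≤ b` and `a + b ≤ c` give `a = 0`, `b = c` and `e = 0`, so `y'`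
  -- coincides with `x'`.
  · intro h
    have h1 := hU.sep_triangle hy hx hz h (causO_of_chronO hxz)
    rw [sep_comm y x] at h1
    change a + c ≤ b at h1
    have ha0 : a = 0 := by linarith
    have he0 : e = 0 := by
      have : b = c := by linarith
      rw [ha0, this] at hec
      have : c * e = 0 := by linarith
      exact (mul_eq_zero.1 this).resolve_left hc.ne'
    rw [y1, y2, x1, x2, hsdef, he0, ha0]
    simp
  · rw [y1, y2, z1, z2, zero_sub, abs_neg, abs_of_nonneg hs0, ← mul_sub, ho']
    exact hsc
  · rw [minkowskiSq, y1, y2, z1, z2]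
    linear_combination (c - e) ^ 2 * ho - hsq - hec
  · intro h
    have h1 := hU.sep_triangle hx hz hy (causO_of_chronO hxz) h
    rw [sep_comm z y] at h1
    change c + b ≤ a at h1
    have hb0 : b = 0 := by linarith
    have hac : a = c := by linarith
    have he0 : e = c := by
      rw [hb0, hac] at hec
      have : c * (e - c) = 0 := by linarith
      linarith [(mul_eq_zero.1 this).resolve_left hc.ne']
    rw [y1, y2, z1, z2, hsdef, he0, hac]
    simp
  · rw [x1, x2, z1, z2]
    simp [ho', hc.le]
  · rw [minkowskiSq, x1, x2, z1, z2]
    linear_combination c ^ 2 * ho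
  · intro h
    exact (hU.not_chronO_of_causO hz h hxz).elim

lemma minkowskiInner_eq (x y z : ModelPlane 0) :
    minkowskiInner x y z = (minkowskiSq y z - minkowskiSq x y - minkowskiSq x z) / 2 := by
  unfold minkowskiInner minkowskiSq; ring

/-- In a comparison neighbourhood the comparison angle is given by the hyperbolic law of cosines. -/
lemma IsComparisonDomain.comparisonAngle_eq (hU : IsComparisonDomain U) {o₁ o₂ o₃ : TimeOrientation}
    (hx : x ∈ U) (hy : y ∈ U) (hz : z ∈ U) (hxy : chronO o₁ x y) (hxz : chronO o₂ x z)
    (hyz : causO o₃ y z)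
    (hex : ∃ x' y' z', IsMinkowskiPair x y x' y' ∧ IsMinkowskiPair x z x' z' ∧
      IsMinkowskiPair y z y' z') :
    comparisonAngle x y z = ENNReal.ofReal (Real.arcosh |hingeCosh 0 x y z|) := by
  have key : ∀ p' : Fin 3 → ModelPlane 0, IsMinkowskiComparison ![x, y, z] p' →
      minkowskiAngle (p' 0) (p' 1) (p' 2) = Real.arcosh |hingeCosh 0 x y z| := by
    intro p' hp'
    rw [isMinkowskiComparison_iff] at hp'
    obtain ⟨h1, h2, h3⟩ := hp'
    have e1 := h1.minkowskiSq_eq hU hx hy (causO_of_chronO hxy)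
    have e2 := h2.minkowskiSq_eq hU hx hz (causO_of_chronO hxz)
    have e3 := h3.minkowskiSq_eq hU hy hz hyz
    have e0 : ∀ p : ModelPlane 0, minkowskiSq p p = 0 := fun p => by simp [minkowskiSq]
    unfold minkowskiAngle
    rw [minkowskiInner_eq, minkowskiInner_eq, minkowskiInner_eq, e0, e0, e1, e2, e3,
      show -((0 - sep x y ^ 2 - sep x y ^ 2) / 2) = sep x y ^ 2 by ring,
      show -((0 - sep x z ^ 2 - sep x z ^ 2) / 2) = sep x z ^ 2 by ring,
      Real.sqrt_sq (sep_nonneg _ _), Real.sqrt_sq (sep_nonneg _ _), hingeCosh, angleCosh_zero_left]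
    have pa := hU.sep_pos hx hy hxy
    have pc := hU.sep_pos hx hz hxz
    congr 1
    conv_lhs => rw [← abs_of_pos (mul_pos pa pc), ← abs_div]
    rw [← abs_neg]
    congr 1
    field_simp
    ring
  unfold comparisonAngle
  refine le_antisymm (iSup₂_le fun p' hp' => by rw [key p' hp']) ?_
  obtain ⟨x', y', z', h⟩ := hex
  have hp' : IsMinkowskiComparison ![x, y, z] ![x', y', z'] := isMinkowskiComparison_iff.2 h
  rw [← key _ hp']
  exact le_iSup₂ (f := fun p' (_ : IsMinkowskiComparison ![x, y, z] p') =>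
    ENNReal.ofReal (minkowskiAngle (p' 0) (p' 1) (p' 2))) _ hp'

lemma IsComparisonDomain.comparisonAngle_eq_of_same (hU : IsComparisonDomain U)
    (hx : x ∈ U) (hy : y ∈ U) (hz : z ∈ U) (hxy : chronO o x y) (hxz : chronO o x z)
    (hyz : causO o y z ∨ causO o z y) :
    comparisonAngle x y z = ENNReal.ofReal (Real.arcosh (hingeCosh 0 x y z)) := by
  have h1 := hU.one_le_hingeCosh (K := 0) hx hy hz hxy hxz hyz (isSize_zero_left (sep_nonneg _ _))
    (isSize_zero_left (sep_nonneg _ _))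
  rw [← abs_of_pos (show 0 < hingeCosh 0 x y z by linarith)]
  rcases hyz with h | h
  · obtain ⟨x', y', z', h1, h2, h3⟩ :=
      hU.exists_minkowski_chain hx hy hz (causO_of_chronO hxy) h hxz
    exact hU.comparisonAngle_eq hx hy hz hxy hxz h ⟨x', y', z', h1, h3, h2⟩
  · obtain ⟨x', z', y', h1, h2, h3⟩ :=
      hU.exists_minkowski_chain hx hz hy (causO_of_chronO hxz) h hxy
    exact hU.comparisonAngle_eq hx hy hz hxy hxz (causO_rev.2 h) ⟨x', y', z', h3, h1, h2.symm⟩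

lemma IsComparisonDomain.comparisonAngle_eq_of_different (hU : IsComparisonDomain U)
    (hx : x ∈ U) (hy : y ∈ U) (hz : z ∈ U) (hxy : chronO o x y) (hxz : chronO o.rev x z) :
    comparisonAngle x y z = ENNReal.ofReal (Real.arcosh (-hingeCosh 0 x y z)) := by
  have h1 := hU.hingeCosh_le_neg_one (K := 0) hx hy hz hxy hxz (isSize_zero_left (sep_nonneg _ _))
  rw [← abs_of_neg (show hingeCosh 0 x y z < 0 by linarith)]
  have c1 := causO_of_chronO hxy
  have c2 := causO_of_chronO (chronO_rev.1 hxz)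
  obtain ⟨z', x', y', h1, h2, h3⟩ :=
    hU.exists_minkowski_chain hz hx hy c2 c1 (chronO_of_causO_of_chronO c2 hxy)
  exact hU.comparisonAngle_eq hx hy hz hxy hxz (causO_rev.2 (causO_trans c2 c1))
    ⟨x', y', z', h2, h1.symm, h3.symm⟩

lemma ofReal_arcosh_le_iff {E A : ℝ} (hE : 1 ≤ E) (hA : 0 ≤ A) :
    ENNReal.ofReal (Real.arcosh E) ≤ ENNReal.ofReal A ↔ E ≤ Real.cosh A := by
  rw [ENNReal.ofReal_le_ofReal_iff hA]
  conv_lhs => rw [← Real.arcosh_cosh hA]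
  exact Real.arcosh_le_arcosh (by linarith) (Real.cosh_pos A)

lemma ofReal_arcosh_lt_iff {E A : ℝ} (hE : 1 ≤ E) (hA : 0 < A) :
    ENNReal.ofReal (Real.arcosh E) < ENNReal.ofReal A ↔ E < Real.cosh A := by
  rw [ENNReal.ofReal_lt_ofReal_iff hA]
  conv_lhs => rw [← Real.arcosh_cosh hA.le]
  exact Real.arcosh_lt_arcosh (by linarith) (Real.cosh_pos A)

end ComparisonAngle

/-! ### Upper angles between timelike rays -/

section UpperAngle

variable {X : Type*} [MetricSpace X] [LorentzianPreLengthSpace X] {o : TimeOrientation}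
  {U : Set X} {x : X} {α β : ℝ → X} {a b : ℝ}

lemma upperAngle_le {c : ℝ≥0∞} {δ : ℝ} (hδ : 0 < δ)
    (h : ∀ s ∈ Ioo 0 δ, ∀ t ∈ Ioo 0 δ, caus (α s) (β t) ∨ caus (β t) (α s) →
      comparisonAngle (α 0) (α s) (β t) ≤ c) : upperAngle α β ≤ c := by
  refine limsup_le_of_le (by isBoundedDefault) ?_
  rw [eventually_inf_principal]
  filter_upwards [prod_mem_prod (Ioo_mem_nhdsGT hδ) (Ioo_mem_nhdsGT hδ)] with z hz hz'
  exact h _ hz.1 _ hz.2 hz'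

lemma exists_of_upperAngle_lt {c : ℝ≥0∞} (h : upperAngle α β < c) :
    ∃ δ > 0, ∀ s ∈ Ioo 0 δ, ∀ t ∈ Ioo 0 δ, caus (α s) (β t) ∨ caus (β t) (α s) →
      comparisonAngle (α 0) (α s) (β t) < c := by
  have h1 := eventually_lt_of_limsup_lt h (by isBoundedDefault)
  rw [eventually_inf_principal, eventually_prod_iff] at h1
  obtain ⟨p, hp, q, hq, hpq⟩ := h1
  obtain ⟨d1, h1, hd1⟩ := mem_nhdsGT_iff_exists_Ioo_subset.1 hp
  obtain ⟨d2, h2, hd2⟩ := mem_nhdsGT_iff_exists_Ioo_subset.1 hq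
  exact ⟨min d1 d2, lt_min h1 h2, fun s hs t ht hr =>
    hpq (hd1 ⟨hs.1, hs.2.trans_le (min_le_left _ _)⟩)
      (hd2 ⟨ht.1, ht.2.trans_le (min_le_right _ _)⟩) hr⟩

/-- `α` restricted to `[0, b]` is a continuous timelike curve in `U` starting at `x`. -/
structure IsTimelikeRay (o : TimeOrientation) (U : Set X) (x : X) (α : ℝ → X) (b : ℝ) : Prop where
  pos : 0 < b
  source : α 0 = x
  mem : ∀ s ∈ Icc 0 b, α s ∈ U
  continuousOn : ContinuousOn α (Icc 0 b)
  isTimelike : IsTimelikeOn o α (Icc 0 b)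

namespace IsTimelikeRay

lemma mono (h : IsTimelikeRay o U x α b) (ha : 0 < a) (hab : a ≤ b) : IsTimelikeRay o U x α a where
  pos := ha
  source := h.source
  mem s hs := h.mem s ⟨hs.1, hs.2.trans hab⟩
  continuousOn := h.continuousOn.mono (Icc_subset_Icc_right hab)
  isTimelike s hs t ht := h.isTimelike s ⟨hs.1, hs.2.trans hab⟩ t ⟨ht.1, ht.2.trans hab⟩

lemma mem_source (h : IsTimelikeRay o U x α b) : x ∈ U :=
  h.source ▸ h.mem 0 ⟨le_rfl, h.pos.le⟩

lemma chronO (h : IsTimelikeRay o U x α b) {s : ℝ} (hs : s ∈ Ioc 0 b) : chronO o x (α s) := by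
  rw [← h.source]
  exact h.isTimelike 0 ⟨le_rfl, h.pos.le⟩ s (Ioc_subset_Icc_self hs) hs.1

lemma tendsto (h : IsTimelikeRay o U x α b) : Tendsto α (𝓝[>] 0) (𝓝 x) := by
  have h1 := h.continuousOn 0 ⟨le_rfl, h.pos.le⟩
  rw [← h.source]
  exact (h1.mono Ioc_subset_Icc_self).tendsto.mono_left
    (nhdsWithin_le_of_mem (Ioc_mem_nhdsGT h.pos))

lemma tendsto_sep (hU : IsComparisonDomain U) (h : IsTimelikeRay o U x α b) :
    Tendsto (fun s => sep x (α s)) (𝓝[>] 0) (𝓝 0) := by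
  have := hU.tendsto_sep h.mem_source h.mem_source tendsto_const_nhds h.tendsto
  rwa [hU.sep_self h.mem_source] at this

lemma continuousOn_sep (hU : IsComparisonDomain U) (h : IsTimelikeRay o U x α b) {y : X}
    (hy : y ∈ U) : ContinuousOn (fun s => sep y (α s)) (Icc 0 b) :=
  hU.continuousOn_sep.comp (f := fun s => (y, α s)) (continuousOn_const.prodMk h.continuousOn)
    fun s hs => ⟨hy, h.mem s hs⟩

lemma sep_lt_sep (hU : IsComparisonDomain U) (h : IsTimelikeRay o U x α b) {s t : ℝ}
    (hs : s ∈ Icc 0 b) (ht : t ∈ Icc 0 b) (hst : s < t) : sep x (α s) < sep x (α t) := by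
  have h1 := h.isTimelike s hs t ht hst
  have h2 : causO o x (α s) := by
    rcases hs.1.eq_or_lt with h0 | h0
    · rw [← h0, h.source]; exact causO_refl o x
    · exact causO_of_chronO (h.chronO ⟨h0, hs.2⟩)
  have := hU.sep_triangle h.mem_source (h.mem s hs) (h.mem t ht) h2 (causO_of_chronO h1)
  linarith [hU.sep_pos (h.mem s hs) (h.mem t ht) h1]

lemma exists_sep_eq (hU : IsComparisonDomain U) (h : IsTimelikeRay o U x α b) {r : ℝ} (hr : 0 < r)
    (hr' : r < sep x (α b)) : ∃ u ∈ Ioo 0 b, sep x (α u) = r := by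
  refine intermediate_value_Ioo h.pos.le (h.continuousOn_sep hU h.mem_source) ⟨?_, hr'⟩
  rwa [h.source, hU.sep_self h.mem_source]

lemma exists_sep_lt (hU : IsComparisonDomain U) (h : IsTimelikeRay o U x α b) {ε : ℝ}
    (hε : 0 < ε) : ∃ δ > 0, δ ≤ b ∧ ∀ s ∈ Ioo 0 δ, sep x (α s) < ε := by
  obtain ⟨δ, hδ, hs⟩ := mem_nhdsGT_iff_exists_Ioo_subset.1 ((h.tendsto_sep hU).eventually
    (gt_mem_nhds hε))
  exact ⟨min δ b, lt_min hδ h.pos, min_le_right _ _, fun s h => hs ⟨h.1, h.2.trans_le (min_le_left _ _)⟩⟩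

end IsTimelikeRay

lemma causO_or_iff {p q : X} : causO o p q ∨ causO o q p ↔ caus p q ∨ caus q p := by
  cases o
  · rfl
  · exact or_comm

/-- Small upper angles between curves of the same time orientation. -/
lemma exists_hingeCosh_lt (hU : IsComparisonDomain U) (hα : IsTimelikeRay o U x α b)
    (hβ : IsTimelikeRay o U x β b) {A : ℝ} (hA : 0 < A) (h : upperAngle α β < ENNReal.ofReal A) :
    ∃ δ > 0, δ ≤ b ∧ ∀ s ∈ Ioo 0 δ, ∀ t ∈ Ioo 0 δ, causO o (α s) (β t) ∨ causO o (β t) (α s) →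
      hingeCosh 0 x (α s) (β t) < Real.cosh A := by
  obtain ⟨δ, hδ, h1⟩ := exists_of_upperAngle_lt h
  refine ⟨min δ b, lt_min hδ hα.pos, min_le_right _ _, fun s hs t ht hr => ?_⟩
  have hs' : s ∈ Ioc 0 b := ⟨hs.1, (hs.2.trans_le (min_le_right _ _)).le⟩
  have ht' : t ∈ Ioc 0 b := ⟨ht.1, (ht.2.trans_le (min_le_right _ _)).le⟩
  have h2 := h1 s ⟨hs.1, hs.2.trans_le (min_le_left _ _)⟩ t ⟨ht.1, ht.2.trans_le (min_le_left _ _)⟩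
    (causO_or_iff.1 hr)
  have m1 := hα.mem s (Ioc_subset_Icc_self hs')
  have m2 := hβ.mem t (Ioc_subset_Icc_self ht')
  rw [hα.source, hU.comparisonAngle_eq_of_same hα.mem_source m1 m2 (hα.chronO hs') (hβ.chronO ht')
    hr, ofReal_arcosh_lt_iff (hU.one_le_hingeCosh hα.mem_source m1 m2 (hα.chronO hs')
    (hβ.chronO ht') hr (isSize_zero_left (sep_nonneg _ _)) (isSize_zero_left (sep_nonneg _ _))) hA]
    at h2
  exact h2

lemma upperAngle_le_of_hingeCosh_le (hU : IsComparisonDomain U) (hα : IsTimelikeRay o U x α b)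
    (hβ : IsTimelikeRay o U x β b) {A δ : ℝ} (hA : 0 ≤ A) (hδ : 0 < δ)
    (h : ∀ s ∈ Ioo 0 δ, ∀ t ∈ Ioo 0 δ, causO o (α s) (β t) ∨ causO o (β t) (α s) →
      hingeCosh 0 x (α s) (β t) ≤ Real.cosh A) : upperAngle α β ≤ ENNReal.ofReal A := by
  refine upperAngle_le (lt_min hδ hα.pos) fun s hs t ht hr => ?_
  have hs' : s ∈ Ioc 0 b := ⟨hs.1, (hs.2.trans_le (min_le_right _ _)).le⟩
  have ht' : t ∈ Ioc 0 b := ⟨ht.1, (ht.2.trans_le (min_le_right _ _)).le⟩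
  have hr := (causO_or_iff (o := o)).2 hr
  have m1 := hα.mem s (Ioc_subset_Icc_self hs')
  have m2 := hβ.mem t (Ioc_subset_Icc_self ht')
  rw [hα.source, hU.comparisonAngle_eq_of_same hα.mem_source m1 m2 (hα.chronO hs') (hβ.chronO ht')
    hr, ofReal_arcosh_le_iff (hU.one_le_hingeCosh hα.mem_source m1 m2 (hα.chronO hs')
    (hβ.chronO ht') hr (isSize_zero_left (sep_nonneg _ _)) (isSize_zero_left (sep_nonneg _ _))) hA]
  exact h s ⟨hs.1, hs.2.trans_le (min_le_left _ _)⟩ t ⟨ht.1, ht.2.trans_le (min_le_left _ _)⟩ hr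

/-- Small upper angles between curves of different time orientations. -/
lemma exists_neg_hingeCosh_lt (hU : IsComparisonDomain U) (hα : IsTimelikeRay o U x α b)
    (hβ : IsTimelikeRay o.rev U x β b) {A : ℝ} (hA : 0 < A)
    (h : upperAngle α β < ENNReal.ofReal A) :
    ∃ δ > 0, δ ≤ b ∧ ∀ s ∈ Ioo 0 δ, ∀ t ∈ Ioo 0 δ,
      -hingeCosh 0 x (α s) (β t) < Real.cosh A := by
  obtain ⟨δ, hδ, h1⟩ := exists_of_upperAngle_lt h
  refine ⟨min δ b, lt_min hδ hα.pos, min_le_right _ _, fun s hs t ht => ?_⟩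
  have hs' : s ∈ Ioc 0 b := ⟨hs.1, (hs.2.trans_le (min_le_right _ _)).le⟩
  have ht' : t ∈ Ioc 0 b := ⟨ht.1, (ht.2.trans_le (min_le_right _ _)).le⟩
  have h2 := h1 s ⟨hs.1, hs.2.trans_le (min_le_left _ _)⟩ t ⟨ht.1, ht.2.trans_le (min_le_left _ _)⟩
    ((causO_or_iff (o := o)).1 (Or.inr (causO_trans (causO_of_chronO (chronO_rev.1 (hβ.chronO ht')))
      (causO_of_chronO (hα.chronO hs')))))
  have m1 := hα.mem s (Ioc_subset_Icc_self hs')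
  have m2 := hβ.mem t (Ioc_subset_Icc_self ht')
  have h3 := hU.hingeCosh_le_neg_one (K := 0) hα.mem_source m1 m2 (hα.chronO hs') (hβ.chronO ht')
    (isSize_zero_left (sep_nonneg _ _))
  rw [hα.source, hU.comparisonAngle_eq_of_different hα.mem_source m1 m2 (hα.chronO hs')
    (hβ.chronO ht'), ofReal_arcosh_lt_iff (by linarith) hA] at h2
  exact h2

lemma upperAngle_le_of_neg_hingeCosh_le (hU : IsComparisonDomain U) (hα : IsTimelikeRay o U x α b)
    (hβ : IsTimelikeRay o.rev U x β b) {A δ : ℝ} (hA : 0 ≤ A) (hδ : 0 < δ)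
    (h : ∀ s ∈ Ioo 0 δ, ∀ t ∈ Ioo 0 δ, -hingeCosh 0 x (α s) (β t) ≤ Real.cosh A) :
    upperAngle α β ≤ ENNReal.ofReal A := by
  refine upperAngle_le (lt_min hδ hα.pos) fun s hs t ht hr => ?_
  have hs' : s ∈ Ioc 0 b := ⟨hs.1, (hs.2.trans_le (min_le_right _ _)).le⟩
  have ht' : t ∈ Ioc 0 b := ⟨ht.1, (ht.2.trans_le (min_le_right _ _)).le⟩
  have m1 := hα.mem s (Ioc_subset_Icc_self hs')
  have m2 := hβ.mem t (Ioc_subset_Icc_self ht')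
  have h3 := hU.hingeCosh_le_neg_one (K := 0) hα.mem_source m1 m2 (hα.chronO hs') (hβ.chronO ht')
    (isSize_zero_left (sep_nonneg _ _))
  rw [hα.source, hU.comparisonAngle_eq_of_different hα.mem_source m1 m2 (hα.chronO hs')
    (hβ.chronO ht'), ofReal_arcosh_le_iff (by linarith) hA]
  exact h s ⟨hs.1, hs.2.trans_le (min_le_left _ _)⟩ t ⟨ht.1, ht.2.trans_le (min_le_left _ _)⟩

end UpperAngle


/-! ### The triangle inequality for upper angles -/

section TriangleInequality

variable {X : Type*} [MetricSpace X] [LorentzianPreLengthSpace X] {o : TimeOrientation}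
  {U : Set X} {x : X} {α β γ : ℝ → X} {b : ℝ}

/-- The law of cosines as a bound for the third side. -/
lemma lt_sq_of_angleCosh_lt {a c s E : ℝ} (ha : 0 < a) (hc : 0 < c)
    (h : angleCosh 0 a c s < E) : a ^ 2 + c ^ 2 - 2 * a * c * E < s ^ 2 := by
  rw [angleCosh_zero_left, div_lt_iff₀ (by positivity)] at h
  linarith

lemma sq_lt_of_lt_angleCosh {a c s E : ℝ} (ha : 0 < a) (hc : 0 < c)
    (h : E < angleCosh 0 a c s) : s ^ 2 < a ^ 2 + c ^ 2 - 2 * a * c * E := by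
  rw [angleCosh_zero_left, lt_div_iff₀ (by positivity)] at h
  linarith

/-- Points of two curves with a finite angle are causally related once the ratio of their
distances from the vertex is large. -/
lemma exists_causO_of_mul_exp_lt (hU : IsComparisonDomain U) (hα : IsTimelikeRay o U x α b)
    (hβ : IsTimelikeRay o U x β b) {A δ : ℝ} (hA : 0 < A) (hδ : 0 < δ)
    (h : ∀ s ∈ Ioo 0 δ, ∀ t ∈ Ioo 0 δ, causO o (α s) (β t) ∨ causO o (β t) (α s) →
      hingeCosh 0 x (α s) (β t) < Real.cosh A) :
    ∃ δ' > 0, δ' ≤ δ ∧ δ' ≤ b ∧ ∀ s ∈ Ioo 0 δ', ∀ u ∈ Ioo 0 δ',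
      sep x (α s) * Real.exp A < sep x (β u) → causO o (α s) (β u) := by
  obtain ⟨w, hw0, hw⟩ := exists_between (lt_min hδ hα.pos)
  have hwδ := hw.trans_le (min_le_left _ _)
  have hwb := hw.trans_le (min_le_right _ _)
  -- A starting point for the continuity argument: `x ≪ β w` is an open condition, so `α s ≪ β w`
  -- for all small `s`.
  have e1 := eventually_chronO (hβ.chronO ⟨hw0, hwb.le⟩) hα.tendsto tendsto_const_nhds
  obtain ⟨d, hd, hd'⟩ := mem_nhdsGT_iff_exists_Ioo_subset.1 e1
  refine ⟨min d w, lt_min hd hw0, (min_le_right _ _).trans hwδ.le,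
    (min_le_right _ _).trans hwb.le, fun s hs u hu hsu => ?_⟩
  have hsw := hs.2.trans_le (min_le_right _ _)
  have huw := hu.2.trans_le (min_le_right _ _)
  have hcw : chronO o (α s) (β w) := hd' ⟨hs.1, hs.2.trans_le (min_le_left _ _)⟩
  have hs' : s ∈ Ioc 0 b := ⟨hs.1, (hsw.trans hwb).le⟩
  have mx := hα.mem_source
  have ms := hα.mem s (Ioc_subset_Icc_self hs')
  have ha := hU.sep_pos mx ms (hα.chronO hs')
  have hmem : ∀ v ∈ Icc u w, v ∈ Ioc 0 b := fun v hv => ⟨hu.1.trans_le hv.1, hv.2.trans hwb.le⟩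
  have hexp : 1 < Real.exp A := Real.one_lt_exp_iff.2 hA
  have hexp' : Real.exp (-A) < 1 := by rw [← Real.exp_zero]; exact Real.exp_lt_exp.2 (by linarith)
  have hee : Real.exp A * Real.exp (-A) = 1 := by rw [← Real.exp_add]; simp
  have hcosh := Real.cosh_eq A
  set a := sep x (α s) with hadef
  have hmono : ∀ v ∈ Icc u w, sep x (β u) ≤ sep x (β v) := fun v hv => by
    rcases hv.1.eq_or_lt with h | h
    · rw [h]
    · exact (hβ.sep_lt_sep hU (Ioc_subset_Icc_self (hmem u ⟨le_rfl, huw.le⟩))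
        (Ioc_subset_Icc_self (hmem v hv)) h).le
  have har : ∀ v ∈ Icc u w, a * Real.exp A < sep x (β v) := fun v hv => hsu.trans_le (hmono v hv)
  have hnot : ∀ v ∈ Icc u w, ¬ chronO o (β v) (α s) := fun v hv hcon => by
    have h1 := hU.sep_triangle mx (hβ.mem v (Ioc_subset_Icc_self (hmem v hv))) ms
      (causO_of_chronO (hβ.chronO (hmem v hv))) (causO_of_chronO hcon)
    have h2 := har v hv
    have h3 := sep_nonneg (β v) (α s)
    nlinarith
  -- `m` is the squared third side of the Minkowski hinge with sides `sep x (α s)`, `sep x (β u)`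
  -- and angle `A`, factored into null components. By the angle bound, the squared separation of `α
  -- s` and `β v` exceeds `m` whenever they are timelike related in this order.
  set m := (sep x (β u) - a * Real.exp A) * (sep x (β u) - a * Real.exp (-A)) with hm
  have hmpos : 0 < m := mul_pos (by linarith) (by nlinarith)
  have hlow : ∀ v ∈ Icc u w, chronO o (α s) (β v) → m < sep (α s) (β v) ^ 2 := fun v hv hc => by
    have h1 := lt_sq_of_angleCosh_lt ha (hU.sep_pos mx (hβ.mem v (Ioc_subset_Icc_self (hmem v hv)))
      (hβ.chronO (hmem v hv))) (h s ⟨hs.1, hsw.trans hwδ⟩ v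
      ⟨(hmem v hv).1, hv.2.trans_lt hwδ⟩ (Or.inl (causO_of_chronO hc)))
    rw [hcosh] at h1
    have h2 : m ≤ (sep x (β v) - a * Real.exp A) * (sep x (β v) - a * Real.exp (-A)) :=
      mul_le_mul (by linarith [hmono v hv]) (by linarith [hmono v hv]) (by nlinarith)
        (by linarith [har v hv])
    have h3 : (sep x (β v) - a * Real.exp A) * (sep x (β v) - a * Real.exp (-A))
        = a ^ 2 + sep x (β v) ^ 2 - 2 * a * sep x (β v) * ((Real.exp A + Real.exp (-A)) / 2) := by
      linear_combination a ^ 2 * hee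
    linarith
  by_contra hcon
  have hzero : sep (α s) (β u) = 0 := by
    by_contra h0
    rcases chronO_or_of_sep_pos (o := o) ((sep_nonneg _ _).lt_of_ne' h0) with h1 | h1
    · exact hcon (causO_of_chronO h1)
    · exact hnot u ⟨le_rfl, huw.le⟩ h1
  -- If `α s` and `β u` were unrelated, the squared separation would vary continuously from `0` at
  -- `u` to above `m` at `w` and would take the value `m / 2`, which is neither zero nor above `m`.
  have hcont : ContinuousOn (fun v => sep (α s) (β v) ^ 2) (Icc u w) :=
    ((hβ.continuousOn_sep hU ms).mono
      fun v hv => Ioc_subset_Icc_self (hmem v hv)).pow 2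
  obtain ⟨v, hv, hv'⟩ := intermediate_value_Icc huw.le hcont
    (show m / 2 ∈ Icc (sep (α s) (β u) ^ 2) (sep (α s) (β w) ^ 2) by
      have := hlow w ⟨huw.le, le_rfl⟩ hcw
      rw [hzero]
      exact ⟨by rw [zero_pow two_ne_zero]; linarith, by linarith⟩)
  simp only at hv'
  have hpos : 0 < sep (α s) (β v) := by
    refine (sep_nonneg _ _).lt_of_ne' fun h0 => ?_
    rw [h0] at hv'
    linarith
  rcases chronO_or_of_sep_pos (o := o) hpos with h1 | h1
  · linarith [hlow v hv h1]
  · exact hnot v hv h1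

/-- If the angle were larger, the point of `β` at the distance supplied by `exists_between_hinge`
would give a causal chain from `α s` to `γ t` whose total separation exceeds `τ(α s, γ t)`. -/
lemma exists_hingeCosh_le_cosh_add (hU : IsComparisonDomain U) (hα : IsTimelikeRay o U x α b)
    (hβ : IsTimelikeRay o U x β b) (hγ : IsTimelikeRay o U x γ b) {A B : ℝ} (hA : 0 < A)
    (hB : 0 < B) (h₁ : upperAngle α β < ENNReal.ofReal A)
    (h₂ : upperAngle β γ < ENNReal.ofReal B) :
    ∃ δ > 0, ∀ s ∈ Ioo 0 δ, ∀ t ∈ Ioo 0 δ, causO o (α s) (γ t) →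
      hingeCosh 0 x (α s) (γ t) ≤ Real.cosh (A + B) := by
  obtain ⟨d1, hd1, hd1b, H1⟩ := exists_hingeCosh_lt hU hα hβ hA h₁
  obtain ⟨d2, hd2, hd2b, H2⟩ := exists_hingeCosh_lt hU hβ hγ hB h₂
  obtain ⟨d3, hd3, hd31, hd3b, C1⟩ := exists_causO_of_mul_exp_lt hU hα hβ hA hd1 H1
  obtain ⟨d4, hd4, hd42, hd4b, C2⟩ := exists_causO_of_mul_exp_lt hU hβ hγ hB hd2 H2
  obtain ⟨w, hw0, hw⟩ := exists_between (lt_min hd3 hd4)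
  have hw3 := hw.trans_le (min_le_left _ _)
  have hw4 := hw.trans_le (min_le_right _ _)
  have hwb := hw3.le.trans hd3b
  have hβw := hβ.mono hw0 hwb
  have mx := hα.mem_source
  -- This yields `r < sep x (γ t) < sep x (β w)`, so that `β` attains the distance `r` before the
  -- parameter `w`.
  obtain ⟨d5, hd5, hd5b, H5⟩ := hγ.exists_sep_lt hU
    (hU.sep_pos mx (hβw.mem w ⟨hw0.le, le_rfl⟩) (hβw.chronO ⟨hw0, le_rfl⟩))
  refine ⟨min w d5, lt_min hw0 hd5, fun s hs t ht hst => ?_⟩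
  have hsw := hs.2.trans_le (min_le_left _ _)
  have htw := ht.2.trans_le (min_le_left _ _)
  have hs' : s ∈ Ioc 0 b := ⟨hs.1, hsw.le.trans hwb⟩
  have ht' : t ∈ Ioc 0 b := ⟨ht.1, htw.le.trans hwb⟩
  have ms := hα.mem s (Ioc_subset_Icc_self hs')
  have mt := hγ.mem t (Ioc_subset_Icc_self ht')
  have ha := hU.sep_pos mx ms (hα.chronO hs')
  have hc := hU.sep_pos mx mt (hγ.chronO ht')
  by_contra! hcon
  have hac := hU.sep_triangle mx ms mt (causO_of_chronO (hα.chronO hs')) hst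
  obtain ⟨r, hr1, hr2, hr⟩ := exists_between_hinge ha
    (by linarith [sep_nonneg (α s) (γ t)]) hA hB (sq_lt_of_lt_angleCosh ha hc hcon)
  have hr0 : 0 < r := (by positivity : 0 < sep x (α s) * Real.exp A).trans hr1
  have hrw : r < sep x (β w) := by
    have := H5 t ⟨ht.1, ht.2.trans_le (min_le_right _ _)⟩
    have := Real.one_lt_exp_iff.2 hB
    nlinarith
  obtain ⟨u, hu, hur⟩ := hβw.exists_sep_eq hU hr0 hrw
  have hu' : u ∈ Ioc 0 b := ⟨hu.1, hu.2.le.trans hwb⟩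
  have mu := hβ.mem u (Ioc_subset_Icc_self hu')
  have c1 := C1 s ⟨hs.1, hsw.trans hw3⟩ u ⟨hu.1, hu.2.trans hw3⟩ (by rw [hur]; exact hr1)
  have c2 := C2 u ⟨hu.1, hu.2.trans hw4⟩ t ⟨ht.1, htw.trans hw4⟩ (by rw [hur]; exact hr2)
  have k1 := lt_sq_of_angleCosh_lt ha (hur ▸ hr0) (H1 s ⟨hs.1, hsw.trans (hw3.trans_le hd31)⟩ u
    ⟨hu.1, hu.2.trans (hw3.trans_le hd31)⟩ (Or.inl c1))
  have k2 := lt_sq_of_angleCosh_lt (hur ▸ hr0) hc (H2 u ⟨hu.1, hu.2.trans (hw4.trans_le hd42)⟩ t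
    ⟨ht.1, htw.trans (hw4.trans_le hd42)⟩ (Or.inl c2))
  rw [hur] at k1 k2
  have := hr _ _ (sep_nonneg _ _) (sep_nonneg _ _) k1.le k2.le
  linarith [hU.sep_triangle ms mu mt c1 c2]

lemma exists_ofReal_of_add_lt {a c d : ℝ≥0∞} (h : a + c < d) : ∃ A B : ℝ, 0 < A ∧ 0 < B ∧
    a < ENNReal.ofReal A ∧ c < ENNReal.ofReal B ∧ ENNReal.ofReal (A + B) < d := by
  have hfin := h.trans_le le_top
  rw [ENNReal.add_lt_top] at hfin
  lift a to NNReal using hfin.1.ne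
  lift c to NNReal using hfin.2.ne
  obtain ⟨e, h1, h2⟩ := ENNReal.lt_iff_exists_nnreal_btwn.1 h
  rw [← ENNReal.coe_add, ENNReal.coe_lt_coe, ← NNReal.coe_lt_coe, NNReal.coe_add] at h1
  have ha : (0 : ℝ) ≤ a := a.2
  have hc : (0 : ℝ) ≤ c := c.2
  refine ⟨a + (e - (a + c)) / 2, c + (e - (a + c)) / 2, by linarith, by linarith, ?_, ?_, ?_⟩
  · rw [← ENNReal.ofReal_coe_nnreal]
    exact (ENNReal.ofReal_lt_ofReal_iff_of_nonneg ha).2 (by linarith)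
  · rw [← ENNReal.ofReal_coe_nnreal]
    exact (ENNReal.ofReal_lt_ofReal_iff_of_nonneg hc).2 (by linarith)
  · rw [show (a : ℝ) + (e - (a + c)) / 2 + (c + (e - (a + c)) / 2) = e by ring,
      ENNReal.ofReal_coe_nnreal]
    exact h2

lemma upperAngle_comm (h : α 0 = β 0) : upperAngle α β = upperAngle β α := by
  have key : ∀ α β : ℝ → X, α 0 = β 0 → upperAngle α β ≤ upperAngle β α := by
    intro α β h
    refine le_of_forall_gt_imp_ge_of_dense fun c hc => ?_
    obtain ⟨δ, hδ, H⟩ := exists_of_upperAngle_lt hc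
    refine upperAngle_le hδ fun s hs t ht hr => ?_
    refine le_trans ?_ (H t ht s hs hr.symm).le
    unfold comparisonAngle
    refine iSup₂_le fun p' hp' => ?_
    rw [isMinkowskiComparison_iff] at hp'
    have hq : IsMinkowskiComparison ![β 0, β t, α s] ![p' 0, p' 2, p' 1] := by
      rw [isMinkowskiComparison_iff, ← h]
      exact ⟨hp'.2.1, hp'.1, hp'.2.2.symm⟩
    refine le_trans (le_of_eq ?_) (le_iSup₂ (f := fun p' (_ : IsMinkowskiComparison
      ![β 0, β t, α s] p') => ENNReal.ofReal (minkowskiAngle (p' 0) (p' 1) (p' 2))) _ hq)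
    simp only [minkowskiAngle, Matrix.cons_val]
    rw [mul_comm (√_), show minkowskiInner (p' 0) (p' 1) (p' 2) = minkowskiInner (p' 0) (p' 2) (p' 1)
      by unfold minkowskiInner; ring]
  exact le_antisymm (key α β h) (key β α h.symm)

/-- The triangle inequality for angles between curves of the same time orientation. -/
lemma upperAngle_le_add (hU : IsComparisonDomain U) (hα : IsTimelikeRay o U x α b)
    (hβ : IsTimelikeRay o U x β b) (hγ : IsTimelikeRay o U x γ b) :
    upperAngle α γ ≤ upperAngle α β + upperAngle β γ := by
  by_contra! hcon
  obtain ⟨A, B, hA, hB, h1, h2, h3⟩ := exists_ofReal_of_add_lt hcon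
  refine h3.not_ge ?_
  obtain ⟨d1, hd1, H1⟩ := exists_hingeCosh_le_cosh_add hU hα hβ hγ hA hB h1 h2
  obtain ⟨d2, hd2, H2⟩ := exists_hingeCosh_le_cosh_add hU hγ hβ hα hB hA
    (by rwa [upperAngle_comm (hγ.source.trans hβ.source.symm)])
    (by rwa [upperAngle_comm (hβ.source.trans hα.source.symm)])
  refine upperAngle_le_of_hingeCosh_le hU hα hγ (by linarith) (lt_min hd1 hd2)
    fun s hs t ht hr => ?_
  rcases hr with hr | hr
  · exact H1 s ⟨hs.1, hs.2.trans_le (min_le_left _ _)⟩ t ⟨ht.1, ht.2.trans_le (min_le_left _ _)⟩ hr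
  · rw [hingeCosh_comm, add_comm]
    exact H2 t ⟨ht.1, ht.2.trans_le (min_le_right _ _)⟩ s ⟨hs.1, hs.2.trans_le (min_le_right _ _)⟩ hr

/-- The triangle inequality for angles between curves of different time orientations, the angle on
the left hand side being a limit. -/
lemma upperAngle_le_add_of_different (hU : IsComparisonDomain U) (hα : IsTimelikeRay o U x α b)
    (hβ : IsTimelikeRay o U x β b) (hγ : IsTimelikeRay o.rev U x γ b)
    (hlim : ∀ A > 0, ENNReal.ofReal A < upperAngle α γ → ∃ δ > 0, ∀ s ∈ Ioo 0 δ, ∀ t ∈ Ioo 0 δ,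
      Real.cosh A < -hingeCosh 0 x (α s) (γ t)) :
    upperAngle α γ ≤ upperAngle α β + upperAngle β γ := by
  by_contra! hcon
  obtain ⟨A, B, hA, hB, h1, h2, h3⟩ := exists_ofReal_of_add_lt hcon
  obtain ⟨d0, hd0, H0⟩ := hlim _ (by linarith) h3
  obtain ⟨d1, hd1, hd1b, H1⟩ := exists_hingeCosh_lt hU hα hβ hA h1
  obtain ⟨d2, hd2, hd2b, H2⟩ := exists_neg_hingeCosh_lt hU hβ hγ hB h2
  obtain ⟨d3, hd3, hd31, hd3b, C1⟩ := exists_causO_of_mul_exp_lt hU hα hβ hA hd1 H1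
  obtain ⟨w, hw0, hw⟩ := exists_between (lt_min hd0 (lt_min hd2 hd3))
  have hw0' := hw.trans_le (min_le_left _ _)
  have hw2 := hw.trans_le ((min_le_right _ _).trans (min_le_left _ _))
  have hw3 := hw.trans_le ((min_le_right _ _).trans (min_le_right _ _))
  have hwb := hw3.le.trans hd3b
  have hβw := hβ.mono hw0 hwb
  have mx := hα.mem_source
  have ht' : w ∈ Ioc 0 b := ⟨hw0, hwb⟩
  have mt := hγ.mem w (Ioc_subset_Icc_self ht')
  have hc := hU.sep_pos mx mt (hγ.chronO ht')
  have hβpos := hU.sep_pos mx (hβw.mem w ⟨hw0.le, le_rfl⟩) (hβw.chronO ⟨hw0, le_rfl⟩)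
  have sA := Real.sinh_pos_iff.2 hA
  have sB := Real.sinh_pos_iff.2 hB
  have sAB := Real.sinh_pos_iff.2 (add_pos hA hB)
  -- The endpoint `γ w` stays fixed and `s` is taken small in comparison. The first bound is the
  -- hypothesis of `exists_beyond_hinge`, the second lets `β` attain the distance `r` before `w`.
  -- Such lopsided pairs need not realize an upper limit, hence the assumption `hlim`.
  obtain ⟨d5, hd5, hd5b, H5⟩ := hα.exists_sep_lt hU (lt_min
    (show 0 < sep x (γ w) * Real.sinh B / (2 * Real.sinh A) by positivity)
    (show 0 < sep x (β w) * Real.sinh B / (2 * Real.sinh (A + B)) by positivity))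
  obtain ⟨s, hs0, hs⟩ := exists_between (lt_min hw0 hd5)
  have hsw := hs.trans_le (min_le_left _ _)
  have hs' : s ∈ Ioc 0 b := ⟨hs0, hsw.le.trans hwb⟩
  have ms := hα.mem s (Ioc_subset_Icc_self hs')
  have ha := hU.sep_pos mx ms (hα.chronO hs')
  have h5 := H5 s ⟨hs0, hs.trans_le (min_le_right _ _)⟩
  rw [lt_min_iff, lt_div_iff₀ (by positivity), lt_div_iff₀ (by positivity)] at h5
  obtain ⟨r, hr1, hr2, hr⟩ := exists_beyond_hinge (a := sep x (α s)) ha hc hA hB (by linarith [h5.1])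
  have hr0 : 0 < r := (by positivity : 0 < sep x (α s) * Real.exp A).trans hr1
  have hrw : r < sep x (β w) := hr2.trans_lt (by rw [div_lt_iff₀ sB]; linarith [h5.2])
  obtain ⟨u, hu, hur⟩ := hβw.exists_sep_eq hU hr0 hrw
  have hu' : u ∈ Ioc 0 b := ⟨hu.1, hu.2.le.trans hwb⟩
  have mu := hβ.mem u (Ioc_subset_Icc_self hu')
  have c1 := C1 s ⟨hs0, hsw.trans hw3⟩ u ⟨hu.1, hu.2.trans hw3⟩ (by rw [hur]; exact hr1)
  have k0 := H0 s ⟨hs0, hsw.trans hw0'⟩ w ⟨hw0, hw0'⟩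
  have k1 := lt_sq_of_angleCosh_lt ha (hur ▸ hr0) (H1 s ⟨hs0, hsw.trans (hw3.trans_le hd31)⟩ u
    ⟨hu.1, hu.2.trans (hw3.trans_le hd31)⟩ (Or.inl c1))
  have k2 := H2 u ⟨hu.1, hu.2.trans hw2⟩ w ⟨hw0, hw2⟩
  have k0' := lt_sq_of_angleCosh_lt ha hc (lt_neg.1 k0)
  have k2' := sq_lt_of_lt_angleCosh (hur ▸ hr0) hc (neg_lt.1 k2)
  rw [hur] at k1 k2'
  have := hr (sep (α s) (γ w)) (sep (α s) (β u)) (sep (β u) (γ w)) (sep_nonneg _ _)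
    (sep_nonneg _ _) (sep_nonneg _ _) (by linarith) k1.le (by linarith)
  have c0 := causO_trans (causO_of_chronO (chronO_rev.1 (hγ.chronO ht')))
    (causO_of_chronO (hα.chronO hs'))
  have := hU.sep_triangle mt ms mu c0 c1
  rw [sep_comm (γ w) (α s), sep_comm (γ w) (β u)] at this
  linarith

end TriangleInequality


/-! ### Geodesic rays, and angles as limits -/

section GeodesicRays

variable {X : Type*} [MetricSpace X] [LorentzianPreLengthSpace X] {o : TimeOrientation}
  {U : Set X} {K : ℝ} {x y z y' z' : X} {α β γ : ℝ → X} {a b c : ℝ} {I : Set ℝ}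

/-- Under an upper curvature bound, the comparison angle between geodesics of different time
orientations increases as the sides shrink. -/
lemma IsComparisonNhdAbove.hingeCosh_le_of_different (hU : IsComparisonNhdAbove K U) (hx : x ∈ U)
    (hy : y ∈ U) (hz : z ∈ U) (hxy : chronO o x y) (hxz : chronO o.rev x z)
    (hsize : IsSize K (sep y z)) (hy' : OnRealizerO o U x y y') (hz' : OnRealizerO o.rev U x z z')
    (hxy' : chronO o x y') (hxz' : chronO o.rev x z') :
    hingeCosh K x y' z' ≤ hingeCosh K x y z := by
  cases o
  · rw [hingeCosh_comm, hingeCosh_comm K x y]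
    rw [sep_comm] at hsize
    exact hU.angleCosh_le_of_past_future hx hz hy hxz hxy hsize hz' hy' hxz' hxy'
  · exact hU.angleCosh_le_of_past_future hx hy hz hxy hxz hsize hy' hz' hxy' hxz'

/-- Under a lower curvature bound, the comparison angle between geodesics of different time
orientations decreases as the sides shrink. -/
lemma IsComparisonNhdBelow.le_hingeCosh_of_different (hU : IsComparisonNhdBelow K U) (hx : x ∈ U)
    (hy : y ∈ U) (hz : z ∈ U) (hxy : chronO o x y) (hxz : chronO o.rev x z)
    (hsize : IsSize K (sep y z)) (hy' : OnRealizerO o U x y y') (hz' : OnRealizerO o.rev U x z z')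
    (hxy' : chronO o x y') (hxz' : chronO o.rev x z') :
    hingeCosh K x y z ≤ hingeCosh K x y' z' := by
  cases o
  · rw [hingeCosh_comm, hingeCosh_comm K x y']
    rw [sep_comm] at hsize
    exact hU.le_angleCosh_of_past_future hx hz hy hxz hxy hsize hz' hy' hxz' hxy'
  · exact hU.le_angleCosh_of_past_future hx hy hz hxy hxz hsize hy' hz' hxy' hxz'

/-- `α` restricted to `[0, b]` is a timelike distance realizer in `U` starting at `x`. -/
structure IsGeodesicRay (o : TimeOrientation) (U : Set X) (x : X) (α : ℝ → X) (b : ℝ) : Prop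
    extends IsTimelikeRay o U x α b where
  isCausalCurve : IsCausalCurve o α (Icc 0 b)
  isSepAdditiveOn : IsSepAdditiveOn α (Icc 0 b)

namespace IsGeodesicRay

lemma restrict (h : IsGeodesicRay o U x α b) (ha : 0 < a) (hab : a ≤ b) : IsGeodesicRay o U x α a where
  toIsTimelikeRay := h.mono ha hab
  isCausalCurve := h.isCausalCurve.mono (Icc_subset_Icc_right hab) ordConnected_Icc
    ⟨0, ⟨le_rfl, ha.le⟩, a, ⟨ha.le, le_rfl⟩, ha.ne⟩
  isSepAdditiveOn := h.isSepAdditiveOn.mono (Icc_subset_Icc_right hab)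

lemma onRealizerO (hU : IsComparisonDomain U) (h : IsGeodesicRay o U x α b) {s' s : ℝ}
    (hs : s ∈ Ioc 0 b) (hs' : s' ∈ Icc 0 s) : OnRealizerO o U x (α s) (α s') := by
  have h1 := h.restrict hs.1 hs.2
  rw [← h.source]
  exact onRealizerO_of_isSepAdditiveOn hU h1.isCausalCurve subset_rfl h1.isSepAdditiveOn h1.mem
    hs.1 hs'

end IsGeodesicRay

lemma tendsto_sep_prod (hU : IsComparisonDomain U) {o₁ o₂ : TimeOrientation} {a : ℝ}
    (hα : IsTimelikeRay o₁ U x α a) (hβ : IsTimelikeRay o₂ U x β b) :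
    Tendsto (fun z : ℝ × ℝ => sep (α z.1) (β z.2)) (𝓝[>] 0 ×ˢ 𝓝[>] 0) (𝓝 0) := by
  have := hU.tendsto_sep hα.mem_source hα.mem_source
    (hα.tendsto.comp (tendsto_fst (f := 𝓝[>] (0 : ℝ)) (g := 𝓝[>] (0 : ℝ))))
    (hβ.tendsto.comp (tendsto_snd (f := 𝓝[>] (0 : ℝ)) (g := 𝓝[>] (0 : ℝ))))
  rwa [hU.sep_self hα.mem_source] at this

lemma exists_forall_of_eventually_prod {P : ℝ × ℝ → Prop}
    (h : ∀ᶠ z in 𝓝[>] (0 : ℝ) ×ˢ 𝓝[>] (0 : ℝ), P z) :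
    ∃ δ > 0, ∀ s ∈ Ioo 0 δ, ∀ t ∈ Ioo 0 δ, P (s, t) := by
  rw [eventually_prod_iff] at h
  obtain ⟨p, hp, q, hq, hpq⟩ := h
  obtain ⟨d1, h1, hd1⟩ := mem_nhdsGT_iff_exists_Ioo_subset.1 hp
  obtain ⟨d2, h2, hd2⟩ := mem_nhdsGT_iff_exists_Ioo_subset.1 hq
  exact ⟨min d1 d2, lt_min h1 h2, fun s hs t ht =>
    hpq (hd1 ⟨hs.1, hs.2.trans_le (min_le_left _ _)⟩) (hd2 ⟨ht.1, ht.2.trans_le (min_le_right _ _)⟩)⟩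

/-- Comparison angles in the `K`-plane and in the Minkowski plane agree in the limit. -/
lemma exists_abs_hingeCosh_sub_le (hU : IsComparisonDomain U) {o₁ o₂ : TimeOrientation}
    (hα : IsTimelikeRay o₁ U x α b) (hβ : IsTimelikeRay o₂ U x β b) (K : ℝ) {ε : ℝ} (hε : 0 < ε) :
    ∃ δ > 0, δ ≤ b ∧ ∀ s ∈ Ioo 0 δ, ∀ t ∈ Ioo 0 δ, IsSize K (sep x (α s)) ∧ IsSize K (sep x (β t)) ∧
      IsSize K (sep (α s) (β t)) ∧ (1 ≤ |hingeCosh 0 x (α s) (β t)| →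
      |hingeCosh K x (α s) (β t) - hingeCosh 0 x (α s) (β t)| ≤
        ε * |hingeCosh 0 x (α s) (β t)|) := by
  obtain ⟨d, hd, H⟩ := exists_abs_angleCosh_sub_le K hε
  obtain ⟨e, he, hK⟩ := exists_isSize K
  have hde := lt_min hd he
  obtain ⟨d1, hd1, hb1, h1⟩ := hα.exists_sep_lt hU hde
  obtain ⟨d2, hd2, hb2, h2⟩ := hβ.exists_sep_lt hU hde
  obtain ⟨d3, hd3, h3⟩ := exists_forall_of_eventually_prod
    ((tendsto_sep_prod hU hα hβ).eventually (gt_mem_nhds hde))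
  refine ⟨min (min d1 d2) d3, lt_min (lt_min hd1 hd2) hd3,
    (min_le_left _ _).trans ((min_le_left _ _).trans hb1), fun s hs t ht => ?_⟩
  have hs1 := hs.2.trans_le ((min_le_left _ _).trans (min_le_left _ _))
  have ht1 := ht.2.trans_le ((min_le_left _ _).trans (min_le_right _ _))
  have k1 := lt_min_iff.1 (h1 s ⟨hs.1, hs1⟩)
  have k2 := lt_min_iff.1 (h2 t ⟨ht.1, ht1⟩)
  have k3 := lt_min_iff.1 (h3 s ⟨hs.1, hs.2.trans_le (min_le_right _ _)⟩ t
    ⟨ht.1, ht.2.trans_le (min_le_right _ _)⟩)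
  have hs' : s ∈ Ioc 0 b := ⟨hs.1, hs1.le.trans hb1⟩
  have ht' : t ∈ Ioc 0 b := ⟨ht.1, ht1.le.trans hb2⟩
  exact ⟨hK _ (sep_nonneg _ _) k1.2, hK _ (sep_nonneg _ _) k2.2, hK _ (sep_nonneg _ _) k3.2,
    H _ _ _ (hU.sep_pos hα.mem_source (hα.mem s (Ioc_subset_Icc_self hs')) (hα.chronO hs')) k1.1
    (hU.sep_pos hα.mem_source (hβ.mem t (Ioc_subset_Icc_self ht')) (hβ.chronO ht')) k2.1
    (sep_nonneg _ _) k3.1⟩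

/-- If the comparison angles in the `K`-plane are monotone, the angle between curves of different
time orientations is a limit. -/
lemma exists_cosh_lt_neg_hingeCosh (hU : IsComparisonDomain U) (hα : IsTimelikeRay o U x α b)
    (hγ : IsTimelikeRay o.rev U x γ b)
    (hmono : ∀ c, (∀ δ > 0, ∃ s ∈ Ioo 0 δ, ∃ t ∈ Ioo 0 δ, c < -hingeCosh K x (α s) (γ t)) →
      ∃ δ > 0, ∀ s ∈ Ioo 0 δ, ∀ t ∈ Ioo 0 δ, c < -hingeCosh K x (α s) (γ t))
    {A : ℝ} (hA : 0 < A) (h : ENNReal.ofReal A < upperAngle α γ) :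
    ∃ δ > 0, ∀ s ∈ Ioo 0 δ, ∀ t ∈ Ioo 0 δ, Real.cosh A < -hingeCosh 0 x (α s) (γ t) := by
  obtain ⟨A', hA', h'⟩ : ∃ A', A < A' ∧ ENNReal.ofReal A' < upperAngle α γ := by
    obtain ⟨e, h1, h2⟩ := ENNReal.lt_iff_exists_nnreal_btwn.1 h
    rw [← ENNReal.ofReal_coe_nnreal] at h1 h2
    exact ⟨e, (ENNReal.ofReal_lt_ofReal_iff_of_nonneg hA.le).1 h1, h2⟩
  have hc : Real.cosh A < Real.cosh A' := by
    rw [Real.cosh_lt_cosh, abs_of_pos hA, abs_of_pos (hA.trans hA')]; exact hA'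
  have hp := Real.cosh_pos A
  have hp' := Real.cosh_pos A'
  -- Chosen so that `(1 - ε) * cosh A' = (1 + ε) * cosh A`: one error in passing from the Minkowski
  -- plane to the `K`-plane, one in passing back.
  set ε := (Real.cosh A' - Real.cosh A) / (Real.cosh A' + Real.cosh A) with hε
  have hε0 : 0 < ε := div_pos (by linarith) (by linarith)
  have hεeq : ε * (Real.cosh A' + Real.cosh A) = Real.cosh A' - Real.cosh A := by
    rw [hε]; field_simp
  have hε1 : ε < 1 := by rw [hε, div_lt_one (by linarith)]; linarith
  obtain ⟨d, hd, hdb, H⟩ := exists_abs_hingeCosh_sub_le hU hα hγ K hε0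
  have key : ∀ s ∈ Ioo 0 d, ∀ t ∈ Ioo 0 d, 1 ≤ -hingeCosh 0 x (α s) (γ t) ∧
      |hingeCosh K x (α s) (γ t) - hingeCosh 0 x (α s) (γ t)| ≤
        ε * -hingeCosh 0 x (α s) (γ t) := by
    intro s hs t ht
    have hs' : s ∈ Ioc 0 b := ⟨hs.1, hs.2.le.trans hdb⟩
    have ht' : t ∈ Ioc 0 b := ⟨ht.1, ht.2.le.trans hdb⟩
    have h1 := hU.hingeCosh_le_neg_one (K := 0) hα.mem_source (hα.mem s (Ioc_subset_Icc_self hs'))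
      (hγ.mem t (Ioc_subset_Icc_self ht')) (hα.chronO hs') (hγ.chronO ht')
      (isSize_zero_left (sep_nonneg _ _))
    have h2 := (H s hs t ht).2.2.2
    rw [abs_of_neg (show hingeCosh 0 x (α s) (γ t) < 0 by linarith)] at h2
    exact ⟨by linarith, h2 (by linarith)⟩
  obtain ⟨d', hd', H'⟩ := hmono ((1 - ε) * Real.cosh A') (by
    intro δ hδ
    by_contra! hcon
    refine h'.not_ge (upperAngle_le_of_neg_hingeCosh_le hU hα hγ (hA.trans hA').le (lt_min hδ hd)
      fun s hs t ht => ?_)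
    have h1 := hcon s ⟨hs.1, hs.2.trans_le (min_le_left _ _)⟩ t
      ⟨ht.1, ht.2.trans_le (min_le_left _ _)⟩
    have h2 := key s ⟨hs.1, hs.2.trans_le (min_le_right _ _)⟩ t
      ⟨ht.1, ht.2.trans_le (min_le_right _ _)⟩
    have h3 := (abs_le.1 h2.2).2
    refine le_of_mul_le_mul_left (a := 1 - ε) ?_ (by linarith)
    linarith)
  refine ⟨min d' d, lt_min hd' hd, fun s hs t ht => ?_⟩
  have h1 := H' s ⟨hs.1, hs.2.trans_le (min_le_left _ _)⟩ t ⟨ht.1, ht.2.trans_le (min_le_left _ _)⟩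
  have h2 := key s ⟨hs.1, hs.2.trans_le (min_le_right _ _)⟩ t
    ⟨ht.1, ht.2.trans_le (min_le_right _ _)⟩
  have h3 := (abs_le.1 h2.2).1
  refine lt_of_mul_lt_mul_left (a := 1 + ε) ?_ (by linarith)
  linarith

/-- The negated signed cosine can only grow as the sides shrink, so a lower bound found at one small
pair of parameters persists at all smaller pairs. -/
lemma IsComparisonNhdAbove.exists_cosh_lt (hU : IsComparisonNhdAbove K U)
    (hα : IsGeodesicRay o U x α b) (hγ : IsGeodesicRay o.rev U x γ b) {A : ℝ} (hA : 0 < A)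
    (h : ENNReal.ofReal A < upperAngle α γ) :
    ∃ δ > 0, ∀ s ∈ Ioo 0 δ, ∀ t ∈ Ioo 0 δ, Real.cosh A < -hingeCosh 0 x (α s) (γ t) := by
  have hD := hU.toIsComparisonDomain
  obtain ⟨d, hd, hdb, H⟩ := exists_abs_hingeCosh_sub_le hD hα.toIsTimelikeRay hγ.toIsTimelikeRay K
    one_pos
  refine exists_cosh_lt_neg_hingeCosh (K := K) hD hα.toIsTimelikeRay hγ.toIsTimelikeRay
    (fun c hc => ?_) hA h
  obtain ⟨s, hs, t, ht, hst⟩ := hc d hd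
  refine ⟨min s t, lt_min hs.1 ht.1, fun s' hs' t' ht' => hst.trans_le (neg_le_neg ?_)⟩
  have ms : s ∈ Ioc 0 b := ⟨hs.1, hs.2.le.trans hdb⟩
  have mt : t ∈ Ioc 0 b := ⟨ht.1, ht.2.le.trans hdb⟩
  have ls := (hs'.2.trans_le (min_le_left _ _)).le
  have lt := (ht'.2.trans_le (min_le_right _ _)).le
  exact hU.hingeCosh_le_of_different hα.mem_source (hα.mem s (Ioc_subset_Icc_self ms))
    (hγ.mem t (Ioc_subset_Icc_self mt)) (hα.chronO ms) (hγ.chronO mt) (H s hs t ht).2.2.1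
    (hα.onRealizerO hD ms ⟨hs'.1.le, ls⟩) (hγ.onRealizerO hD mt ⟨ht'.1.le, lt⟩)
    (hα.chronO ⟨hs'.1, ls.trans ms.2⟩) (hγ.chronO ⟨ht'.1, lt.trans mt.2⟩)

/-- The negated signed cosine can only drop as the sides shrink, so a lower bound that holds at
arbitrarily small pairs holds at every small pair. -/
lemma IsComparisonNhdBelow.exists_cosh_lt (hU : IsComparisonNhdBelow K U)
    (hα : IsGeodesicRay o U x α b) (hγ : IsGeodesicRay o.rev U x γ b) {A : ℝ} (hA : 0 < A)
    (h : ENNReal.ofReal A < upperAngle α γ) :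
    ∃ δ > 0, ∀ s ∈ Ioo 0 δ, ∀ t ∈ Ioo 0 δ, Real.cosh A < -hingeCosh 0 x (α s) (γ t) := by
  have hD := hU.toIsComparisonDomain
  obtain ⟨d, hd, hdb, H⟩ := exists_abs_hingeCosh_sub_le hD hα.toIsTimelikeRay hγ.toIsTimelikeRay K
    one_pos
  refine exists_cosh_lt_neg_hingeCosh (K := K) hD hα.toIsTimelikeRay hγ.toIsTimelikeRay
    (fun c hc => ⟨d, hd, fun s hs t ht => ?_⟩) hA h
  obtain ⟨s', hs', t', ht', hst⟩ := hc (min s t) (lt_min hs.1 ht.1)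
  refine hst.trans_le (neg_le_neg ?_)
  have ms : s ∈ Ioc 0 b := ⟨hs.1, hs.2.le.trans hdb⟩
  have mt : t ∈ Ioc 0 b := ⟨ht.1, ht.2.le.trans hdb⟩
  have ls := (hs'.2.trans_le (min_le_left _ _)).le
  have lt := (ht'.2.trans_le (min_le_right _ _)).le
  exact hU.le_hingeCosh_of_different hα.mem_source (hα.mem s (Ioc_subset_Icc_self ms))
    (hγ.mem t (Ioc_subset_Icc_self mt)) (hα.chronO ms) (hγ.chronO mt) (H s hs t ht).2.2.1
    (hα.onRealizerO hD ms ⟨hs'.1.le, ls⟩) (hγ.onRealizerO hD mt ⟨ht'.1.le, lt⟩)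
    (hα.chronO ⟨hs'.1, ls.trans ms.2⟩) (hγ.chronO ⟨ht'.1, lt.trans mt.2⟩)

/-- An upper bound for the comparison angles in the `K`-plane bounds the upper angle. -/
lemma upperAngle_le_of_hingeCosh_le_of_lt (hU : IsComparisonDomain U) (hα : IsTimelikeRay o U x α b)
    (hβ : IsTimelikeRay o U x β b) {A C δ : ℝ} (hA : 0 ≤ A) (hδ : 0 < δ) (hC0 : 0 < C)
    (hC : C < Real.cosh A)
    (h : ∀ s ∈ Ioo 0 δ, ∀ t ∈ Ioo 0 δ, causO o (α s) (β t) ∨ causO o (β t) (α s) →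
      hingeCosh K x (α s) (β t) ≤ C) : upperAngle α β ≤ ENNReal.ofReal A := by
  have hp := Real.cosh_pos A
  -- With this relative error, a cosine at most `C` in the `K`-plane means at most `cosh A` in the
  -- Minkowski plane.
  have hε : 0 < 1 - C / Real.cosh A := by rw [sub_pos, div_lt_one hp]; exact hC
  obtain ⟨d, hd, hdb, H⟩ := exists_abs_hingeCosh_sub_le hU hα hβ K hε
  refine upperAngle_le_of_hingeCosh_le hU hα hβ hA (lt_min hδ hd) fun s hs t ht hr => ?_
  have h1 := h s ⟨hs.1, hs.2.trans_le (min_le_left _ _)⟩ t ⟨ht.1, ht.2.trans_le (min_le_left _ _)⟩ hr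
  have hsd : s ∈ Ioo 0 d := ⟨hs.1, hs.2.trans_le (min_le_right _ _)⟩
  have htd : t ∈ Ioo 0 d := ⟨ht.1, ht.2.trans_le (min_le_right _ _)⟩
  have hs' : s ∈ Ioc 0 b := ⟨hs.1, hsd.2.le.trans hdb⟩
  have ht' : t ∈ Ioc 0 b := ⟨ht.1, htd.2.le.trans hdb⟩
  have h2 := hU.one_le_hingeCosh (K := 0) hα.mem_source (hα.mem s (Ioc_subset_Icc_self hs'))
    (hβ.mem t (Ioc_subset_Icc_self ht')) (hα.chronO hs') (hβ.chronO ht') hr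
    (isSize_zero_left (sep_nonneg _ _)) (isSize_zero_left (sep_nonneg _ _))
  have h3 := (H s hsd t htd).2.2.2
  rw [abs_of_pos (show 0 < hingeCosh 0 x (α s) (β t) by linarith)] at h3
  have h4 := (abs_le.1 (h3 h2)).1
  have h5 : C / Real.cosh A * hingeCosh 0 x (α s) (β t) ≤ C := by linarith
  rw [div_mul_eq_mul_div, div_le_iff₀ hp] at h5
  exact le_of_mul_le_mul_left h5 hC0

end GeodesicRays


/-! ### Geodesics as distance realizers -/

section LocalAdditivity

variable {X : Type*} [MetricSpace X] [LorentzianPreLengthSpace X] {o : TimeOrientation}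
  {U : Set X} {K : ℝ} {x : X} {α γ : ℝ → X} {a b c : ℝ} {I : Set ℝ}

/-- Every point has a neighbourhood in which the time separation is finite. -/
def IsLocallyTauFinite (X : Type*) [MetricSpace X] [LorentzianPreLengthSpace X] : Prop :=
  ∀ x : X, ∃ V : Set X, x ∈ V ∧ IsOpen V ∧ ∀ p ∈ V, ∀ q ∈ V, tau p q < ⊤

lemma TimelikeCurvatureBoundedAbove.isLocallyTauFinite (h : TimelikeCurvatureBoundedAbove X K) :
    IsLocallyTauFinite X := fun x => by
  obtain ⟨U, hx, hU⟩ := h x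
  exact ⟨U, hx, hU.isOpen, hU.tau_lt_top⟩

lemma TimelikeCurvatureBoundedBelow.isLocallyTauFinite (h : TimelikeCurvatureBoundedBelow X K) :
    IsLocallyTauFinite X := fun x => by
  obtain ⟨U, hx, hU⟩ := h x
  exact ⟨U, hx, hU.isOpen, hU.tau_lt_top⟩

/-- By compactness the curve splits into finitely many pieces lying in sets where `τ` is finite, and
the length is subadditive. Thus the realizing condition of a geodesic is an equality of finite
values and implies additivity. -/
lemma IsLocallyTauFinite.tauLength_lt_top (hX : IsLocallyTauFinite X)
    (hγ : ContinuousOn γ (Icc a b)) (hab : a ≤ b) : tauLength o γ a b < ⊤ := by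
  choose V hxV hVo hV using hX
  obtain ⟨t, ht0, htm, ⟨m, hm⟩, ht⟩ := exists_monotone_Icc_subset_open_cover_Icc hab
    (c := fun x : X => (Icc a b).domRestrict γ ⁻¹' V x)
    (fun x => (hVo x).preimage hγ.domRestrict) (fun s _ => mem_iUnion.2 ⟨γ s, hxV _⟩)
  have key : ∀ n, tauLength o γ a (t n) < ⊤ := by
    intro n
    induction n with
    | zero => rw [ht0, tauLength_self]; exact ENNReal.zero_lt_top
    | succ n ih =>
      obtain ⟨x, hx⟩ := ht n
      have hle := htm n.le_succ
      have h1 : γ (t n) ∈ V x := hx (left_mem_Icc.2 hle)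
      have h2 : γ (t (n + 1)) ∈ V x := hx (right_mem_Icc.2 hle)
      refine (tauLength_le_add o γ a (t n) _).trans_lt (ENNReal.add_lt_top.2 ⟨ih, ?_⟩)
      refine (tauLength_le_tauO hle).trans_lt ?_
      cases o
      · exact hV x _ h1 _ h2
      · exact hV x _ h2 _ h1
  have := key m
  rwa [hm m le_rfl] at this

/-- Geodesics are locally distance realizers. -/
lemma IsGeodesic.exists_isTauAdditiveOn (hX : IsLocallyTauFinite X) (h : IsGeodesic o γ I) {t : ℝ}
    (ht : t ∈ I) : ∃ a b, Icc a b ⊆ I ∧ Icc a b ∈ 𝓝[I] t ∧ IsTauAdditiveOn o γ (Icc a b) := by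
  obtain ⟨a, b, h1, h2, h3⟩ := h.locally_realizing t ht
  have hab := nonempty_Icc.1 ⟨t, mem_of_mem_nhdsWithin ht h2⟩
  exact ⟨a, b, h1, h2, (isTauAdditiveOn_of_eq_tauLength h.isCausalCurve h1 h3
    (hX.tauLength_lt_top (h.isCausalCurve.locallyLipschitz.continuousOn.mono h1) hab)).1⟩

/-- Initial pieces of timelike geodesics are distance realizers in a given neighbourhood. -/
lemma IsTimelikeGeodesic.exists_isGeodesicRay (hX : IsLocallyTauFinite X)
    (hU : IsComparisonDomain U) (hx : x ∈ U) (h : IsTimelikeGeodesic o α (Icc 0 b)) (hb : 0 < b)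
    (hα : α 0 = x) : ∃ c > 0, c ≤ b ∧ IsGeodesicRay o U x α c := by
  have h0 : (0 : ℝ) ∈ Icc 0 b := ⟨le_rfl, hb.le⟩
  obtain ⟨a, d, h1, h2, h3⟩ := h.isGeodesic.exists_isTauAdditiveOn hX h0
  have hcont := h.isGeodesic.isCausalCurve.locallyLipschitz.continuousOn 0 h0
  have h4 : α ⁻¹' U ∈ 𝓝[Icc 0 b] 0 := hcont (hU.isOpen.mem_nhds (hα ▸ hx))
  have h5 := inter_mem h2 h4
  rw [nhdsWithin_Icc_eq_nhdsGE hb, mem_nhdsGE_iff_exists_Icc_subset] at h5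
  obtain ⟨e, he, h6⟩ := h5
  have he : 0 < e := he
  have h7 : Icc 0 e ⊆ Icc a d := fun s hs => (h6 hs).1
  have hcc := h.isGeodesic.isCausalCurve.mono (h7.trans h1) ordConnected_Icc
    ⟨0, ⟨le_rfl, he.le⟩, e, ⟨he.le, le_rfl⟩, he.ne⟩
  have hmem : ∀ s ∈ Icc 0 e, α s ∈ U := fun s hs => (h6 hs).2
  refine ⟨e, he, (h1 (h7 ⟨he.le, le_rfl⟩)).2, ⟨⟨he, hα, hmem, hcc.locallyLipschitz.continuousOn,
    fun s hs t ht => h.isTimelike s (h1 (h7 hs)) t (h1 (h7 ht))⟩, hcc, ?_⟩⟩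
  exact (isTauAdditiveOn_iff hU hcc hmem).1
    fun r hr t ht u hu => h3 r (h7 hr) t (h7 ht) u (h7 hu)

/-- By the reverse triangle inequality, a defect of additivity at the junction for two inner points
would also be a defect for the two endpoints. -/
lemma IsSepAdditiveOn.union (hU : IsComparisonDomain U) (hγ : IsCausalCurve o γ (Icc a c))
    (hmem : ∀ t ∈ Icc a c, γ t ∈ U) (hab : a ≤ b) (hbc : b ≤ c) (h₁ : IsSepAdditiveOn γ (Icc a b))
    (h₂ : IsSepAdditiveOn γ (Icc b c)) (h : sep (γ a) (γ c) = sep (γ a) (γ b) + sep (γ b) (γ c)) :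
    IsSepAdditiveOn γ (Icc a c) := by
  have tri : ∀ r ∈ Icc a c, ∀ t ∈ Icc a c, ∀ u ∈ Icc a c, r ≤ t → t ≤ u →
      sep (γ r) (γ t) + sep (γ t) (γ u) ≤ sep (γ r) (γ u) := fun r hr t ht u hu hrt htu =>
    hU.sep_triangle (hmem r hr) (hmem t ht) (hmem u hu) (hγ.causO_of_le hr ht hrt)
      (hγ.causO_of_le ht hu htu)
  have ma : a ∈ Icc a c := ⟨le_rfl, hab.trans hbc⟩
  have mb : b ∈ Icc a c := ⟨hab, hbc⟩
  have mc : c ∈ Icc a c := ⟨hab.trans hbc, le_rfl⟩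
  have key : ∀ r ∈ Icc a b, ∀ u ∈ Icc b c,
      sep (γ r) (γ u) = sep (γ r) (γ b) + sep (γ b) (γ u) := by
    intro r hr u hu
    have hr' : r ∈ Icc a c := ⟨hr.1, hr.2.trans hbc⟩
    have hu' : u ∈ Icc a c := ⟨hab.trans hu.1, hu.2⟩
    have e1 := h₁ a ⟨le_rfl, hab⟩ r hr b ⟨hab, le_rfl⟩ hr.1 hr.2
    have e2 := h₂ b ⟨le_rfl, hbc⟩ u hu c ⟨hbc, le_rfl⟩ hu.1 hu.2
    have e3 := tri a ma r hr' c mc hr.1 hr'.2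
    have e4 := tri r hr' u hu' c mc (hr.2.trans hu.1) hu.2
    have e5 := tri r hr' b mb u hu' hr.2 hu.1
    linarith
  intro r hr t ht u hu hrt htu
  rcases le_total u b with hub | hub
  · exact h₁ r ⟨hr.1, hrt.trans (htu.trans hub)⟩ t ⟨ht.1, htu.trans hub⟩ u ⟨hu.1, hub⟩ hrt htu
  rcases le_total b r with hbr | hbr
  · exact h₂ r ⟨hbr, hr.2⟩ t ⟨hbr.trans hrt, ht.2⟩ u ⟨hub, hu.2⟩ hrt htu
  have k1 := key r ⟨hr.1, hbr⟩ u ⟨hub, hu.2⟩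
  rcases le_total t b with htb | htb
  · have k2 := key t ⟨ht.1, htb⟩ u ⟨hub, hu.2⟩
    have k3 := h₁ r ⟨hr.1, hbr⟩ t ⟨ht.1, htb⟩ b ⟨hab, le_rfl⟩ hrt htb
    linarith
  · have k2 := key r ⟨hr.1, hbr⟩ t ⟨htb, ht.2⟩
    have k3 := h₂ b ⟨le_rfl, hbc⟩ t ⟨htb, ht.2⟩ u ⟨hub, hu.2⟩ htb htu
    linarith

/-- The interval on which a curve is a distance realizer is closed. -/
lemma isClosed_setOf_isSepAdditiveOn (hU : IsComparisonDomain U) (hγ : ContinuousOn γ (Icc 0 b))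
    (hmem : ∀ t ∈ Icc 0 b, γ t ∈ U) : IsClosed ({T | IsSepAdditiveOn γ (Icc 0 T)} ∩ Icc 0 b) := by
  refine IsSeqClosed.isClosed fun T S hT hS => ?_
  have hSb : S ∈ Icc 0 b := isClosed_Icc.mem_of_tendsto hS (Eventually.of_forall fun n => (hT n).2)
  refine ⟨fun r hr t ht u hu hrt htu => ?_, hSb⟩
  rcases hSb.1.eq_or_lt with h0 | hpos
  · have hr0 : r = 0 := le_antisymm (hr.2.trans_eq h0.symm) hr.1
    have ht0 : t = 0 := le_antisymm (ht.2.trans_eq h0.symm) ht.1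
    have hu0 : u = 0 := le_antisymm (hu.2.trans_eq h0.symm) hu.1
    rw [hr0, ht0, hu0, hU.sep_self (hmem 0 ⟨le_rfl, hSb.1.trans hSb.2⟩), add_zero]
  -- Linear rescaling moves points of `[0, S]` into `[0, T n]`, so that additivity passes to the
  -- limit even when `T n < S`.
  have hscale : ∀ v ∈ Icc 0 S, ∀ n, v * (T n / S) ∈ Icc 0 (T n) := fun v hv n => by
    have h1 := (hT n).2.1
    refine ⟨mul_nonneg hv.1 (div_nonneg h1 hSb.1), ?_⟩
    rw [mul_div_assoc', div_le_iff₀ hpos, mul_comm]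
    exact mul_le_mul_of_nonneg_left hv.2 h1
  have hlim : ∀ v ∈ Icc 0 S, Tendsto (fun n => γ (v * (T n / S))) atTop (𝓝 (γ v)) := fun v hv => by
    have h1 : Tendsto (fun n => v * (T n / S)) atTop (𝓝[Icc 0 b] v) := by
      refine tendsto_nhdsWithin_iff.2 ⟨?_, Eventually.of_forall fun n =>
        ⟨(hscale v hv n).1, (hscale v hv n).2.trans (hT n).2.2⟩⟩
      have := (hS.div_const S).const_mul v
      rwa [div_self hpos.ne', mul_one] at this
    exact (hγ v ⟨hv.1, hv.2.trans hSb.2⟩).tendsto.comp h1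
  have hm : ∀ v ∈ Icc 0 S, γ v ∈ U := fun v hv => hmem v ⟨hv.1, hv.2.trans hSb.2⟩
  refine tendsto_nhds_unique (hU.tendsto_sep (hm r hr) (hm u hu) (hlim r hr) (hlim u hu)) ?_
  refine ((hU.tendsto_sep (hm r hr) (hm t ht) (hlim r hr) (hlim t ht)).add
    (hU.tendsto_sep (hm t ht) (hm u hu) (hlim t ht) (hlim u hu))).congr fun n => ?_
  have hp : 0 ≤ T n / S := div_nonneg (hT n).2.1 hSb.1
  exact ((hT n).1 _ (hscale r hr n) _ (hscale t ht n) _ (hscale u hu n)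
    (mul_le_mul_of_nonneg_right hrt hp) (mul_le_mul_of_nonneg_right htu hp)).symm

/-- In a `≤ K`-comparison neighbourhood, timelike geodesics are distance realizers. -/
lemma IsComparisonNhdAbove.isSepAdditiveOn (hX : IsLocallyTauFinite X)
    (hU : IsComparisonNhdAbove K U) {B : ℝ} (h : IsTimelikeGeodesic o α (Icc 0 B)) (hb : 0 < b)
    (hbB : b ≤ B) (hmem : ∀ s ∈ Icc 0 b, α s ∈ U) (hsize : IsSize K (sep (α 0) (α b))) :
    IsSepAdditiveOn α (Icc 0 b) := by
  have hD := hU.toIsComparisonDomain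
  have hI : Icc 0 b ⊆ Icc 0 B := Icc_subset_Icc_right hbB
  have hc := h.isGeodesic.isCausalCurve.mono hI ordConnected_Icc
    ⟨0, ⟨le_rfl, hb.le⟩, b, ⟨hb.le, le_rfl⟩, hb.ne⟩
  have m0 : (0 : ℝ) ∈ Icc 0 b := ⟨le_rfl, hb.le⟩
  -- Continuity argument: the set of admissible `T` is closed and contains `0`, and it remains to
  -- extend beyond each `T < b`.
  have hsub : Icc 0 b ⊆ {T | IsSepAdditiveOn α (Icc 0 T)} := by
    refine (isClosed_setOf_isSepAdditiveOn hD hc.locallyLipschitz.continuousOn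
      hmem).Icc_subset_of_forall_exists_gt ?_ ?_
    · intro r hr t ht u hu _ _
      rw [Icc_self, mem_singleton_iff] at hr ht hu
      rw [hr, ht, hu, hD.sep_self (hmem 0 m0), add_zero]
    · rintro T ⟨hT, hT0, hTb⟩ y hy
      have hTb' : T ∈ Icc 0 b := ⟨hT0, hTb.le⟩
      obtain ⟨e, d, h1, h2, h3⟩ : ∃ e d, Icc e d ⊆ Icc 0 b ∧ Icc e d ∈ 𝓝[Icc 0 b] T ∧
          IsTauAdditiveOn o α (Icc e d) := by
        obtain ⟨e, d, h1, h2, h3⟩ := h.isGeodesic.exists_isTauAdditiveOn hX (hI hTb')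
        have hTed := mem_of_mem_nhdsWithin (hI hTb') h2
        have hsub : Icc e (min d b) ⊆ Icc e d := Icc_subset_Icc_right (min_le_left _ _)
        refine ⟨e, min d b, fun s hs => ⟨(h1 (hsub hs)).1, hs.2.trans (min_le_right _ _)⟩, ?_,
          fun r hr t ht u hu => h3 r (hsub hr) t (hsub ht) u (hsub hu)⟩
        filter_upwards [nhdsWithin_mono _ hI h2, self_mem_nhdsWithin] with s hs hs'
        exact ⟨hs.1, le_min hs.2 hs'.2⟩
      have hTed := mem_of_mem_nhdsWithin hTb' h2
      obtain ⟨T', hTT', hT'd, hT'y⟩ : ∃ T', T < T' ∧ T' ≤ d ∧ T' ≤ y := by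
        have h4 : Icc e d ∈ 𝓝[≥] T := by
          have : 𝓝[Icc T b] T ≤ 𝓝[Icc 0 b] T := nhdsWithin_mono _ (Icc_subset_Icc_left hT0)
          rw [nhdsWithin_Icc_eq_nhdsGE hTb] at this
          exact this h2
        obtain ⟨w, hw, h5⟩ := mem_nhdsGE_iff_exists_Icc_subset.1 h4
        exact ⟨min w y, lt_min hw hy, (min_le_left _ _).trans (h5 ⟨le_of_lt hw, le_rfl⟩).2,
          min_le_right _ _⟩
      have hT'm : T' ∈ Icc e d := ⟨hTed.1.trans hTT'.le, hT'd⟩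
      have hT'b := h1 hT'm
      have hadd : IsSepAdditiveOn α (Icc e d) := (isTauAdditiveOn_iff hD
        (hc.mono h1 ordConnected_Icc ⟨T, hTed, T', hT'm, hTT'.ne⟩) fun s hs => hmem s (h1 hs)).1 h3
      refine ⟨T', ?_, hTT', hT'y⟩
      have hcT' : IsCausalCurve o α (Icc 0 T') := hc.mono (Icc_subset_Icc_right hT'b.2)
        ordConnected_Icc ⟨0, ⟨le_rfl, hT0.trans hTT'.le⟩, T', ⟨hT0.trans hTT'.le, le_rfl⟩,
          (hT0.trans_lt hTT').ne⟩
      refine IsSepAdditiveOn.union hD hcT' (fun s hs => hmem s ⟨hs.1, hs.2.trans hT'b.2⟩) hT0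
        hTT'.le hT (hadd.mono (Icc_subset_Icc hTed.1 hT'd)) ?_
      rcases hT0.eq_or_lt with h0 | hTpos
      · rw [← h0, hD.sep_self (hmem 0 m0), zero_add]
      -- Both `c < T` and `T' > T` belong to a piece on which the geodesic realizes, so the triangle
      -- with vertices `α c`, `α T`, `α T'` is degenerate.
      obtain ⟨c, hc0, hce, hcT⟩ : ∃ c, 0 ≤ c ∧ e ≤ c ∧ c < T := by
        have h4 : Icc e d ∈ 𝓝[≤] T := by
          have : 𝓝[Icc 0 T] T ≤ 𝓝[Icc 0 b] T := nhdsWithin_mono _ (Icc_subset_Icc_right hTb.le)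
          rw [nhdsWithin_Icc_eq_nhdsLE hTpos] at this
          exact this h2
        obtain ⟨w, hw, h5⟩ := mem_nhdsLE_iff_exists_Icc_subset.1 h4
        have hw : w < T := hw
        exact ⟨max w 0, le_max_right _ _, (h5 ⟨le_rfl, hw.le⟩).1.trans (le_max_left _ _),
          max_lt hw hTpos⟩
      have hcb : c ∈ Icc 0 b := ⟨hc0, hcT.le.trans hTb.le⟩
      have M0 := hmem 0 m0
      have MT := hmem T hTb'
      have MT' := hmem T' hT'b
      have Mc := hmem c hcb
      have C1 : chronO o (α T) (α T') := h.isTimelike T (hI hTb') T' (hI hT'b) hTT'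
      have C2 : chronO o.rev (α T) (α 0) := chronO_rev.2 (h.isTimelike 0 (hI m0) T (hI hTb') hTpos)
      have C3 : chronO o.rev (α T) (α c) := chronO_rev.2 (h.isTimelike c (hI hcb) T (hI hTb') hcT)
      have t1 := hD.sep_triangle M0 MT MT' (causO_of_chronO (chronO_rev.1 C2)) (causO_of_chronO C1)
      have t2 := hD.sep_triangle M0 MT' (hmem b ⟨hb.le, le_rfl⟩)
        (hc.causO_of_le m0 hT'b hT'b.1) (hc.causO_of_le hT'b ⟨hb.le, le_rfl⟩ hT'b.2)
      have hs : IsSize K (sep (α T') (α 0)) := by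
        rw [sep_comm]
        exact hsize.mono (sep_nonneg _ _) (by linarith [sep_nonneg (α T') (α b)])
      have p1 := hD.sep_pos MT MT' C1
      have p2 := hD.sep_pos MT Mc C3
      have p3 := hD.sep_pos MT M0 C2
      have e1 := hadd c ⟨hce, hcT.le.trans hTed.2⟩ T hTed T' hT'm hcT.le hTT'.le
      have e2 := hT 0 ⟨le_rfl, hT0⟩ c ⟨hc0, hcT.le⟩ T ⟨hT0, le_rfl⟩ hc0 hcT.le
      rw [sep_comm (α 0) (α T), sep_comm (α 0) (α T')] at t1 ⊢
      rw [sep_comm (α 0) (α T), sep_comm (α c) (α T)] at e2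
      rw [sep_comm (α c) (α T'), sep_comm (α c) (α T)] at e1
      have hsT' : IsSize K (sep (α T) (α T')) := hs.mono p1.le (by linarith)
      have hsc : IsSize K (sep (α T) (α c)) := hs.mono p2.le (by linarith [sep_nonneg (α 0) (α c)])
      -- Monotonicity at `α T`: the signed cosine `-1` of the degenerate triangle with `α c` bounds
      -- from below that of the triangle with `α 0`, whose sides at `α T` are therefore aligned as
      -- well.
      have key := hU.hingeCosh_le_of_different MT MT' M0 C1 C2 hs
        (exists_onRealizerO hD MT MT' C1).2
        (onRealizerO_rev.2 (onRealizerO_of_isSepAdditiveOn hD hc (Icc_subset_Icc_right hTb.le) hT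
          (fun s hs => hmem s ⟨hs.1, hs.2.trans hTb.le⟩) hTpos ⟨hc0, hcT.le⟩)) C1 C3
      rw [hingeCosh, e1, add_comm, angleCosh_add p1 p2 hsT' hsc] at key
      rw [eq_add_of_neg_one_le_angleCosh p1 p3 hs (by linarith) key, add_comm]
  exact hsub ⟨hb.le, le_rfl⟩

/-- A distance realizer between chronologically related points of `U` is timelike. -/
lemma IsComparisonDomain.isTimelikeOn (hU : IsComparisonDomain U) (hγ : IsCausalCurve o γ (Icc a b))
    (hmem : ∀ t ∈ Icc a b, γ t ∈ U) (hadd : IsSepAdditiveOn γ (Icc a b))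
    (h : chronO o (γ a) (γ b)) : IsTimelikeOn o γ (Icc a b) := by
  obtain ⟨w, hw⟩ := hγ.nontrivial.nonempty
  have hab := hw.1.trans hw.2
  have ma : a ∈ Icc a b := ⟨le_rfl, hab⟩
  have mb : b ∈ Icc a b := ⟨hab, le_rfl⟩
  cases o
  · exact hU.connected.timelike_of_realizer _ (hmem a ma) _ (hmem b mb) h γ a b
      ⟨isDistanceRealizer_of_isTauAdditiveOn hγ ((isTauAdditiveOn_iff hU hγ hmem).2 hadd)
        (hU.tau_self (hmem a ma)), rfl, rfl, hmem⟩
  · have hneg : -Icc a b = Icc (-b) (-a) := by ext x; simp [and_comm]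
    have h1 := hγ.rev
    rw [hneg] at h1
    have hm : ∀ {x}, x ∈ Icc (-b) (-a) → -x ∈ Icc a b := fun hx =>
      ⟨by linarith [hx.2], by linarith [hx.1]⟩
    have hmem' : ∀ t ∈ Icc (-b) (-a), (fun t => γ (-t)) t ∈ U := fun t ht => hmem _ (hm ht)
    have hadd' : IsSepAdditiveOn (fun t => γ (-t)) (Icc (-b) (-a)) :=
      fun r hr t ht u hu hrt htu => by
        have := hadd _ (hm hu) _ (hm ht) _ (hm hr) (by linarith) (by linarith)
        rw [sep_comm, this, sep_comm (γ (-t)) (γ (-r)), sep_comm (γ (-u)) (γ (-t)), add_comm]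
    have := hU.connected.timelike_of_realizer _ (hmem b mb) _ (hmem a ma) h (fun t => γ (-t)) (-b)
      (-a) ⟨isDistanceRealizer_of_isTauAdditiveOn h1 ((isTauAdditiveOn_iff hU h1 hmem').2 hadd')
        (hU.tau_self (hmem' _ ⟨le_rfl, by linarith⟩)), by simp, by simp, hmem'⟩
    intro s hs t ht hst
    have := this (-t) ⟨by linarith [ht.2], by linarith [ht.1]⟩ (-s)
      ⟨by linarith [hs.2], by linarith [hs.1]⟩ (by linarith)
    simp only [neg_neg] at this
    exact this

end LocalAdditivity

/-! ### Confinement of curves by strong causality -/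

section StrongCausality

variable {X : Type*} [MetricSpace X] [LorentzianPreLengthSpace X] {o : TimeOrientation}

/-- In a strongly causal space, causal curves with endpoints close to `x` stay close to `x`. -/
lemma StronglyCausal.exists_nhds (hX : StronglyCausal X) {U : Set X} (hU : IsOpen U) {x : X}
    (hx : x ∈ U) : ∃ W ∈ 𝓝 x, ∀ p ∈ W, ∀ q ∈ W, ∀ z, causO o p z → causO o z q → z ∈ U := by
  have key : ∀ U : Set X, TopologicalSpace.GenerateOpen
      {S : Set X | ∃ p q : X, S = {z | chron p z ∧ chron z q}} U → ∀ x ∈ U,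
      ∃ W ∈ 𝓝 x, ∀ p ∈ W, ∀ q ∈ W, ∀ z, caus p z → caus z q → z ∈ U := by
    intro U hU
    induction hU with
    | basic S hS =>
      obtain ⟨p, q, rfl⟩ := hS
      rintro x ⟨h1, h2⟩
      -- A diamond is its own `W`: from `p ≪ p' ≤ z ≤ q' ≪ q` the point `z` lies in it again. Finite
      -- intersections and unions inherit the property.
      refine ⟨{z | chron p z ∧ chron z q}, ?_, ?_⟩
      · exact (eventually_chronO (o := .future) h1 tendsto_const_nhds tendsto_id).and
          (eventually_chronO (o := .future) h2 tendsto_id tendsto_const_nhds)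
      · intro p' hp' q' hq' z h3 h4
        exact ⟨chronO_of_chronO_of_causO (o := .future) hp'.1 h3,
          chronO_of_causO_of_chronO (o := .future) h4 hq'.2⟩
    | univ => exact fun x _ => ⟨univ, univ_mem, fun _ _ _ _ _ _ _ => mem_univ _⟩
    | inter s t _ _ ihs iht =>
      intro x hx
      obtain ⟨W, hW, h⟩ := ihs x hx.1
      obtain ⟨W', hW', h'⟩ := iht x hx.2
      exact ⟨W ∩ W', inter_mem hW hW', fun p hp q hq z h1 h2 =>
        ⟨h p hp.1 q hq.1 z h1 h2, h' p hp.2 q hq.2 z h1 h2⟩⟩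
    | sUnion S _ ih =>
      rintro x ⟨s, hs, hxs⟩
      obtain ⟨W, hW, h⟩ := ih s hs x hxs
      exact ⟨W, hW, fun p hp q hq z h1 h2 => ⟨s, hs, h p hp q hq z h1 h2⟩⟩
  have hU' : TopologicalSpace.GenerateOpen
      {S : Set X | ∃ p q : X, S = {z | chron p z ∧ chron z q}} U := by
    have : IsOpen[TopologicalSpace.generateFrom
        {S : Set X | ∃ p q : X, S = {z | chron p z ∧ chron z q}}] U := by
      rw [show TopologicalSpace.generateFrom _ = _ from hX]; exact hU
    exact this
  obtain ⟨W, hW, h⟩ := key U hU' x hx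
  cases o
  · exact ⟨W, hW, h⟩
  · exact ⟨W, hW, fun p hp q hq z h1 h2 => h q hq p hp z h2 h1⟩

/-- In a strongly causal space, curves converging pointwise to a curve from `x` stay in a given
neighbourhood of `x` on a common interval. -/
lemma StronglyCausal.exists_eventually_mem (hX : StronglyCausal X) {U : Set X} (hU : IsOpen U)
    {x : X} (hx : x ∈ U) {B : ℝ} (hB : 0 < B) {α : ℝ → X} {αs : ℕ → ℝ → X}
    (hα : IsCausalCurve o α (Icc 0 B)) (hαs : ∀ n, IsCausalCurve o (αs n) (Icc 0 B)) (hα0 : α 0 = x)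
    (hαs0 : ∀ n, αs n 0 = x)
    (hlim : ∀ s ∈ Icc 0 B, Tendsto (fun n => αs n s) atTop (𝓝 (α s))) :
    ∃ b ∈ Ioc 0 B, ∀ᶠ n in atTop, ∀ s ∈ Icc 0 b, αs n s ∈ U := by
  obtain ⟨W, hW, h⟩ := hX.exists_nhds (o := o) hU hx
  have hcont := hα.locallyLipschitz.continuousOn 0 ⟨le_rfl, hB.le⟩
  have h1 : α ⁻¹' interior W ∈ 𝓝[Icc 0 B] 0 :=
    hcont (isOpen_interior.mem_nhds (hα0 ▸ mem_interior_iff_mem_nhds.2 hW))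
  rw [nhdsWithin_Icc_eq_nhdsGE hB, mem_nhdsGE_iff_exists_Icc_subset] at h1
  obtain ⟨e, he, h2⟩ := h1
  have he : 0 < e := he
  have hb : 0 < min e B := lt_min he hB
  refine ⟨min e B, ⟨hb, min_le_right _ _⟩, ?_⟩
  have h3 : α (min e B) ∈ interior W := h2 ⟨hb.le, min_le_left _ _⟩
  filter_upwards [(hlim (min e B) ⟨hb.le, min_le_right _ _⟩).eventually
    (isOpen_interior.mem_nhds h3)] with n hn s hs
  have ms : s ∈ Icc 0 B := ⟨hs.1, hs.2.trans (min_le_right _ _)⟩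
  -- The point `αs n s` is causally between `x` and `αs n (min e B)`, both of which lie in `W`.
  refine h x (mem_of_mem_nhds hW) _ (interior_subset hn) _ ?_
    ((hαs n).causO_of_le ms ⟨hb.le, min_le_right _ _⟩ hs.2)
  rw [← hαs0 n]
  exact (hαs n).causO_of_le ⟨le_rfl, hB.le⟩ ms hs.1

end StrongCausality


/-! ### Vanishing angles under an upper curvature bound -/

section Limits

variable {X : Type*} [MetricSpace X] [LorentzianPreLengthSpace X] {o : TimeOrientation}
  {U : Set X} {K : ℝ} {x y z : X} {α : ℝ → X} {αs : ℕ → ℝ → X} {b B : ℝ}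

lemma IsComparisonDomain.tendsto_hingeCosh (hU : IsComparisonDomain U) {ι : Type*} {l : Filter ι}
    {f g : ι → X} (hx : x ∈ U) (hy : y ∈ U) (hz : z ∈ U) (hxy : 0 < sep x y) (hxz : 0 < sep x z)
    (h₁ : IsSize K (sep x y)) (h₂ : IsSize K (sep x z)) (hf : Tendsto f l (𝓝 y))
    (hg : Tendsto g l (𝓝 z)) :
    Tendsto (fun i => hingeCosh K x (f i) (g i)) l (𝓝 (hingeCosh K x y z)) := by
  have ta := hU.tendsto_sep hx hy tendsto_const_nhds hf
  have tc := hU.tendsto_sep hx hz tendsto_const_nhds hg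
  have tb := hU.tendsto_sep hy hz hf hg
  have sn : ∀ {u : ι → ℝ} {v : ℝ}, Tendsto u l (𝓝 v) →
      Tendsto (fun i => snHalf K (u i)) l (𝓝 (snHalf K v)) :=
    fun h => ((continuous_snHalf K).tendsto _).comp h
  have cs : ∀ {u : ι → ℝ} {v : ℝ}, Tendsto u l (𝓝 v) →
      Tendsto (fun i => csHalf K (u i)) l (𝓝 (csHalf K v)) :=
    fun h => ((continuous_csHalf K).tendsto _).comp h
  exact (((((sn ta).pow 2).mul ((cs tc).pow 2)).add (((sn tc).pow 2).mul ((cs ta).pow 2))).sub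
    ((sn tb).pow 2)).div (((((sn ta).mul (cs ta)).const_mul 2).mul ((sn tc).mul (cs tc))))
    (angleCosh_denom_pos h₁ h₂ hxy hxz).ne'

/-- Since `cosh A > 1` for `A > 0`, a bound halfway between `1` and `cosh A` leaves room for the
discrepancy between the `K`-plane and the Minkowski plane. -/
lemma tendsto_upperAngle_zero (hU : IsComparisonDomain U) (hα : ∃ c, IsTimelikeRay o U x α c)
    (hαs : ∀ n, ∃ c, IsTimelikeRay o U x (αs n) c)
    (h : ∀ C > 1, ∀ᶠ n in atTop, ∃ δ > 0, ∀ s ∈ Ioo 0 δ, ∀ t ∈ Ioo 0 δ,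
      causO o (αs n s) (α t) ∨ causO o (α t) (αs n s) → hingeCosh K x (αs n s) (α t) ≤ C) :
    Tendsto (fun n => upperAngle (αs n) α) atTop (𝓝 0) := by
  rw [ENNReal.tendsto_nhds_zero]
  intro ε hε
  obtain ⟨A, h1, h2⟩ := ENNReal.lt_iff_exists_nnreal_btwn.1 hε
  rw [← ENNReal.ofReal_coe_nnreal] at h1 h2
  have hA : (0 : ℝ) < A := ENNReal.ofReal_pos.1 h1
  have hc := Real.one_lt_cosh.2 hA.ne'
  filter_upwards [h ((1 + Real.cosh A) / 2) (by linarith)] with n hn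
  obtain ⟨δ, hδ, H⟩ := hn
  obtain ⟨c, hα⟩ := hα
  obtain ⟨d, hαn⟩ := hαs n
  have hp := lt_min hα.pos hαn.pos
  exact (upperAngle_le_of_hingeCosh_le_of_lt hU (hαn.mono hp (min_le_right _ _))
    (hα.mono hp (min_le_left _ _)) hA.le hδ (by linarith) (by linarith) H).trans h2.le

/-- Small initial pieces of a ray satisfy the size bounds. -/
lemma IsGeodesicRay.exists_isSize (hU : IsComparisonDomain U) (h : IsGeodesicRay o U x α b) (K : ℝ) :
    ∃ c > 0, c ≤ b ∧ ∃ δ, sep x (α c) < δ ∧ ∀ r, 0 ≤ r → r < δ → IsSize K r := by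
  obtain ⟨δ, hδ, hK⟩ := LorentzianPreLengthSpace.exists_isSize K
  obtain ⟨e, he, heb, H⟩ := h.toIsTimelikeRay.exists_sep_lt hU hδ
  exact ⟨e / 2, half_pos he, by linarith, δ, H _ ⟨half_pos he, half_lt_self he⟩, hK⟩

/-- Under an upper curvature bound, the angle between a limit geodesic and the geodesics of the
sequence tends to zero. -/
lemma IsComparisonNhdAbove.tendsto_upperAngle_zero (hX : IsLocallyTauFinite X)
    (hU : IsComparisonNhdAbove K U) (hx : x ∈ U) (hB : 0 < B)
    (hα : IsTimelikeGeodesic o α (Icc 0 B)) (hαs : ∀ n, IsTimelikeGeodesic o (αs n) (Icc 0 B))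
    (hα0 : α 0 = x) (hαs0 : ∀ n, αs n 0 = x)
    (hlim : ∀ s ∈ Icc 0 B, Tendsto (fun n => αs n s) atTop (𝓝 (α s))) (hb : b ∈ Ioc 0 B)
    (hmem : ∀ᶠ n in atTop, ∀ s ∈ Icc 0 b, αs n s ∈ U) :
    Tendsto (fun n => upperAngle (αs n) α) atTop (𝓝 0) := by
  have hD := hU.toIsComparisonDomain
  obtain ⟨c, hc, hcB, hαc⟩ := hα.exists_isGeodesicRay hX hD hx hB hα0
  obtain ⟨e, he, hec, δ, heδ, hδ⟩ := (hαc.restrict (lt_min hc hb.1) (min_le_left c b)).exists_isSize hD K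
  have heb := hec.trans (min_le_right c b)
  have hαe := hαc.restrict he (hec.trans (min_le_left c b))
  -- Different parameters on the two curves make the limit pair `α (e / 2) ≪ α e` timelike related,
  -- an open condition that the pairs `αs n (e / 2)`, `α e` eventually satisfy.
  have he2 : 0 < e / 2 := half_pos he
  have he2e : e / 2 < e := half_lt_self he
  have m1 : e / 2 ∈ Ioc 0 e := ⟨he2, he2e.le⟩
  have m2 : e ∈ Ioc 0 e := ⟨he, le_rfl⟩
  have heB := heb.trans hb.2
  have U1 := hαe.mem _ (Ioc_subset_Icc_self m1)
  have U2 := hαe.mem _ (Ioc_subset_Icc_self m2)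
  have p1 := hD.sep_pos hx U1 (hαe.chronO m1)
  have p2 := hD.sep_pos hx U2 (hαe.chronO m2)
  have hlt := hαe.sep_lt_sep hD (Ioc_subset_Icc_self m1) (Ioc_subset_Icc_self m2) he2e
  have hs2 := hδ _ p2.le heδ
  have hs1 := hδ _ p1.le (hlt.trans heδ)
  have ht := hlim (e / 2) ⟨he2.le, he2e.le.trans heB⟩
  have hone : hingeCosh K x (α (e / 2)) (α e) = 1 := by
    have := hαe.isSepAdditiveOn 0 ⟨le_rfl, he.le⟩ _ (Ioc_subset_Icc_self m1) _
      (Ioc_subset_Icc_self m2) he2.le he2e.le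
    rw [hα0] at this
    rw [hingeCosh, show sep (α (e / 2)) (α e) = sep x (α e) - sep x (α (e / 2)) by linarith]
    exact angleCosh_sub p1 p2 hs1 hs2
  refine LorentzianPreLengthSpace.tendsto_upperAngle_zero (K := K) hD ⟨e, hαe.toIsTimelikeRay⟩
    (fun n => ?_) fun C hC => ?_
  · obtain ⟨c, -, -, h⟩ := (hαs n).exists_isGeodesicRay hX hD hx hB (hαs0 n)
    exact ⟨c, h.toIsTimelikeRay⟩
  have T1 := hD.tendsto_hingeCosh (K := K) hx U1 U2 p1 p2 hs1 hs2 ht (tendsto_const_nhds (x := α e))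
  rw [hone] at T1
  filter_upwards [hmem, T1.eventually (gt_mem_nhds hC),
    eventually_chronO (hαe.isTimelike _ (Ioc_subset_Icc_self m1) _ (Ioc_subset_Icc_self m2) he2e)
      ht (tendsto_const_nhds (x := α e)),
    (hD.tendsto_sep hx U1 tendsto_const_nhds ht).eventually (gt_mem_nhds (hlt.trans heδ))]
    with n hn h1 h2 h3
  have hn' : ∀ s ∈ Icc 0 (e / 2), αs n s ∈ U := fun s hs => hn s ⟨hs.1, by linarith [hs.2]⟩
  have hray : IsGeodesicRay o U x (αs n) (e / 2) := by
    have hI : Icc 0 (e / 2) ⊆ Icc 0 B := Icc_subset_Icc_right (by linarith)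
    have hcc := (hαs n).isGeodesic.isCausalCurve.mono hI ordConnected_Icc
      ⟨0, ⟨le_rfl, he2.le⟩, e / 2, ⟨he2.le, le_rfl⟩, he2.ne⟩
    exact ⟨⟨he2, hαs0 n, hn', hcc.locallyLipschitz.continuousOn,
      fun s hs t ht => (hαs n).isTimelike s (hI hs) t (hI ht)⟩, hcc,
      hU.isSepAdditiveOn hX (hαs n) he2 (by linarith) hn'
        (by rw [hαs0 n]; exact hδ _ (sep_nonneg _ _) h3)⟩
  have m3 : e / 2 ∈ Ioc 0 (e / 2) := ⟨he2, le_rfl⟩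
  refine ⟨e / 2, he2, fun s hs t ht _ => le_trans ?_ h1.le⟩
  exact hU.angleCosh_le hx (hn' _ (Ioc_subset_Icc_self m3)) U2 (hray.chronO m3) h2 hs2
    (hray.onRealizerO hD m3 ⟨hs.1.le, hs.2.le⟩) (hαe.onRealizerO hD m2 ⟨ht.1.le, by linarith [ht.2]⟩)
    (hray.chronO ⟨hs.1, hs.2.le⟩) (hαe.chronO ⟨ht.1, by linarith [ht.2]⟩)

end Limits


/-! ### Vanishing angles under a lower curvature bound -/

section LowerBound

variable {X : Type*} [MetricSpace X] [LorentzianPreLengthSpace X] {o : TimeOrientation}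
  {U : Set X} {K : ℝ} {p x y z : X} {α : ℝ → X} {αs : ℕ → ℝ → X} {b B : ℝ}

/-- Under a lower curvature bound, the angles of a geodesic and of its prolongation beyond `x`
with another geodesic compare like supplementary angles. -/
lemma IsComparisonNhdBelow.hingeCosh_le_neg (hU : IsComparisonNhdBelow K U) (hp : p ∈ U)
    (hx : x ∈ U) (hy : y ∈ U) (hz : z ∈ U) (hpx : chronO o p x) (hxy : chronO o x y)
    (hxz : chronO o x z) (hyz : chronO o y z ∨ chronO o z y) (hsy : IsSize K (sep p y))
    (hsz : IsSize K (sep p z)) (hline : OnRealizerO o U p y x) :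
    hingeCosh K x y z ≤ -hingeCosh K x p z := by
  have hD := hU.toIsComparisonDomain
  have cpx := causO_of_chronO hpx
  have hpy := chronO_of_causO_of_chronO cpx hxy
  have hpz := chronO_of_causO_of_chronO cpx hxz
  have hadd := (hline.additive hD).2.2.2
  have htri := hD.sep_triangle hp hx hz cpx (causO_of_chronO hxz)
  have ppx := hD.sep_pos hp hx hpx
  -- Monotonicity at `p`: replacing `y` by the nearer point `x` of the same realizer does not
  -- decrease the signed cosine with the side to `z`. This is the hypothesis of `angleCosh_stewart`;
  -- its two cases are the chronological orders of `y` and `z`.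
  have key : angleCosh K (sep p x + sep x y) (sep p z) (sep y z) ≤
      angleCosh K (sep p x) (sep p z) (sep x z) := by
    rw [← hadd]
    rcases hyz with h | h
    · exact hU.le_angleCosh hp hy hz hpy h hsz hline (exists_onRealizerO hD hp hz hpz).2 hpx hpz
        (Or.inl hxz)
    · have := hU.le_angleCosh hp hz hy hpz h hsy (exists_onRealizerO hD hp hz hpz).2 hline hpz hpx
        (Or.inr hxz)
      rwa [angleCosh_comm, sep_comm z y, angleCosh_comm K (sep p z), sep_comm z x] at this
  have := angleCosh_stewart ppx (hD.sep_pos hx hy hxy) (hD.sep_pos hp hz hpz)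
    (hD.sep_pos hx hz hxz) (hadd ▸ hsy) hsz (hsz.mono (sep_nonneg _ _) (by linarith)) key
  rwa [sep_comm p x] at this

/-- A bound for the comparison angles of timelike related points of two curves also holds for
causally related points. -/
lemma hingeCosh_le_of_causO (hU : IsComparisonDomain U) {β : ℝ → X} {C : ℝ}
    (hα : IsTimelikeRay o U x α b) (hβ : IsTimelikeRay o U x β b)
    (hsα : IsSize K (sep x (α b))) (hsβ : IsSize K (sep x (β b)))
    (h : ∀ s ∈ Ioc 0 b, ∀ t ∈ Ioc 0 b, chronO o (α s) (β t) ∨ chronO o (β t) (α s) →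
      hingeCosh K x (α s) (β t) ≤ C) {s t : ℝ} (hs : s ∈ Ioo 0 b) (ht : t ∈ Ioo 0 b)
    (hr : causO o (α s) (β t)) : hingeCosh K x (α s) (β t) ≤ C := by
  have hs' := Ioo_subset_Ioc_self hs
  have ht' := Ioo_subset_Ioc_self ht
  have mb : b ∈ Icc 0 b := ⟨hα.pos.le, le_rfl⟩
  have mx := hα.mem_source
  have ms := hα.mem s (Ioc_subset_Icc_self hs')
  have mt := hβ.mem t (Ioc_subset_Icc_self ht')
  have hmem : Icc 0 b ∈ 𝓝[>] t :=
    mem_of_superset (Ioo_mem_nhdsGT ht.2) fun u hu => ⟨ht.1.le.trans hu.1.le, hu.2.le⟩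
  have hcont : Tendsto β (𝓝[>] t) (𝓝 (β t)) :=
    (hβ.continuousOn t (Ioc_subset_Icc_self ht')).mono_left (nhdsWithin_le_of_mem hmem)
  have T := hU.tendsto_hingeCosh (K := K) mx ms mt (hU.sep_pos mx ms (hα.chronO hs'))
    (hU.sep_pos mx mt (hβ.chronO ht'))
    (hsα.mono (sep_nonneg _ _) (hα.sep_lt_sep hU (Ioc_subset_Icc_self hs') mb hs.2).le)
    (hsβ.mono (sep_nonneg _ _) (hβ.sep_lt_sep hU (Ioc_subset_Icc_self ht') mb ht.2).le)
    (tendsto_const_nhds (x := α s)) hcont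
  -- Moving `β t` along `β` turns the causal relation into a timelike one, as `α s ≤ β t ≪ β u` in
  -- the sense of `o`; the bound then passes to the limit `u ↓ t`.
  refine le_of_tendsto T ?_
  filter_upwards [Ioo_mem_nhdsGT ht.2] with u hu
  have mu : u ∈ Ioc 0 b := ⟨ht.1.trans hu.1, hu.2.le⟩
  exact h s hs' u mu (Or.inl (chronO_of_causO_of_chronO hr
    (hβ.isTimelike t (Ioc_subset_Icc_self ht') u (Ioc_subset_Icc_self mu) hu.1)))

/-- A geodesic from `x` that can be prolonged beyond `x` is locally a distance realizer around
`x`. -/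
lemma exists_prolongation (hX : IsLocallyTauFinite X) (hprol : GeodesicProlongation X)
    (hU : IsComparisonDomain U) (hx : x ∈ U) (hB : 0 < B)
    (hα : IsTimelikeGeodesic o α (Icc 0 B)) (hα0 : α 0 = x) {δ c : ℝ} (hδ : 0 < δ)
    (hc : c ∈ Ioc 0 B) : ∃ r > 0, r ≤ c ∧ ∃ γ : ℝ → X, EqOn γ α (Icc 0 r) ∧ (∀ t ∈ Icc (-r) r, γ t ∈ U) ∧
      IsCausalCurve o γ (Icc (-r) r) ∧ IsSepAdditiveOn γ (Icc (-r) r) ∧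
      IsTimelikeOn o γ (Icc (-r) r) ∧ sep (γ (-r)) (γ r) < δ := by
  obtain ⟨a, e, γ, ha, he, hγ, hEq⟩ := hprol o α 0 B hα.isGeodesic
  have m0 : (0 : ℝ) ∈ Ioo a e := ⟨ha, hB.trans he⟩
  have hγ0 : γ 0 = x := (hEq ⟨le_rfl, hB.le⟩).trans hα0
  obtain ⟨a', b', h1, h2, h3⟩ := hγ.exists_isTauAdditiveOn hX m0
  rw [isOpen_Ioo.nhdsWithin_eq m0] at h2
  have hcont : ContinuousAt γ 0 :=
    hγ.isCausalCurve.locallyLipschitz.continuousOn.continuousAt (isOpen_Ioo.mem_nhds m0)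
  have hct : Tendsto γ (𝓝 0) (𝓝 x) := hγ0 ▸ hcont
  have hneg : Tendsto (fun r : ℝ => γ (-r)) (𝓝 0) (𝓝 x) :=
    hct.comp (by simpa using (continuous_neg (G := ℝ)).tendsto 0)
  have hsep := hU.tendsto_sep hx hx hneg hct
  rw [hU.sep_self hx] at hsep
  obtain ⟨d, hd, hd'⟩ := Metric.mem_nhds_iff.1 (inter_mem (inter_mem h2
    (hct (hU.isOpen.mem_nhds hx))) (hsep.eventually (gt_mem_nhds hδ)))
  have hr : 0 < min (d / 2) c := lt_min (half_pos hd) hc.1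
  have hrd : min (d / 2) c < d := (min_le_left _ _).trans_lt (half_lt_self hd)
  have hrB : min (d / 2) c ≤ B := (min_le_right _ _).trans hc.2
  have hrc : min (d / 2) c ≤ c := min_le_right _ _
  set r := min (d / 2) c
  have hball : ∀ t ∈ Icc (-r) r, t ∈ Metric.ball (0 : ℝ) d := fun t ht => by
    rw [mem_ball_zero_iff, Real.norm_eq_abs]
    exact (abs_le.2 ht).trans_lt hrd
  have hsub : Icc (-r) r ⊆ Icc a' b' := fun t ht => (hd' (hball t ht)).1.1
  have hmem : ∀ t ∈ Icc (-r) r, γ t ∈ U := fun t ht => (hd' (hball t ht)).1.2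
  have mr : r ∈ Icc (-r) r := ⟨by linarith, le_rfl⟩
  have mr' : -r ∈ Icc (-r) r := ⟨le_rfl, by linarith⟩
  have mz : (0 : ℝ) ∈ Icc (-r) r := ⟨by linarith, hr.le⟩
  have hcc : IsCausalCurve o γ (Icc (-r) r) := hγ.isCausalCurve.mono (hsub.trans h1)
    ordConnected_Icc ⟨-r, mr', r, mr, by linarith⟩
  have hadd : IsSepAdditiveOn γ (Icc (-r) r) := (isTauAdditiveOn_iff hU hcc hmem).1
    fun s hs t ht u hu => h3 s (hsub hs) t (hsub ht) u (hsub hu)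
  refine ⟨r, hr, hrc, γ, hEq.mono (Icc_subset_Icc_right hrB), hmem, hcc, hadd,
    hU.isTimelikeOn hcc hmem hadd ?_, (hd' (hball r mr)).2⟩
  -- The prolongation is only known to be causal. Its endpoints are nevertheless timelike related,
  -- because the part along `α` is timelike, and realizers between such points are timelike by
  -- strict connectedness.
  refine chronO_of_causO_of_chronO (hcc.causO_of_le mr' mz (by linarith)) ?_
  rw [hEq ⟨le_rfl, hB.le⟩, hEq ⟨hr.le, hrB⟩]
  exact hα.isTimelike 0 ⟨le_rfl, hB.le⟩ r ⟨hr.le, hrB⟩ hr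

/-- Under a lower curvature bound, the angle between a limit geodesic and the geodesics of the
sequence tends to zero. -/
lemma IsComparisonNhdBelow.tendsto_upperAngle_zero (hX : IsLocallyTauFinite X)
    (hprol : GeodesicProlongation X) (hU : IsComparisonNhdBelow K U) (hx : x ∈ U) (hB : 0 < B)
    (hα : IsTimelikeGeodesic o α (Icc 0 B)) (hαs : ∀ n, IsTimelikeGeodesic o (αs n) (Icc 0 B))
    (hα0 : α 0 = x) (hαs0 : ∀ n, αs n 0 = x)
    (hlim : ∀ s ∈ Icc 0 B, Tendsto (fun n => αs n s) atTop (𝓝 (α s))) (hb : b ∈ Ioc 0 B)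
    (hmem : ∀ᶠ n in atTop, ∀ s ∈ Icc 0 b, αs n s ∈ U) {b' : ℝ} (hb' : b' ∈ Ioc 0 B)
    (hreal : ∀ᶠ n in atTop, IsDistanceRealizer o (αs n) 0 b') :
    Tendsto (fun n => upperAngle (αs n) α) atTop (𝓝 0) := by
  have hD := hU.toIsComparisonDomain
  obtain ⟨δ, hδ, hK⟩ := exists_isSize K
  obtain ⟨r, hr, hrm, γ, hEq, hγU, hγc, hγadd, hγt, hγδ⟩ := exists_prolongation hX hprol hD hx hB hα
    hα0 hδ (c := min b b') ⟨lt_min hb.1 hb'.1, (min_le_left _ _).trans hb.2⟩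
  have hrb := hrm.trans (min_le_left _ _)
  have hrb' := hrm.trans (min_le_right _ _)
  have hrB := hrb.trans hb.2
  have hI : Icc 0 r ⊆ Icc (-r) r := Icc_subset_Icc_left (by linarith)
  have mr : r ∈ Icc (-r) r := ⟨by linarith, le_rfl⟩
  have mr' : -r ∈ Icc (-r) r := ⟨le_rfl, by linarith⟩
  have mz : (0 : ℝ) ∈ Icc (-r) r := ⟨by linarith, hr.le⟩
  have mb : r ∈ Ioc 0 r := ⟨hr, le_rfl⟩
  have hγ0 : γ 0 = x := (hEq ⟨le_rfl, hr.le⟩).trans hα0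
  have hpU := hγU _ mr'
  set p := γ (-r) with hp
  have hpx : chronO o p x := hγ0 ▸ hγt _ mr' _ mz (by linarith)
  have hαr : IsTimelikeRay o U x α r := by
    refine ⟨hr, hα0, fun s hs => hEq hs ▸ hγU s (hI hs), ?_,
      fun s hs t ht => hα.isTimelike s ⟨hs.1, hs.2.trans hrB⟩ t ⟨ht.1, ht.2.trans hrB⟩⟩
    exact hα.isGeodesic.isCausalCurve.locallyLipschitz.continuousOn.mono
      (Icc_subset_Icc_right hrB)
  rw [hEq ⟨hr.le, le_rfl⟩] at hγδ
  have hxr : chronO o x (α r) := hαr.chronO mb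
  have Ur := hαr.mem r (Ioc_subset_Icc_self mb)
  have hadd : sep p (α r) = sep p x + sep x (α r) := by
    have := hγadd _ mr' _ mz _ mr (by linarith) hr.le
    rwa [hγ0, hEq ⟨hr.le, le_rfl⟩] at this
  have ppx := hD.sep_pos hpU hx hpx
  have pxr := hD.sep_pos hx Ur hxr
  have hspx : IsSize K (sep p x) := hK _ ppx.le (by linarith)
  have hsxr : IsSize K (sep x (α r)) := hK _ pxr.le (by linarith)
  have hlr := hlim r ⟨hr.le, hrB⟩
  -- The point `x` lies on a realizer from `p` to `α r`, so this triangle is degenerate with a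
  -- straight angle at `x`.
  have hneg : hingeCosh K x (α r) p = -1 := by
    rw [hingeCosh, sep_comm (α r) p, hadd, sep_comm p x, add_comm]
    exact angleCosh_add pxr (sep_comm p x ▸ ppx) hsxr (sep_comm p x ▸ hspx)
  have T1 := hD.tendsto_hingeCosh (K := K) hx Ur hpU pxr (sep_comm p x ▸ ppx) hsxr
    (sep_comm p x ▸ hspx) hlr (tendsto_const_nhds (x := p))
  rw [hneg] at T1
  refine LorentzianPreLengthSpace.tendsto_upperAngle_zero (K := K) hD ⟨r, hαr⟩
    (fun n => ?_) fun C hC => ?_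
  · obtain ⟨c, -, -, h⟩ := (hαs n).exists_isGeodesicRay hX hD hx hB (hαs0 n)
    exact ⟨c, h.toIsTimelikeRay⟩
  filter_upwards [hmem, hreal, T1.eventually (lt_mem_nhds (neg_lt_neg hC)),
    (hD.tendsto_sep hpU Ur tendsto_const_nhds hlr).eventually (gt_mem_nhds hγδ)]
    with n hnU hn h1 h2
  have hn' : ∀ s ∈ Icc 0 r, αs n s ∈ U := fun s hs => hnU s ⟨hs.1, hs.2.trans hrb⟩
  have hray : IsGeodesicRay o U x (αs n) r := by
    have hsub : Icc 0 r ⊆ Icc 0 b' := Icc_subset_Icc_right hrb'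
    have hcc := hn.isCausalCurve.mono hsub ordConnected_Icc
      ⟨0, ⟨le_rfl, hr.le⟩, r, ⟨hr.le, le_rfl⟩, hr.ne⟩
    have hta := (isTauAdditiveOn_of_eq_tauLength hn.isCausalCurve subset_rfl hn.tau_eq_length
      (hX.tauLength_lt_top hn.isCausalCurve.locallyLipschitz.continuousOn hb'.1.le)).1
    exact ⟨⟨hr, hαs0 n, hn', hcc.locallyLipschitz.continuousOn,
      fun s hs t ht => (hαs n).isTimelike s ⟨hs.1, hs.2.trans hrB⟩ t ⟨ht.1, ht.2.trans hrB⟩⟩, hcc,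
      (isTauAdditiveOn_iff hD hcc hn').1 fun s hs t ht u hu => hta s (hsub hs) t (hsub ht) u (hsub hu)⟩
  have Un := hn' r (Ioc_subset_Icc_self mb)
  have hxp : chronO o.rev x p := chronO_rev.2 hpx
  have hsn : IsSize K (sep (αs n r) p) := by rw [sep_comm]; exact hK _ (sep_nonneg _ _) h2
  have hle : ∀ s ∈ Ioc 0 r, ∀ β : ℝ → X, IsTimelikeRay o U x β r → sep p (β r) < δ →
      IsSize K (sep p (β s)) := by
    intro s hs β hβ hβδ
    refine hK _ (sep_nonneg _ _) (lt_of_le_of_lt ?_ hβδ)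
    rcases hs.2.eq_or_lt with h | h
    · rw [h]
    · have := hD.sep_triangle hpU (hβ.mem s (Ioc_subset_Icc_self hs))
        (hβ.mem r (Ioc_subset_Icc_self mb)) (causO_trans (causO_of_chronO hpx)
        (causO_of_chronO (hβ.chronO hs))) (causO_of_chronO (hβ.isTimelike s
          (Ioc_subset_Icc_self hs) r (Ioc_subset_Icc_self mb) h))
      linarith [sep_nonneg (β s) (β r)]
  have strict : ∀ s ∈ Ioc 0 r, ∀ t ∈ Ioc 0 r, chronO o (α t) (αs n s) ∨ chronO o (αs n s) (α t) →
      hingeCosh K x (αs n s) (α t) ≤ C := by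
    intro s hs t ht hst
    have hline : OnRealizerO o U p (α t) x := by
      have hsub : Icc (-r) t ⊆ Icc (-r) r := Icc_subset_Icc_right ht.2
      have := onRealizerO_of_isSepAdditiveOn hD hγc hsub (hγadd.mono hsub)
        (fun u hu => hγU u (hsub hu)) (by linarith [ht.1]) (t := 0) ⟨by linarith, ht.1.le⟩
      rwa [hγ0, hEq (Ioc_subset_Icc_self ht)] at this
    -- Passing to the supplementary angle with the prolongation replaces equal orientations by
    -- opposite ones. There monotonicity bounds the signed cosine at `αs n s` from below by its
    -- value at the fixed parameter `r`, which is above `-C`.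
    have k1 := hU.hingeCosh_le_neg hpU hx (hαr.mem t (Ioc_subset_Icc_self ht))
      (hn' s (Ioc_subset_Icc_self hs)) hpx (hαr.chronO ht) (hray.chronO hs) hst
      (hle t ht α hαr hγδ) (hle s hs _ hray.toIsTimelikeRay h2) hline
    have k2 := hU.le_hingeCosh_of_different hx Un hpU (hray.chronO mb) hxp hsn
      (hray.onRealizerO hD mb (Ioc_subset_Icc_self hs))
      (exists_onRealizerO hD hx hpU hxp).2 (hray.chronO hs) hxp
    rw [hingeCosh_comm K x (α t), hingeCosh_comm K x p] at k1
    linarith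
  have hsnr : IsSize K (sep x (αs n r)) := by
    have := hD.sep_triangle hpU hx Un (causO_of_chronO hpx) (causO_of_chronO (hray.chronO mb))
    exact hK _ (sep_nonneg _ _) (by linarith)
  refine ⟨r, hr, fun s hs t ht hst => ?_⟩
  rcases hst with h | h
  · exact hingeCosh_le_of_causO hD hray.toIsTimelikeRay hαr hsnr hsxr
      (fun s hs t ht hst => strict s hs t ht hst.symm) hs ht h
  · rw [hingeCosh_comm]
    refine hingeCosh_le_of_causO hD hαr hray.toIsTimelikeRay hsxr hsnr
      (fun t ht s hs hst => ?_) ht hs h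
    rw [hingeCosh_comm]
    exact strict s hs t ht hst

end LowerBound


/-! ### Continuity of angles -/

section Continuity

variable {X : Type*} [MetricSpace X] [LorentzianPreLengthSpace X] {o o₁ o₂ : TimeOrientation}
  {U : Set X} {x : X} {α β γ : ℝ → X}

/-- Angles at `x` between timelike geodesics of different time orientations are limits. -/
def AnglesAreLimits (U : Set X) (x : X) : Prop :=
  ∀ (o : TimeOrientation) (α γ : ℝ → X) (b : ℝ), IsGeodesicRay o U x α b →
    IsGeodesicRay o.rev U x γ b → ∀ A > 0, ENNReal.ofReal A < upperAngle α γ →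
    ∃ δ > 0, ∀ s ∈ Ioo 0 δ, ∀ t ∈ Ioo 0 δ, Real.cosh A < -hingeCosh 0 x (α s) (γ t)

/-- The triangle inequality for angles, the first two curves having the same time orientation. -/
lemma upperAngle_le_add_of_isGeodesicRay (hU : IsComparisonDomain U) (hL : AnglesAreLimits U x)
    (hα : ∃ b, IsGeodesicRay o₁ U x α b) (hβ : ∃ b, IsGeodesicRay o₁ U x β b)
    (hγ : ∃ b, IsGeodesicRay o₂ U x γ b) :
    upperAngle α γ ≤ upperAngle α β + upperAngle β γ := by
  obtain ⟨a, hα⟩ := hα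
  obtain ⟨b, hβ⟩ := hβ
  obtain ⟨c, hγ⟩ := hγ
  have hp := lt_min hα.pos (lt_min hβ.pos hγ.pos)
  have hα := hα.restrict hp (min_le_left _ _)
  have hβ := hβ.restrict hp ((min_le_right _ _).trans (min_le_left _ _))
  have hγ := hγ.restrict hp ((min_le_right _ _).trans (min_le_right _ _))
  have h : o₂ = o₁ ∨ o₂ = o₁.rev := by cases o₁ <;> cases o₂ <;> simp [TimeOrientation.rev]
  rcases h with rfl | rfl
  · exact upperAngle_le_add hU hα.toIsTimelikeRay hβ.toIsTimelikeRay hγ.toIsTimelikeRay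
  · exact upperAngle_le_add_of_different hU hα.toIsTimelikeRay hβ.toIsTimelikeRay
      hγ.toIsTimelikeRay (hL _ _ _ _ hα hγ)

/-- Two triangle inequalities in each direction squeeze the angles. Writing the lower estimate with
truncated subtraction in `[0, ∞]` covers infinite angles at the same time. -/
lemma tendsto_upperAngle (hU : IsComparisonDomain U) (hL : AnglesAreLimits U x)
    {αs βs : ℕ → ℝ → X}
    (hα : ∃ b, IsGeodesicRay o₁ U x α b) (hβ : ∃ b, IsGeodesicRay o₂ U x β b)
    (hαs : ∀ n, ∃ b, IsGeodesicRay o₁ U x (αs n) b) (hβs : ∀ n, ∃ b, IsGeodesicRay o₂ U x (βs n) b)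
    (hαlim : Tendsto (fun n => upperAngle (αs n) α) atTop (𝓝 0))
    (hβlim : Tendsto (fun n => upperAngle (βs n) β) atTop (𝓝 0)) :
    Tendsto (fun n => upperAngle (αs n) (βs n)) atTop (𝓝 (upperAngle α β)) := by
  have src : ∀ {o : TimeOrientation} {α : ℝ → X}, (∃ b, IsGeodesicRay o U x α b) → α 0 = x :=
    fun ⟨_, h⟩ => h.source
  have comm : ∀ {o o' : TimeOrientation} {α β : ℝ → X}, (∃ b, IsGeodesicRay o U x α b) →
      (∃ b, IsGeodesicRay o' U x β b) → upperAngle α β = upperAngle β α :=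
    fun h h' => upperAngle_comm ((src h).trans (src h').symm)
  have hsum := hαlim.add hβlim
  rw [add_zero] at hsum
  have up : ∀ n, upperAngle (αs n) (βs n) ≤
      upperAngle (αs n) α + upperAngle (βs n) β + upperAngle α β := fun n => by
    refine (upperAngle_le_add_of_isGeodesicRay hU hL (hαs n) hα (hβs n)).trans ?_
    rw [add_assoc, comm hα (hβs n), comm hα hβ]
    gcongr
    exact upperAngle_le_add_of_isGeodesicRay hU hL (hβs n) hβ hα
  have low : ∀ n, upperAngle α β ≤
      upperAngle (αs n) α + upperAngle (βs n) β + upperAngle (αs n) (βs n) := fun n => by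
    refine (upperAngle_le_add_of_isGeodesicRay hU hL hα (hαs n) hβ).trans ?_
    rw [add_assoc, comm hα (hαs n), comm (hαs n) hβ, comm (hβs n) hβ, comm (hαs n) (hβs n)]
    gcongr
    exact upperAngle_le_add_of_isGeodesicRay hU hL hβ (hβs n) (hαs n)
  refine tendsto_of_tendsto_of_tendsto_of_le_of_le ?_ ?_ (fun n => tsub_le_iff_left.2 (low n)) up
  · have := ENNReal.Tendsto.sub (tendsto_const_nhds (x := upperAngle α β)) hsum
      (Or.inr ENNReal.zero_ne_top)
    rwa [tsub_zero] at this
  · have := hsum.add (tendsto_const_nhds (x := upperAngle α β))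
    rwa [zero_add] at this

lemma IsComparisonNhdAbove.anglesAreLimits {K : ℝ} (hU : IsComparisonNhdAbove K U) (x : X) :
    AnglesAreLimits U x :=
  fun _ _ _ _ hα hγ _ hA h => hU.exists_cosh_lt hα hγ hA h

lemma IsComparisonNhdBelow.anglesAreLimits {K : ℝ} (hU : IsComparisonNhdBelow K U) (x : X) :
    AnglesAreLimits U x :=
  fun _ _ _ _ hα hγ _ hA h => hU.exists_cosh_lt hα hγ hA h

lemma IsTimelikeGeodesic.exists_ray (hX : IsLocallyTauFinite X) (hU : IsComparisonDomain U)
    (hx : x ∈ U) {b : ℝ} (hb : 0 < b) (h : IsTimelikeGeodesic o α (Icc 0 b)) (hα : α 0 = x) :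
    ∃ c, IsGeodesicRay o U x α c := by
  obtain ⟨c, -, -, hc⟩ := h.exists_isGeodesicRay hX hU hx hb hα
  exact ⟨c, hc⟩

end Continuity

end LorentzianPreLengthSpace

end

open LorentzianPreLengthSpace in
theorem mainTheorem8 {X : Type*} [MetricSpace X] [LorentzianPreLengthSpace X]
    (hconn : LocallyStrictlyTimelikeGeodesicallyConnected X) (hclosed : LocallyCausallyClosed X)
    (x : X) (B : ℝ) (o₁ o₂ : TimeOrientation) (α β : ℝ → X) (αs βs : ℕ → ℝ → X)
    (hα : IsTimelikeGeodesic o₁ α (Icc 0 B)) (hαs : ∀ n, IsTimelikeGeodesic o₁ (αs n) (Icc 0 B))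
    (hβ : IsTimelikeGeodesic o₂ β (Icc 0 B)) (hβs : ∀ n, IsTimelikeGeodesic o₂ (βs n) (Icc 0 B))
    (hα0 : α 0 = x) (hαs0 : ∀ n, αs n 0 = x) (hβ0 : β 0 = x) (hβs0 : ∀ n, βs n 0 = x)
    (hαlim : ∀ s ∈ Icc 0 B, Tendsto (fun n => αs n s) atTop (𝓝 (α s)))
    (hβlim : ∀ s ∈ Icc 0 B, Tendsto (fun n => βs n s) atTop (𝓝 (β s)))
    (hcases :
      -- curvature bounded above, same time orientation
      (∃ K : ℝ, TimelikeCurvatureBoundedAbove X K ∧ o₁ = o₂ ∧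
        ∃ U : Set X, IsComparisonNhdAbove K U ∧ ∃ b ∈ Ioc 0 B, ∀ᶠ n in atTop,
          ∀ s ∈ Icc 0 b, αs n s ∈ U ∧ βs n s ∈ U) ∨
      -- curvature bounded above, different time orientation
      (∃ K : ℝ, TimelikeCurvatureBoundedAbove X K ∧ o₁ ≠ o₂ ∧ StronglyCausal X ∧
        upperAngle α β < ⊤ ∧ ∀ n, upperAngle α (βs n) < ⊤ ∧ upperAngle (αs n) (βs n) < ⊤) ∨
      -- curvature bounded below
      (∃ K : ℝ, TimelikeCurvatureBoundedBelow X K ∧ StronglyCausal X ∧ GeodesicProlongation X ∧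
        ∃ b ∈ Ioc 0 B, ∀ᶠ n in atTop,
          IsDistanceRealizer o₁ (αs n) 0 b ∧ IsDistanceRealizer o₂ (βs n) 0 b)) :
    Tendsto (fun n => upperAngle (αs n) (βs n)) atTop (𝓝 (upperAngle α β)) := by
  obtain ⟨w, hw, w', hw', hww⟩ := hα.isGeodesic.isCausalCurve.nontrivial
  have hB : 0 < B := by
    refine (hw.1.trans hw.2).lt_of_ne fun h => hww ?_
    rw [← h, Icc_self, mem_singleton_iff] at hw hw'
    rw [hw, hw']
  rcases hcases with ⟨K, hK, -, U, hU, b, hb, hmem⟩ | ⟨K, hK, -, hsc, -⟩ |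
    ⟨K, hK, hsc, hprol, b, hb, hreal⟩
  · have hX := hK.isLocallyTauFinite
    have hD := hU.toIsComparisonDomain
    have hx : x ∈ U := by
      obtain ⟨n, hn⟩ := hmem.exists
      rw [← hαs0 n]
      exact (hn 0 ⟨le_rfl, hb.1.le⟩).1
    exact tendsto_upperAngle hD (hU.anglesAreLimits x) (hα.exists_ray hX hD hx hB hα0)
      (hβ.exists_ray hX hD hx hB hβ0) (fun n => (hαs n).exists_ray hX hD hx hB (hαs0 n))
      (fun n => (hβs n).exists_ray hX hD hx hB (hβs0 n))
      (hU.tendsto_upperAngle_zero hX hx hB hα hαs hα0 hαs0 hαlim hb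
        (hmem.mono fun n hn s hs => (hn s hs).1))
      (hU.tendsto_upperAngle_zero hX hx hB hβ hβs hβ0 hβs0 hβlim hb
        (hmem.mono fun n hn s hs => (hn s hs).2))
  · have hX := hK.isLocallyTauFinite
    obtain ⟨U, hx, hU⟩ := hK x
    have hD := hU.toIsComparisonDomain
    -- Strong causality confines almost all curves of each sequence to the comparison neighbourhood
    -- on a common initial interval.
    obtain ⟨a, ha, hma⟩ := hsc.exists_eventually_mem hU.isOpen hx hB hα.isGeodesic.isCausalCurve
      (fun n => (hαs n).isGeodesic.isCausalCurve) hα0 hαs0 hαlim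
    obtain ⟨b, hb, hmb⟩ := hsc.exists_eventually_mem hU.isOpen hx hB hβ.isGeodesic.isCausalCurve
      (fun n => (hβs n).isGeodesic.isCausalCurve) hβ0 hβs0 hβlim
    exact tendsto_upperAngle hD (hU.anglesAreLimits x) (hα.exists_ray hX hD hx hB hα0)
      (hβ.exists_ray hX hD hx hB hβ0) (fun n => (hαs n).exists_ray hX hD hx hB (hαs0 n))
      (fun n => (hβs n).exists_ray hX hD hx hB (hβs0 n))
      (hU.tendsto_upperAngle_zero hX hx hB hα hαs hα0 hαs0 hαlim ha hma)
      (hU.tendsto_upperAngle_zero hX hx hB hβ hβs hβ0 hβs0 hβlim hb hmb)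
  · have hX := hK.isLocallyTauFinite
    obtain ⟨U, hx, hU⟩ := hK x
    have hD := hU.toIsComparisonDomain
    obtain ⟨a, ha, hma⟩ := hsc.exists_eventually_mem hU.isOpen hx hB hα.isGeodesic.isCausalCurve
      (fun n => (hαs n).isGeodesic.isCausalCurve) hα0 hαs0 hαlim
    obtain ⟨c, hc, hmc⟩ := hsc.exists_eventually_mem hU.isOpen hx hB hβ.isGeodesic.isCausalCurve
      (fun n => (hβs n).isGeodesic.isCausalCurve) hβ0 hβs0 hβlim
    exact tendsto_upperAngle hD (hU.anglesAreLimits x) (hα.exists_ray hX hD hx hB hα0)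
      (hβ.exists_ray hX hD hx hB hβ0) (fun n => (hαs n).exists_ray hX hD hx hB (hαs0 n))
      (fun n => (hβs n).exists_ray hX hD hx hB (hβs0 n))
      (hU.tendsto_upperAngle_zero hX hprol hx hB hα hαs hα0 hαs0 hαlim ha hma hb
        (hreal.mono fun n hn => hn.1))
      (hU.tendsto_upperAngle_zero hX hprol hx hB hβ hβs hβ0 hβs0 hβlim hc hmc hb
        (hreal.mono fun n hn => hn.2))
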